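/- Let $k$ be a field and let $H$ be a Hopf algebra over $k$ with bijective antipode. Let $A$ be a right $H$-comodule algebra, i.e. a (unital, associative) $k$-algebra with a right $H$-comodule structure $\delta\colon A\to A\otimes H$, $\delta(a)=a_{(0)}\otimes a_{(1)}$, that is an algebra homomorphism. Put $B:=\{b\in A\mid \delta(b)=b\otimes 1\}$, a subalgebra of $A$, and let $$\beta\colon A\otimes_B A\to A\otimes H,\qquad x\otimes y\mapsto xy_{(0)}\otimes y_{(1)},$$ be the Galois map; $A$ is called an $H$-Galois extension of $B$ if $\beta$ is bijective. Let $\mathcal M_A^H$ be the category of Hopf modules: right $A$-modules $M$ that are also right $H$-comodules such that $\delta(ma)=m_{(0)}a_{(0)}\otimes m_{(1)}a_{(1)}$ for all $m\in M$, $a\in A$, with the $A$-linear and $H$-colinear maps as morphisms. The induction functor $\mathrm{Mod}_B\to\mathcal M_A^H$ sends a right $B$-module $N$ to $N\otimes_B A$, with $A$-action $(n\otimes x)a=n\otimes xa$ and coaction $n\otimes a\mapsto (n\otimes a_{(0)})\otimes a_{(1)}$. The following are equivalent: 1. $\beta$ is surjective, and $A$ is injective as a right $H$-comodule. 2. $A$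 is an $H$-Galois extension of $B$ and a faithfully flat left $B$-module. 3. $A$ is an $H$-Galois extension of $B$ and a faithfully flat right $B$-module. 4. The induction functor $\mathrm{Mod}_B\to\mathcal M_A^H$ is an equivalence of categories. In this case $A$ is projective as a left and as a right $B$-module, and $B$ is a direct summand of $A$ both as a left and as a right $B$-module. -/

import Mathlib

open scoped TensorProduct

universe u t

namespace HopfGalois

open MulOpposite

/-! ### Comodules, comodule algebras, coinvariants -/

/-- A right comodule `M` over a coalgebra `C`: a coassociative and counital coaction
`δ : M → M ⊗ C`. -/
class RightComodule (k C M : Type*) [CommRing k] [AddCommGroup C] [Module k C] [Coalgebra k C]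
    [AddCommGroup M] [Module k M] where
  coact : M →ₗ[k] M ⊗[k] C
  coact_coassoc : (TensorProduct.assoc k M C C).toLinearMap ∘ₗ coact.rTensor C ∘ₗ coact =
    (Coalgebra.comul (R := k) (A := C)).lTensor M ∘ₗ coact
  coact_counit : (TensorProduct.rid k M).toLinearMap ∘ₗ
    (Coalgebra.counit (R := k) (A := C)).lTensor M ∘ₗ coact = LinearMap.id

/-- The coaction `δ : M → M ⊗ C`. -/
abbrev coaction (k C M : Type*) [CommRing k] [AddCommGroup C] [Module k C] [Coalgebra k C]
    [AddCommGroup M] [Module k M] [RightComodule k C M] : M →ₗ[k] M ⊗[k] C :=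
  RightComodule.coact

/-- A linear map is a comodule map (is colinear) if it commutes with the coactions. -/
def IsColinear (k C : Type*) {M N : Type*} [CommRing k] [AddCommGroup C] [Module k C]
    [Coalgebra k C] [AddCommGroup M] [Module k M] [RightComodule k C M]
    [AddCommGroup N] [Module k N] [RightComodule k C N] (f : M →ₗ[k] N) : Prop :=
  f.rTensor C ∘ₗ coaction k C M = coaction k C N ∘ₗ f

/-- Injectivity of a comodule `I`: every comodule map to `I` extends along every injective
comodule map (the test comodules live in `Type t`). -/
def IsInjectiveComodule (k C I : Type*) [CommRing k] [AddCommGroup C] [Module k C]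
    [Coalgebra k C] [AddCommGroup I] [Module k I] [RightComodule k C I] : Prop :=
  ∀ (X Y : Type t) [AddCommGroup X] [Module k X] [RightComodule k C X]
    [AddCommGroup Y] [Module k Y] [RightComodule k C Y]
    (i : X →ₗ[k] Y) (f : X →ₗ[k] I), IsColinear k C i → Function.Injective i → IsColinear k C f →
      ∃ g : Y →ₗ[k] I, IsColinear k C g ∧ g ∘ₗ i = f

/-- A right `H`-comodule algebra: an algebra `A` with a coaction `δ : A → A ⊗ H` which is
an algebra homomorphism. -/
class RightComoduleAlgebra (k H A : Type*) [CommRing k] [Ring H] [Bialgebra k H] [Ring A]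
    [Algebra k A] extends RightComodule k H A where
  coact_one : coact 1 = 1
  coact_mul : ∀ a b : A, coact (a * b) = coact a * coact b

section Coinvariants

variable (k H A : Type*) [CommRing k] [Ring H] [Bialgebra k H] [Ring A] [Algebra k A]
  [RightComoduleAlgebra k H A]

theorem coaction_one : coaction k H A 1 = 1 := RightComoduleAlgebra.coact_one

theorem coaction_mul (a b : A) :
    coaction k H A (a * b) = coaction k H A a * coaction k H A b :=
  RightComoduleAlgebra.coact_mul a b

/-- The subalgebra of coinvariants `{b ∈ A | δ(b) = b ⊗ 1}`. -/
def coinvariants : Subalgebra k A where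
  carrier := {b | coaction k H A b = b ⊗ₜ[k] 1}
  mul_mem' {a b} ha hb := by
    simp only [Set.mem_ofPred_eq] at ha hb ⊢
    rw [coaction_mul, ha, hb, Algebra.TensorProduct.tmul_mul_tmul, one_mul]
  add_mem' {a b} ha hb := by
    simp only [Set.mem_ofPred_eq] at ha hb ⊢
    rw [map_add, ha, hb, TensorProduct.add_tmul]
  algebraMap_mem' r := by
    simp only [Set.mem_ofPred_eq]
    rw [Algebra.algebraMap_eq_smul_one, map_smul, coaction_one, Algebra.TensorProduct.one_def,
      TensorProduct.smul_tmul']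

theorem coaction_coe_mul (b : coinvariants k H A) (a : A) :
    coaction k H A ((b : A) * a) = ((b : A) ⊗ₜ[k] (1 : H)) * coaction k H A a := by
  rw [coaction_mul, show coaction k H A (b : A) = (b : A) ⊗ₜ[k] 1 from b.2]

end Coinvariants

/-! ### Tensor products over a noncommutative algebra

Right modules over a ring `R` are modules over `Rᵐᵒᵖ`; `op r • n` is `n r`. -/

section Balanced

variable (k R N M : Type*) [CommRing k] [Ring R]
  [AddCommGroup N] [Module k N] [Module Rᵐᵒᵖ N] [AddCommGroup M] [Module k M] [Module R M]

/-- The subspace of `N ⊗ M` spanned by all `n r ⊗ m - n ⊗ r m`. -/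
def balancedRel : Submodule k (N ⊗[k] M) :=
  Submodule.span k {x | ∃ (n : N) (r : R) (m : M), x = (op r • n) ⊗ₜ[k] m - n ⊗ₜ[k] (r • m)}

/-- The tensor product of a right `R`-module `N` and a left `R`-module `M` over the `k`-algebra
`R`. -/
def BalancedTensor : Type _ := (N ⊗[k] M) ⧸ balancedRel k R N M

noncomputable instance : AddCommGroup (BalancedTensor k R N M) :=
  inferInstanceAs (AddCommGroup ((N ⊗[k] M) ⧸ balancedRel k R N M))

noncomputable instance : Module k (BalancedTensor k R N M) :=
  inferInstanceAs (Module k ((N ⊗[k] M) ⧸ balancedRel k R N M))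

namespace BalancedTensor

/-- The quotient map from the tensor product over `k` to the tensor product over `R`. -/
noncomputable def mk : N ⊗[k] M →ₗ[k] BalancedTensor k R N M := (balancedRel k R N M).mkQ

variable {k N M}

theorem mk_smul_tmul (n : N) (r : R) (m : M) :
    mk k R N M ((op r • n) ⊗ₜ[k] m) = mk k R N M (n ⊗ₜ[k] (r • m)) := by
  rw [← sub_eq_zero, ← map_sub]
  exact (Submodule.Quotient.mk_eq_zero _).2 (Submodule.subset_span ⟨n, r, m, rfl⟩)

variable {R}

/-- Linear maps out of the tensor product over `R`, from balanced maps. -/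
noncomputable def lift {P : Type*} [AddCommGroup P] [Module k P] (f : N ⊗[k] M →ₗ[k] P)
    (hf : ∀ (n : N) (r : R) (m : M), f ((op r • n) ⊗ₜ[k] m) = f (n ⊗ₜ[k] (r • m))) :
    BalancedTensor k R N M →ₗ[k] P :=
  (balancedRel k R N M).liftQ f <| by
    rw [balancedRel, Submodule.span_le]
    rintro _ ⟨n, r, m, rfl⟩
    simp [hf]

@[simp]
theorem lift_mk {P : Type*} [AddCommGroup P] [Module k P] (f : N ⊗[k] M →ₗ[k] P)
    (hf : ∀ (n : N) (r : R) (m : M), f ((op r • n) ⊗ₜ[k] m) = f (n ⊗ₜ[k] (r • m)))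
    (x : N ⊗[k] M) : lift f hf (mk k R N M x) = f x :=
  Submodule.liftQ_apply _ _ _

theorem hom_ext {P : Type*} [AddCommGroup P] [Module k P] {f g : BalancedTensor k R N M →ₗ[k] P}
    (h : ∀ (n : N) (m : M), f (mk k R N M (n ⊗ₜ[k] m)) = g (mk k R N M (n ⊗ₜ[k] m))) : f = g :=
  Submodule.linearMap_qext _ (TensorProduct.ext' h)

/-- The map `f ⊗ g` of tensor products over `R`. -/
noncomputable def map [Algebra k R] [IsScalarTower k Rᵐᵒᵖ N] [IsScalarTower k R M]
    {N' M' : Type*} [AddCommGroup N'] [Module k N'] [Module Rᵐᵒᵖ N'] [IsScalarTower k Rᵐᵒᵖ N']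
    [AddCommGroup M'] [Module k M'] [Module R M'] [IsScalarTower k R M']
    (f : N →ₗ[Rᵐᵒᵖ] N') (g : M →ₗ[R] M') :
    BalancedTensor k R N M →ₗ[k] BalancedTensor k R N' M' :=
  lift (mk k R N' M' ∘ₗ TensorProduct.map (f.restrictScalars k) (g.restrictScalars k)) <| by
    intro n r m
    simp [mk_smul_tmul]

@[simp]
theorem map_mk_tmul [Algebra k R] [IsScalarTower k Rᵐᵒᵖ N] [IsScalarTower k R M]
    {N' M' : Type*} [AddCommGroup N'] [Module k N'] [Module Rᵐᵒᵖ N'] [IsScalarTower k Rᵐᵒᵖ N']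
    [AddCommGroup M'] [Module k M'] [Module R M'] [IsScalarTower k R M']
    (f : N →ₗ[Rᵐᵒᵖ] N') (g : M →ₗ[R] M') (n : N) (m : M) :
    map (k := k) f g (mk k R N M (n ⊗ₜ[k] m)) = mk k R N' M' (f n ⊗ₜ[k] g m) := by
  simp [map]

end BalancedTensor

end Balanced

/-- A left `R`-module `M` is faithfully flat if a sequence of right `R`-modules `N₁ → N₂ → N₃` is
exact if and only if `N₁ ⊗_R M → N₂ ⊗_R M → N₃ ⊗_R M` is exact (the test modules live in
`Type t`). -/
def IsLeftFaithfullyFlat (k R M : Type*) [CommRing k] [Ring R] [Algebra k R]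
    [AddCommGroup M] [Module k M] [Module R M] [IsScalarTower k R M] : Prop :=
  ∀ (N₁ N₂ N₃ : Type t)
    [AddCommGroup N₁] [Module k N₁] [Module Rᵐᵒᵖ N₁] [IsScalarTower k Rᵐᵒᵖ N₁]
    [AddCommGroup N₂] [Module k N₂] [Module Rᵐᵒᵖ N₂] [IsScalarTower k Rᵐᵒᵖ N₂]
    [AddCommGroup N₃] [Module k N₃] [Module Rᵐᵒᵖ N₃] [IsScalarTower k Rᵐᵒᵖ N₃]
    (f : N₁ →ₗ[Rᵐᵒᵖ] N₂) (g : N₂ →ₗ[Rᵐᵒᵖ] N₃),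
    Function.Exact f g ↔ Function.Exact
      (BalancedTensor.map (k := k) f (LinearMap.id : M →ₗ[R] M))
      (BalancedTensor.map (k := k) g (LinearMap.id : M →ₗ[R] M))

/-- A right `R`-module `N` is faithfully flat if a sequence of left `R`-modules `M₁ → M₂ → M₃` is
exact if and only if `N ⊗_R M₁ → N ⊗_R M₂ → N ⊗_R M₃` is exact (the test modules live in
`Type t`). -/
def IsRightFaithfullyFlat (k R N : Type*) [CommRing k] [Ring R] [Algebra k R]
    [AddCommGroup N] [Module k N] [Module Rᵐᵒᵖ N] [IsScalarTower k Rᵐᵒᵖ N] : Prop :=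
  ∀ (M₁ M₂ M₃ : Type t)
    [AddCommGroup M₁] [Module k M₁] [Module R M₁] [IsScalarTower k R M₁]
    [AddCommGroup M₂] [Module k M₂] [Module R M₂] [IsScalarTower k R M₂]
    [AddCommGroup M₃] [Module k M₃] [Module R M₃] [IsScalarTower k R M₃]
    (f : M₁ →ₗ[R] M₂) (g : M₂ →ₗ[R] M₃),
    Function.Exact f g ↔ Function.Exact
      (BalancedTensor.map (k := k) (LinearMap.id : N →ₗ[Rᵐᵒᵖ] N) f)
      (BalancedTensor.map (k := k) (LinearMap.id : N →ₗ[Rᵐᵒᵖ] N) g)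

/-! ### A ring as a right module over a subalgebra -/

section Subalgebra

variable {k A : Type*} [CommRing k] [Ring A] [Algebra k A] (B : Subalgebra k A)

/-- `A` is a right `B`-module by right multiplication. -/
instance rightModule : Module (B)ᵐᵒᵖ A :=
  Module.compHom A (B.val.toRingHom.op : (B)ᵐᵒᵖ →+* Aᵐᵒᵖ)

theorem op_smul_def (b : B) (a : A) : op b • a = a * (b : A) := rfl

instance : IsScalarTower k (B)ᵐᵒᵖ A where
  smul_assoc c b a := by
    induction b using MulOpposite.rec' with
    | h b => rw [← op_smul, op_smul_def, op_smul_def]; simp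

/-- `B`, as a left `B`-submodule of `A`. -/
def leftSubmodule : Submodule B A where
  carrier := B
  add_mem' := B.add_mem
  zero_mem' := B.zero_mem
  smul_mem' b _ hx := B.mul_mem b.2 hx

/-- `B`, as a right `B`-submodule of `A`. -/
def rightSubmodule : Submodule (B)ᵐᵒᵖ A where
  carrier := B
  add_mem' := B.add_mem
  zero_mem' := B.zero_mem
  smul_mem' b _ hx := B.mul_mem hx b.unop.2

/-- Right multiplication by `a`, as a left `B`-linear map. -/
def mulRightLinear (a : A) : A →ₗ[B] A where
  toFun x := x * a
  map_add' x y := add_mul x y a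
  map_smul' b x := smul_mul_assoc b x a

variable (N : Type*) [AddCommGroup N] [Module k N] [Module (B)ᵐᵒᵖ N] [IsScalarTower k (B)ᵐᵒᵖ N]

/-- The right `A`-module structure `(n ⊗ x) a = n ⊗ x a` on `N ⊗_B A`. -/
noncomputable instance inducedModule : Module Aᵐᵒᵖ (BalancedTensor k B N A) where
  smul a x := BalancedTensor.map (k := k) (LinearMap.id : N →ₗ[(B)ᵐᵒᵖ] N)
    (mulRightLinear B a.unop) x
  one_smul x := by
    change BalancedTensor.map (k := k) _ _ x = LinearMap.id (R := k) x
    congr 1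
    exact BalancedTensor.hom_ext fun n m => by simp [mulRightLinear]
  mul_smul a b x := by
    change BalancedTensor.map (k := k) _ _ x =
      (BalancedTensor.map (k := k) _ _ ∘ₗ BalancedTensor.map (k := k) _ _) x
    congr 1
    exact BalancedTensor.hom_ext fun n m => by simp [mulRightLinear, mul_assoc]
  smul_zero a := map_zero _
  smul_add a := map_add _
  add_smul a b x := by
    change BalancedTensor.map (k := k) _ _ x =
      (BalancedTensor.map (k := k) (LinearMap.id : N →ₗ[(B)ᵐᵒᵖ] N) (mulRightLinear B a.unop) +
        BalancedTensor.map (k := k) (LinearMap.id : N →ₗ[(B)ᵐᵒᵖ] N) (mulRightLinear B b.unop) :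
          BalancedTensor k B N A →ₗ[k] BalancedTensor k B N A) x
    congr 1
    exact BalancedTensor.hom_ext fun n m => by
      simp [mulRightLinear, mul_add, TensorProduct.tmul_add]
  zero_smul x := by
    change BalancedTensor.map (k := k) _ _ x = (0 : _ →ₗ[k] BalancedTensor k B N A) x
    congr 1
    exact BalancedTensor.hom_ext fun n m => by simp [mulRightLinear]

theorem op_smul_mk (a x : A) (n : N) :
    op a • BalancedTensor.mk k B N A (n ⊗ₜ[k] x) = BalancedTensor.mk k B N A (n ⊗ₜ[k] (x * a)) :=
  BalancedTensor.map_mk_tmul _ _ _ _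

instance : IsScalarTower k Aᵐᵒᵖ (BalancedTensor k B N A) where
  smul_assoc c a x := by
    change BalancedTensor.map (k := k) _ _ x = (c • BalancedTensor.map (k := k) _ _) x
    congr 1
    exact BalancedTensor.hom_ext fun n m => by simp [mulRightLinear]

end Subalgebra

/-! ### Hopf modules and the induction functor -/

section HopfModules

/-- The right action of `A` on `M`, as a bilinear map `m ↦ a ↦ m a`. -/
def rightAction (k A M : Type*) [CommRing k] [Ring A] [Algebra k A] [AddCommGroup M] [Module k M]
    [Module Aᵐᵒᵖ M] [IsScalarTower k Aᵐᵒᵖ M] : M →ₗ[k] A →ₗ[k] M :=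
  LinearMap.mk₂ k (fun m a => op a • m) (fun _ _ _ => smul_add _ _ _)
    (fun c m a => smul_comm (op a) c m) (fun m a b => by rw [op_add, add_smul])
    (fun c m a => by rw [op_smul, smul_assoc])

/-- A Hopf module: a right `A`-module and right `H`-comodule `M` with
`δ(m a) = m₍₀₎ a₍₀₎ ⊗ m₍₁₎ a₍₁₎`. -/
class IsHopfModule (k H A M : Type*) [CommRing k] [Ring H] [Bialgebra k H] [Ring A] [Algebra k A]
    [RightComoduleAlgebra k H A] [AddCommGroup M] [Module k M] [Module Aᵐᵒᵖ M]
    [IsScalarTower k Aᵐᵒᵖ M] [RightComodule k H M] : Prop where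
  coact_smul : ∀ (m : M) (a : A), coaction k H M (op a • m) =
    TensorProduct.map₂ (rightAction k A M) (LinearMap.mul k H) (coaction k H M m) (coaction k H A a)

variable (k H A : Type u) [Field k] [Ring H] [Bialgebra k H] [Ring A] [Algebra k A]
  [RightComoduleAlgebra k H A]

/-- The category of Hopf modules (right `A`-modules and right `H`-comodules). -/
structure HopfModuleCat : Type (u + 1) where
  carrier : Type u
  [addCommGroup : AddCommGroup carrier]
  [moduleBase : Module k carrier]
  [module : Module Aᵐᵒᵖ carrier]
  [isScalarTower : IsScalarTower k Aᵐᵒᵖ carrier]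
  [comodule : RightComodule k H carrier]
  [isHopfModule : IsHopfModule k H A carrier]

attribute [instance] HopfModuleCat.addCommGroup HopfModuleCat.moduleBase HopfModuleCat.module
  HopfModuleCat.isScalarTower HopfModuleCat.comodule HopfModuleCat.isHopfModule

namespace HopfModuleCat

variable {k H A}

/-- Morphisms of Hopf modules: `A`-linear and `H`-colinear maps. -/
@[ext]
structure Hom (M N : HopfModuleCat k H A) : Type u where
  toLinearMap : M.carrier →ₗ[Aᵐᵒᵖ] N.carrier
  isColinear : IsColinear k H (toLinearMap.restrictScalars k)

instance : CategoryTheory.Category (HopfModuleCat k H A) where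
  Hom := Hom
  id M := ⟨LinearMap.id, by ext x; simp⟩
  comp {M N P} f g := ⟨g.toLinearMap ∘ₗ f.toLinearMap, by
    have hf := f.isColinear
    have hg := g.isColinear
    unfold IsColinear at hf hg ⊢
    rw [show (g.toLinearMap ∘ₗ f.toLinearMap).restrictScalars k =
      g.toLinearMap.restrictScalars k ∘ₗ f.toLinearMap.restrictScalars k from rfl,
      LinearMap.rTensor_comp, LinearMap.comp_assoc, hf, ← LinearMap.comp_assoc, hg,
      LinearMap.comp_assoc]⟩

end HopfModuleCat

section Induction

variable (N : Type*) [AddCommGroup N] [Module k N] [Module (coinvariants k H A)ᵐᵒᵖ N]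

/-- The coaction `n ⊗ a ↦ (n ⊗ a₍₀₎) ⊗ a₍₁₎` on `N ⊗_B A`. -/
noncomputable def inducedCoact : BalancedTensor k (coinvariants k H A) N A →ₗ[k]
    BalancedTensor k (coinvariants k H A) N A ⊗[k] H :=
  BalancedTensor.lift ((BalancedTensor.mk k (coinvariants k H A) N A).rTensor H ∘ₗ
    (TensorProduct.assoc k N A H).symm.toLinearMap ∘ₗ (coaction k H A).lTensor N) <| by
    intro n b a
    have key : ∀ z : A ⊗[k] H,
        (BalancedTensor.mk k (coinvariants k H A) N A).rTensor H
          ((TensorProduct.assoc k N A H).symm ((op b • n) ⊗ₜ[k] z)) =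
        (BalancedTensor.mk k (coinvariants k H A) N A).rTensor H
          ((TensorProduct.assoc k N A H).symm (n ⊗ₜ[k] (((b : A) ⊗ₜ[k] (1 : H)) * z))) := by
      intro z
      induction z with
      | zero => simp
      | add x y hx hy => simp only [mul_add, TensorProduct.tmul_add, map_add, hx, hy]
      | tmul x h =>
        simp only [Algebra.TensorProduct.tmul_mul_tmul, one_mul, TensorProduct.assoc_symm_tmul,
          LinearMap.rTensor_tmul, BalancedTensor.mk_smul_tmul]
        rfl
    have hb : coaction k H A (b • a) = ((b : A) ⊗ₜ[k] (1 : H)) * coaction k H A a :=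
      coaction_coe_mul k H A b a
    simp only [LinearMap.comp_apply, LinearMap.lTensor_tmul, LinearEquiv.coe_coe, hb]
    exact key _

theorem inducedCoact_mk (n : N) (a : A) :
    inducedCoact k H A N (BalancedTensor.mk k (coinvariants k H A) N A (n ⊗ₜ[k] a)) =
      (BalancedTensor.mk k (coinvariants k H A) N A ∘ₗ TensorProduct.mk k N A n).rTensor H
        (coaction k H A a) := by
  simp only [inducedCoact, BalancedTensor.lift_mk, LinearMap.comp_apply, LinearMap.lTensor_tmul,
    LinearEquiv.coe_coe]
  generalize coaction k H A a = z
  induction z with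
  | zero => simp
  | add x y hx hy => simp only [TensorProduct.tmul_add, map_add, hx, hy]
  | tmul x h => simp

noncomputable instance inducedComodule :
    RightComodule k H (BalancedTensor k (coinvariants k H A) N A) where
  coact := inducedCoact k H A N
  coact_coassoc := by
    refine BalancedTensor.hom_ext fun n a => ?_
    have h := LinearMap.congr_fun (RightComodule.coact_coassoc (k := k) (C := H) (M := A)) a
    simp only [LinearMap.comp_apply, LinearEquiv.coe_coe] at h ⊢
    rw [inducedCoact_mk]
    set φ := BalancedTensor.mk k (coinvariants k H A) N A ∘ₗ TensorProduct.mk k N A n with hφ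
    have h1 : (Coalgebra.comul (R := k) (A := H)).lTensor _ (φ.rTensor H (coaction k H A a)) =
        φ.rTensor (H ⊗[k] H) ((Coalgebra.comul (R := k) (A := H)).lTensor A
          (coaction k H A a)) := by
      generalize coaction k H A a = z
      rw [← LinearMap.comp_apply, ← LinearMap.comp_apply, LinearMap.lTensor_comp_rTensor,
        LinearMap.rTensor_comp_lTensor]
    rw [h1]
    change _ = φ.rTensor (H ⊗[k] H) ((Coalgebra.comul (R := k) (A := H)).lTensor A
      (RightComodule.coact a))
    rw [← h]
    change _ = φ.rTensor (H ⊗[k] H) ((TensorProduct.assoc k A H H)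
      ((coaction k H A).rTensor H (coaction k H A a)))
    generalize coaction k H A a = z
    induction z with
    | zero => simp
    | add x y hx hy => simp only [map_add, hx, hy]
    | tmul x h =>
      simp only [LinearMap.rTensor_tmul]
      rw [hφ, LinearMap.comp_apply, TensorProduct.mk_apply, inducedCoact_mk, ← hφ]
      generalize coaction k H A x = y
      induction y with
      | zero => simp
      | add x y hx hy => simp only [map_add, TensorProduct.add_tmul, hx, hy]
      | tmul x h' => simp
  coact_counit := by
    refine BalancedTensor.hom_ext fun n a => ?_
    have h := LinearMap.congr_fun (RightComodule.coact_counit (k := k) (C := H) (M := A)) a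
    simp only [LinearMap.comp_apply, LinearEquiv.coe_coe, LinearMap.id_apply] at h ⊢
    rw [inducedCoact_mk]
    conv_rhs => rw [← h]
    change _ = BalancedTensor.mk k (coinvariants k H A) N A
      (n ⊗ₜ[k] TensorProduct.rid k A ((Coalgebra.counit (R := k) (A := H)).lTensor A
        (coaction k H A a)))
    generalize coaction k H A a = z
    induction z with
    | zero => simp
    | add x y hx hy => simp only [map_add, TensorProduct.tmul_add, hx, hy]
    | tmul x h => simp

instance inducedIsHopfModule [IsScalarTower k (coinvariants k H A)ᵐᵒᵖ N] :
    IsHopfModule k H A (BalancedTensor k (coinvariants k H A) N A) where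
  coact_smul x a := by
    change ((coaction k H _) ∘ₗ (rightAction k A _).flip a) x =
      ((TensorProduct.map₂ (rightAction k A (BalancedTensor k (coinvariants k H A) N A))
        (LinearMap.mul k H)).flip (coaction k H A a) ∘ₗ (coaction k H _)) x
    congr 1
    refine BalancedTensor.hom_ext fun n y => ?_
    have e : ∀ z, coaction k H (BalancedTensor k (coinvariants k H A) N A)
        (BalancedTensor.mk k _ N A (n ⊗ₜ[k] z)) = _ := fun z => inducedCoact_mk k H A N n z
    simp only [LinearMap.comp_apply, LinearMap.flip_apply]
    change coaction k H _ (op a • BalancedTensor.mk k _ N A (n ⊗ₜ[k] y)) = _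
    rw [op_smul_mk, e, e, coaction_mul]
    generalize coaction k H A y = u
    generalize coaction k H A a = v
    induction u with
    | zero => simp
    | add x y hx hy => simp only [map_add, LinearMap.add_apply, add_mul, hx, hy]
    | tmul x h =>
      induction v with
      | zero => simp
      | add x y hx hy => simp only [map_add, mul_add, hx, hy]
      | tmul x' h' => simp [rightAction, op_smul_mk]

end Induction

/-- Maps `f ⊗ A` are colinear. -/
theorem isColinear_map_id {N N' : Type*} [AddCommGroup N] [Module k N]
    [Module (coinvariants k H A)ᵐᵒᵖ N] [IsScalarTower k (coinvariants k H A)ᵐᵒᵖ N]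
    [AddCommGroup N'] [Module k N'] [Module (coinvariants k H A)ᵐᵒᵖ N']
    [IsScalarTower k (coinvariants k H A)ᵐᵒᵖ N'] (f : N →ₗ[(coinvariants k H A)ᵐᵒᵖ] N') :
    IsColinear k H (BalancedTensor.map (k := k) f
      (LinearMap.id : A →ₗ[coinvariants k H A] A)) := by
  refine BalancedTensor.hom_ext fun n a => ?_
  simp only [LinearMap.comp_apply, BalancedTensor.map_mk_tmul, LinearMap.id_apply]
  change _ = inducedCoact k H A N' _
  rw [show coaction k H (BalancedTensor k (coinvariants k H A) N A)
    (BalancedTensor.mk k _ N A (n ⊗ₜ[k] a)) = _ from inducedCoact_mk k H A N n a, inducedCoact_mk]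
  generalize coaction k H A a = z
  induction z with
  | zero => simp
  | add x y hx hy => simp only [map_add, hx, hy]
  | tmul x h => simp

open scoped ModuleCat in
/-- The induction functor `N ↦ N ⊗_B A` from right `B`-modules to Hopf modules. -/
noncomputable def inductionFunctor :
    CategoryTheory.Functor (ModuleCat.{u} (coinvariants k H A)ᵐᵒᵖ) (HopfModuleCat k H A) where
  obj N := { carrier := BalancedTensor k (coinvariants k H A) N A }
  map {N N'} f :=
    { toLinearMap :=
      { toFun := BalancedTensor.map (k := k) f.hom (LinearMap.id : A →ₗ[coinvariants k H A] A)
        map_add' := map_add _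
        map_smul' := fun a x => by
          change (BalancedTensor.map (k := k) f.hom LinearMap.id ∘ₗ
              BalancedTensor.map (k := k) LinearMap.id (mulRightLinear _ a.unop)) x =
            (BalancedTensor.map (k := k) LinearMap.id (mulRightLinear _ a.unop) ∘ₗ
              BalancedTensor.map (k := k) f.hom LinearMap.id) x
          congr 1
          exact BalancedTensor.hom_ext fun n m => by simp }
      isColinear := isColinear_map_id k H A f.hom }
  map_id N := HopfModuleCat.Hom.ext <| LinearMap.ext fun x => by
    change BalancedTensor.map (k := k) _ _ x = LinearMap.id (R := k) x
    congr 1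
    exact BalancedTensor.hom_ext fun n m => by simp
  map_comp f g := HopfModuleCat.Hom.ext <| LinearMap.ext fun x => by
    change BalancedTensor.map (k := k) _ _ x =
      (BalancedTensor.map (k := k) g.hom LinearMap.id ∘ₗ
        BalancedTensor.map (k := k) f.hom LinearMap.id) x
    congr 1
    exact BalancedTensor.hom_ext fun n m => by simp

end HopfModules

/-! ### The Galois map -/

section Galois

variable (k H A : Type*) [CommRing k] [Ring H] [Bialgebra k H] [Ring A] [Algebra k A]
  [RightComoduleAlgebra k H A]

/-- The Galois map `β : A ⊗_B A → A ⊗ H`, `x ⊗ y ↦ (x ⊗ 1) δ(y) = x y₍₀₎ ⊗ y₍₁₎`. -/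
noncomputable def galoisMap :
    BalancedTensor k (coinvariants k H A) A A →ₗ[k] A ⊗[k] H :=
  BalancedTensor.lift
    (LinearMap.mul' k (A ⊗[k] H) ∘ₗ
      TensorProduct.map (Algebra.TensorProduct.includeLeft (S := k)).toLinearMap
        (coaction k H A)) <| by
    intro x b y
    have hb : coaction k H A (b • y) = ((b : A) ⊗ₜ[k] (1 : H)) * coaction k H A y :=
      coaction_coe_mul k H A b y
    simp [op_smul_def, hb, ← mul_assoc]

/-- `A` is an `H`-Galois extension of its coinvariants if the Galois map is bijective. -/
def IsHopfGalois : Prop := Function.Bijective (galoisMap k H A)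

end Galois

end HopfGalois

open HopfGalois

set_option linter.unusedSectionVars false

/-! Write `S` for the antipode, `T` for its inverse, `B` for the coinvariants of `A`, and indices 0,
1, 2 for Sweedler legs.

The core is that surjectivity of the Galois map and injectivity of `A` yield explicit formulas.
Injectivity extends the unit `k → A` along `k → H` to a total integral, a colinear `γ : H → A` with
`γ(1) = 1`. Surjectivity gives, over a field, a linear `ℓ : H → A ⊗ A`, `ℓ(h) = Σ l ⊗ r`, with `Σ l
r₀ ⊗ r₁ = 1 ⊗ h`. For colinear `g : H → A` and any Hopf module `M`, the element `m₀ g(S m₁)` is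
coinvariant (`coaction_coinvTrace`), and each `a` in `A` supplies such a `g`, namely `h ↦ γ(h T(a₁))
a₀` (`coaction_twist`). Together they give a section `hopfSplitting` of the action map from
coinvariants of `M` tensor `A` to `M`, and a mirror image `rightSplitting` for `A` as a right
`B`-module. Hence `A` is projective on both sides, `a ↦ a₀ γ(S a₁)` and `a ↦ γ(T a₁) a₀` split off
`B`, `A` is right faithfully flat, and the unit and counit of induction are bijective.

If induction is an equivalence, applying it to the Hopf module `A ⊗ H`, whose coinvariants are `A ⊗
1`, shows that the Galois map is bijective. Kernels of Hopf module maps are again induced, so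
tensoring with the left module `A` preserves and reflects exactness.

For the way back from faithful flatness to injectivity, colinear maps `E → A` form the kernel of a
`B`-linear map. For finite-dimensional `E`, flatness identifies `A ⊗_B Hom^H(E, A)` with `Hom^H(E, A
⊗_B A)`. The Galois map makes `A ⊗_B A` cofree, so colinear maps into it extend, and faithful
flatness descends this to `A`. Local finiteness of comodules and Zorn's lemma remove the restriction
on `E`. For left flatness a mirrored Galois map is used, which is bijective because `S` is. -/

namespace HopfGalois

open MulOpposite

/-! ### Convolution identities for the antipode and its inverse. -/

section Antipode

open Coalgebra HopfAlgebra WithConv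

variable {k H : Type*} [CommRing k] [Ring H] [HopfAlgebra k H]

/-- The map `h ↦ h ⊗ 1`. -/
noncomputable abbrev inlTensor (k H : Type*) [CommRing k] [Ring H] [Algebra k H] :
    H →ₐ[k] H ⊗[k] H := Algebra.TensorProduct.includeLeft

/-- The map `h ↦ 1 ⊗ h`. -/
noncomputable abbrev inrTensor (k H : Type*) [CommRing k] [Ring H] [Algebra k H] :
    H →ₐ[k] H ⊗[k] H := Algebra.TensorProduct.includeRight

/-- This factorization of the comultiplication in the convolution algebra `Hom(H, H ⊗ H)` replaces
Sweedler computations: the antipode identities below follow by cancelling convolution inverses. -/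
theorem conv_inl_inr : toConv (inlTensor k H).toLinearMap * toConv (inrTensor k H).toLinearMap =
    toConv (comul (R := k) (A := H)) := by
  ext h
  rw [(ℛ k h).convMul_apply]
  simp [← (ℛ k h).eq]

theorem conv_algHom_antipode {D : Type*} [Ring D] [Algebra k D] (f : H →ₐ[k] D) :
    toConv f.toLinearMap * toConv (f.toLinearMap ∘ₗ antipode k) = 1 := by
  ext h
  rw [(ℛ k h).convMul_apply]
  simp [← map_mul, ← map_sum, sum_mul_antipode_eq_algebraMap_counit (ℛ k h)]

theorem conv_antipode_algHom {D : Type*} [Ring D] [Algebra k D] (f : H →ₐ[k] D) :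
    toConv (f.toLinearMap ∘ₗ antipode k) * toConv f.toLinearMap = 1 := by
  ext h
  rw [(ℛ k h).convMul_apply]
  simp [← map_mul, ← map_sum, sum_antipode_mul_eq_algebraMap_counit (ℛ k h)]

theorem conv_inr_comul_antipode :
    toConv (inrTensor k H).toLinearMap * toConv (comul ∘ₗ antipode k) =
      toConv ((inlTensor k H).toLinearMap ∘ₗ antipode k) := by
  have h := conv_antipode_algHom (inlTensor k H)
  calc _ = (toConv ((inlTensor k H).toLinearMap ∘ₗ antipode k) *
        toConv (inlTensor k H).toLinearMap) * (toConv (inrTensor k H).toLinearMap *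
          toConv (comul ∘ₗ antipode k)) := by rw [h, one_mul]
    _ = _ := by
      rw [mul_assoc, ← mul_assoc (toConv (inlTensor k H).toLinearMap), conv_inl_inr,
        LinearMap.comul_right_inv, mul_one]

theorem conv_comul_inr_antipode :
    toConv (comul (R := k) (A := H)) * toConv ((inrTensor k H).toLinearMap ∘ₗ antipode k) =
      toConv (inlTensor k H).toLinearMap := by
  rw [← conv_inl_inr, mul_assoc, conv_algHom_antipode, mul_one]

/-- Both sides are convolution inverses of the comultiplication. For the right side, the
comultiplication is a product of two algebra maps, each inverted by precomposing with `S`, and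
inversion reverses the order. -/
theorem comul_antipode (h : H) : comul (R := k) (antipode k h) =
    TensorProduct.map (antipode k) (antipode k) (TensorProduct.comm k H H (comul h)) := by
  have e : toConv ((inrTensor k H).toLinearMap ∘ₗ antipode k) *
      toConv ((inlTensor k H).toLinearMap ∘ₗ antipode k) = toConv (comul ∘ₗ antipode k) := by
    refine left_inv_eq_right_inv (a := toConv (comul (R := k) (A := H))) ?_
      LinearMap.comul_right_inv
    rw [← conv_inl_inr, mul_assoc, ← mul_assoc _ (toConv (inlTensor k H).toLinearMap),
      conv_antipode_algHom, one_mul, conv_antipode_algHom]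
  have := congr($e h)
  rw [(ℛ k h).convMul_apply] at this
  change _ = comul (R := k) (antipode k h) at this
  rw [← this]
  conv_rhs => rw [← (ℛ k h).eq]
  simp

variable {T : H →ₗ[k] H}

/-- `(1 ⊗ h₁) Δ(S h₂) = S h ⊗ 1`. -/
theorem inr_mul_comul_antipode (h : H) :
    LinearMap.mul' k (H ⊗[k] H) (TensorProduct.map (inrTensor k H).toLinearMap
      (comul ∘ₗ antipode k) (comul h)) = antipode k h ⊗ₜ[k] 1 :=
  congr($conv_inr_comul_antipode h)

/-- `Δ(T h₂) (1 ⊗ h₁) = T h ⊗ 1` for the inverse `T` of the antipode. -/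
theorem comul_inv_mul_inr (hTS : ∀ h, T (antipode k h) = h) (hST : ∀ h, antipode k (T h) = h)
    (h : H) : LinearMap.mul' k (H ⊗[k] H) (TensorProduct.map
      (comul ∘ₗ T) (inrTensor k H).toLinearMap (TensorProduct.comm k H H (comul h))) =
        T h ⊗ₜ[k] 1 := by
  -- Writing the element as `S y` cancels `T` on the legs, and the claim becomes the identity for
  -- `S` at `y`.
  obtain ⟨y, rfl⟩ : ∃ y, antipode k y = h := ⟨T h, hST h⟩
  rw [comul_antipode, hTS]
  refine Eq.trans ?_ congr($conv_comul_inr_antipode y)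
  rw [LinearMap.convMul_apply]
  generalize comul (R := k) y = z
  induction z with
  | zero => simp
  | add x y hx hy => simp only [map_add, hx, hy]
  | tmul x h => simp [hTS]

/-- `h₂ T(h₁) = ε(h)`. -/
theorem mul_inv_antipode (hTS : ∀ h, T (antipode k h) = h) (hST : ∀ h, antipode k (T h) = h)
    (h : H) : LinearMap.mul' k H (TensorProduct.map .id T (TensorProduct.comm k H H (comul h))) =
      algebraMap k H (counit h) := by
  obtain ⟨y, rfl⟩ : ∃ y, antipode k y = h := ⟨T h, hST h⟩
  rw [comul_antipode, counit_antipode, ← mul_antipode_rTensor_comul_apply]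
  generalize comul (R := k) y = z
  induction z with
  | zero => simp
  | add x y hx hy => simp only [map_add, hx, hy]
  | tmul x h => simp [hTS]

/-- `T(h₂) h₁ = ε(h)`. -/
theorem inv_antipode_mul (hTS : ∀ h, T (antipode k h) = h) (hST : ∀ h, antipode k (T h) = h)
    (h : H) : LinearMap.mul' k H (TensorProduct.map T .id (TensorProduct.comm k H H (comul h))) =
      algebraMap k H (counit h) := by
  obtain ⟨y, rfl⟩ : ∃ y, antipode k y = h := ⟨T h, hST h⟩
  rw [comul_antipode, counit_antipode, ← mul_antipode_lTensor_comul_apply]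
  generalize comul (R := k) y = z
  induction z with
  | zero => simp
  | add x y hx hy => simp only [map_add, hx, hy]
  | tmul x h => simp [hTS]

theorem inv_antipode_mul_rev (hTS : ∀ h, T (antipode k h) = h)
    (hST : ∀ h, antipode k (T h) = h) (g h : H) : T (g * h) = T h * T g := by
  rw [← hTS (T h * T g), antipode_mul_antidistrib, hST, hST]

end Antipode

/-! ### Elementwise comodule axioms. -/

section Comodules

open Coalgebra

variable {k C M : Type*} [CommRing k] [AddCommGroup C] [Module k C] [Coalgebra k C]
    [AddCommGroup M] [Module k M] [RightComodule k C M]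

theorem coaction_coassoc (m : M) : (coaction k C M).rTensor C (coaction k C M m) =
    (TensorProduct.assoc k M C C).symm ((comul (R := k) (A := C)).lTensor M
      (coaction k C M m)) := by
  rw [LinearEquiv.eq_symm_apply]
  exact LinearMap.congr_fun (RightComodule.coact_coassoc (k := k) (C := C) (M := M)) m

theorem coaction_counit (m : M) : TensorProduct.rid k M
    ((counit (R := k) (A := C)).lTensor M (coaction k C M m)) = m :=
  LinearMap.congr_fun (RightComodule.coact_counit (k := k) (C := C) (M := M)) m

end Comodules

/-! ### Coinvariants and splittings from a total integral. -/

section TotalIntegral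

open Coalgebra HopfAlgebra

variable {k H A : Type*} [CommRing k] [Ring H] [HopfAlgebra k H] [Ring A] [Algebra k A]
  [RightComoduleAlgebra k H A]

@[simp]
theorem rightAction_apply {k A M : Type*} [CommRing k] [Ring A] [Algebra k A] [AddCommGroup M]
    [Module k M] [Module Aᵐᵒᵖ M] [IsScalarTower k Aᵐᵒᵖ M] (m : M) (a : A) :
    rightAction k A M m a = op a • m := rfl

instance selfIsHopfModule : IsHopfModule k H A A where
  coact_smul m a := by
    rw [op_smul_eq_mul, coaction_mul]
    generalize coaction k H A m = u
    generalize coaction k H A a = v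
    induction u with
    | zero => simp
    | add x y hx hy => simp only [map_add, LinearMap.add_apply, add_mul, hx, hy]
    | tmul x h =>
      induction v with
      | zero => simp
      | add x y hx hy => simp only [map_add, mul_add, hx, hy]
      | tmul x' h' => simp

section Trace

variable (M : Type*) [AddCommGroup M] [Module k M] [Module Aᵐᵒᵖ M]
    [IsScalarTower k Aᵐᵒᵖ M] [RightComodule k H M]

/-- The map `m ↦ m₍₀₎ g(S m₍₁₎)`, which takes values in the coinvariants of the Hopf module `M` if
`g` is colinear. -/
noncomputable def coinvTrace : (H →ₗ[k] A) →ₗ[k] M →ₗ[k] M :=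
  LinearMap.mk₂ k (fun g m => TensorProduct.lift
      ((rightAction k A M).compl₂ (g ∘ₗ antipode k)) (coaction k H M m))
    (fun g g' m => by
      generalize coaction k H M m = z
      induction z with
      | zero => simp
      | add x y hx hy => simp only [map_add, hx, hy]; abel
      | tmul x h => simp [add_smul])
    (fun c g m => by
      generalize coaction k H M m = z
      induction z with
      | zero => simp
      | add x y hx hy => simp only [map_add, hx, hy, smul_add]
      | tmul x h => simp)
    (fun g m m' => by simp) (fun c g m => by simp)

variable {M}

theorem coinvTrace_apply (g : H →ₗ[k] A) (m : M) : coinvTrace M g m = TensorProduct.lift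
    ((rightAction k A M).compl₂ (g ∘ₗ antipode k)) (coaction k H M m) := rfl

/-- By coassociativity the legs of `m` enter only through `(1 ⊗ h₁) Δ(S h₂) = S h ⊗ 1`, which clears
the factor `H`. This produces the coinvariants used in the splittings. -/
theorem coaction_coinvTrace [IsHopfModule k H A M] {g : H →ₗ[k] A}
    (hg : ∀ h, coaction k H A (g h) = g.rTensor H (comul h)) (m : M) :
    coaction k H M (coinvTrace M g m) = coinvTrace M g m ⊗ₜ[k] 1 := by
  let L : (M ⊗[k] H) ⊗[k] H →ₗ[k] M ⊗[k] H := TensorProduct.lift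
    ((TensorProduct.map₂ (rightAction k A M) (LinearMap.mul k H)).compl₂
      (coaction k H A ∘ₗ g ∘ₗ antipode k))
  have h1 : ∀ z : M ⊗[k] H, coaction k H M (TensorProduct.lift
      ((rightAction k A M).compl₂ (g ∘ₗ antipode k)) z) =
        L ((coaction k H M).rTensor H z) := by
    intro z
    induction z with
    | zero => simp
    | add x y hx hy => simp only [map_add, hx, hy]
    | tmul x h => simp [L, IsHopfModule.coact_smul]
  have h2 : ∀ z : M ⊗[k] H, L ((TensorProduct.assoc k M H H).symm (comul.lTensor M z)) =
      TensorProduct.lift ((rightAction k A M).compl₂ (g ∘ₗ antipode k)) z ⊗ₜ[k] 1 := by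
    intro z
    induction z with
    | zero => simp
    | add x y hx hy => simp only [map_add, hx, hy, TensorProduct.add_tmul]
    | tmul m h =>
      have h3 : ∀ w : H ⊗[k] H, L ((TensorProduct.assoc k M H H).symm (m ⊗ₜ w)) =
          (rightAction k A M m ∘ₗ g).rTensor H (LinearMap.mul' k (H ⊗[k] H)
            (TensorProduct.map (inrTensor k H).toLinearMap (comul ∘ₗ antipode k) w)) := by
        intro w
        induction w with
        | zero => simp
        | add x y hx hy => simp only [map_add, hx, hy, TensorProduct.tmul_add]
        | tmul x y =>
          simp only [TensorProduct.assoc_symm_tmul, L, TensorProduct.lift.tmul,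
            LinearMap.compl₂_apply, LinearMap.comp_apply, hg, TensorProduct.map_tmul,
            LinearMap.mul'_apply]
          generalize comul (R := k) (antipode k y) = v
          induction v with
          | zero => simp
          | add x y hx hy => simp only [map_add, hx, hy, mul_add]
          | tmul p q => simp
      rw [LinearMap.lTensor_tmul, h3, inr_mul_comul_antipode]
      simp
  rw [coinvTrace_apply, h1, coaction_coassoc, h2]

theorem coinvTrace_of_coinvariant {g : H →ₗ[k] A} (hg : g 1 = 1) {m : M}
    (hm : coaction k H M m = m ⊗ₜ[k] 1) : coinvTrace M g m = m := by
  simp [coinvTrace_apply, hm, hg]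

/-- Only the coaction of `a` contributes, since `n` is coinvariant. For `M = A` this is left
`B`-linearity of the trace. -/
theorem coinvTrace_op_smul [IsHopfModule k H A M] (g : H →ₗ[k] A) {n : M}
    (hn : coaction k H M n = n ⊗ₜ[k] 1) (a : A) :
    coinvTrace M g (op a • n) = op (coinvTrace A g a) • n := by
  rw [coinvTrace_apply, coinvTrace_apply, IsHopfModule.coact_smul, hn]
  generalize coaction k H A a = z
  induction z with
  | zero => simp
  | add x y hx hy => simp only [map_add, hx, hy, op_add, add_smul]
  | tmul x h => simp [mul_smul]

end Trace

variable (T : H →ₗ[k] H) (γ : H →ₗ[k] A)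

/-- The map `a ⊗ h ↦ (g ↦ γ(g T(h)) a)`. -/
noncomputable def twistAux : A ⊗[k] H →ₗ[k] H →ₗ[k] A :=
  TensorProduct.lift <| LinearMap.mk₂ k
    (fun a h => (LinearMap.mul k A).flip a ∘ₗ γ ∘ₗ (LinearMap.mul k H).flip (T h))
    (fun a a' h => by ext; simp) (fun c a h => by ext; simp)
    (fun a h h' => by ext; simp) (fun c a h => by ext; simp)

@[simp]
theorem twistAux_tmul (a : A) (h g : H) : twistAux T γ (a ⊗ₜ[k] h) g = γ (g * T h) * a := rfl

/-- The map `a ↦ (g ↦ γ(g T(a₍₁₎)) a₍₀₎)`. -/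
noncomputable def twist : A →ₗ[k] H →ₗ[k] A := twistAux T γ ∘ₗ coaction k H A

theorem twist_apply (a : A) : twist T γ a = twistAux T γ (coaction k H A a) := rfl

variable {T γ}

/-- The legs of `x` cancel through `Δ(T h₂) (1 ⊗ h₁) = T h ⊗ 1`. Consequently `twist T γ x` may be
fed to `coaction_coinvTrace` for every `x`. -/
theorem coaction_twist (hTS : ∀ h, T (antipode k h) = h) (hST : ∀ h, antipode k (T h) = h)
    (hγ : ∀ h, coaction k H A (γ h) = γ.rTensor H (comul h)) (x : A) (h : H) :
    coaction k H A (twist T γ x h) = (twist T γ x).rTensor H (comul h) := by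
  let L : (A ⊗[k] H) ⊗[k] H →ₗ[k] A ⊗[k] H := TensorProduct.lift <|
    ((LinearMap.mul k (A ⊗[k] H)).flip).compl₂
      (γ.rTensor H ∘ₗ LinearMap.mul k (H ⊗[k] H) (comul h) ∘ₗ comul ∘ₗ T)
  have h1 : ∀ z : A ⊗[k] H, coaction k H A (twistAux T γ z h) =
      L ((coaction k H A).rTensor H z) := by
    intro z
    induction z with
    | zero => simp
    | add x y hx hy => simp only [map_add, LinearMap.add_apply, hx, hy]
    | tmul x y => simp [L, coaction_mul, hγ, Bialgebra.comul_mul]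
  have h2 : ∀ z : A ⊗[k] H, L ((TensorProduct.assoc k A H H).symm (comul.lTensor A z)) =
      (twistAux T γ z).rTensor H (comul h) := by
    intro z
    induction z with
    | zero => simp
    | add x y hx hy => simp only [map_add, hx, hy, LinearMap.rTensor_add, LinearMap.add_apply]
    | tmul a h' =>
      have h3 : ∀ w : H ⊗[k] H, L ((TensorProduct.assoc k A H H).symm (a ⊗ₜ w)) =
          ((LinearMap.mul k A).flip a ∘ₗ γ).rTensor H (comul h * LinearMap.mul' k (H ⊗[k] H)
            (TensorProduct.map (comul ∘ₗ T) (inrTensor k H).toLinearMap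
              (TensorProduct.comm k H H w))) := by
        intro w
        induction w with
        | zero => simp
        | add x y hx hy => simp only [map_add, hx, hy, TensorProduct.tmul_add, mul_add]
        | tmul x y =>
          simp only [TensorProduct.assoc_symm_tmul, L, TensorProduct.lift.tmul,
            LinearMap.compl₂_apply, LinearMap.comp_apply, TensorProduct.map_tmul,
            LinearMap.mul'_apply, TensorProduct.comm_tmul, LinearMap.flip_apply,
            LinearMap.mul_apply', ← mul_assoc]
          generalize comul (R := k) h * comul (R := k) (T y) = v
          induction v with
          | zero => simp
          | add x y hx hy => simp only [map_add, hx, hy, add_mul]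
          | tmul p q => simp
      rw [LinearMap.lTensor_tmul, h3, comul_inv_mul_inr hTS hST]
      generalize comul (R := k) h = v
      induction v with
      | zero => simp
      | add x y hx hy => simp only [map_add, hx, hy, add_mul]
      | tmul p q => simp
  rw [twist_apply, h1, coaction_coassoc, h2]

theorem twist_one (hTS : ∀ h, T (antipode k h) = h) (h : H) :
    twist T γ (1 : A) h = γ h := by
  have : T 1 = 1 := by simpa using hTS 1
  simp [twist_apply, coaction_one, Algebra.TensorProduct.one_def, this]

theorem twist_mul_coe (x : A) (b : coinvariants k H A) (h : H) :
    twist T γ (x * (b : A)) h = twist T γ x h * b := by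
  rw [twist_apply, twist_apply, coaction_mul, show coaction k H A (b : A) = _ from b.2]
  generalize coaction k H A x = z
  induction z with
  | zero => simp
  | add x y hx hy => simp only [map_add, LinearMap.add_apply, hx, hy, add_mul]
  | tmul x h => simp [mul_assoc]

variable (k H A) in
/-- The map `x ⊗ y ↦ (x ⊗ 1) δ(y)` that induces the Galois map. -/
noncomputable def preGaloisMap : A ⊗[k] A →ₗ[k] A ⊗[k] H :=
  LinearMap.mul' k (A ⊗[k] H) ∘ₗ
    TensorProduct.map (Algebra.TensorProduct.includeLeft (S := k)).toLinearMap (coaction k H A)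

@[simp]
theorem preGaloisMap_tmul (x y : A) :
    preGaloisMap k H A (x ⊗ₜ y) = (x ⊗ₜ 1) * coaction k H A y := rfl

theorem galoisMap_mk (z : A ⊗[k] A) : galoisMap k H A (BalancedTensor.mk k _ A A z) =
    preGaloisMap k H A z := rfl

variable (T γ) in
/-- The map `x ⊗ y ↦ (g ↦ γ(g T(x₍₁₎)) x₍₀₎ y)`. -/
noncomputable def twistMul : A ⊗[k] A →ₗ[k] H →ₗ[k] A :=
  TensorProduct.lift <| LinearMap.mk₂ k
    (fun x y => (LinearMap.mul k A).flip y ∘ₗ twist T γ x)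
    (fun a a' h => by ext; simp) (fun c a h => by ext; simp)
    (fun a h h' => by ext; simp) (fun c a h => by ext; simp)

@[simp]
theorem twistMul_tmul (x y : A) (g : H) :
    twistMul T γ (x ⊗ₜ[k] y) g = twist T γ x g * y := rfl

/-- As `T` reverses products, the left side at `x ⊗ y` is `γ(g y₂ T(y₁) T(x₁)) x₀ y₀`, and `y₂
T(y₁)` collapses to the counit. The expression `γ(g T(x₁)) x₀ y` thus depends only on the image
under the Galois map, so it can be computed on `ℓ h`. -/
theorem lift_twist_preGaloisMap (hTS : ∀ h, T (antipode k h) = h)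
    (hST : ∀ h, antipode k (T h) = h) (g : H) (z : A ⊗[k] A) :
    TensorProduct.lift ((twist T γ).compl₂ (LinearMap.mul k H g)) (preGaloisMap k H A z) =
      twistMul T γ z g := by
  induction z with
  | zero => simp
  | add x y hx hy => simp only [map_add, LinearMap.add_apply, hx, hy]
  | tmul x y =>
    let L : (A ⊗[k] H) ⊗[k] H →ₗ[k] A := TensorProduct.lift <|
      (twistAux T γ ∘ₗ LinearMap.mul k (A ⊗[k] H) (coaction k H A x)).compl₂ (LinearMap.mul k H g)
    have h1 : ∀ z : A ⊗[k] H, TensorProduct.lift ((twist T γ).compl₂ (LinearMap.mul k H g))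
        (x ⊗ₜ[k] 1 * z) = L ((coaction k H A).rTensor H z) := by
      intro z
      induction z with
      | zero => simp
      | add x y hx hy => simp only [map_add, hx, hy, mul_add]
      | tmul a h => simp [L, twist_apply, coaction_mul]
    have h2 : ∀ z : A ⊗[k] H, L ((TensorProduct.assoc k A H H).symm (comul.lTensor A z)) =
        twist T γ x g * (TensorProduct.rid k A (counit.lTensor A z)) := by
      intro z
      induction z with
      | zero => simp
      | add x y hx hy => simp only [map_add, hx, hy, mul_add]
      | tmul a h =>
        have h3 : ∀ (v : A ⊗[k] H) (w : H ⊗[k] H), TensorProduct.lift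
            ((twistAux T γ ∘ₗ LinearMap.mul k (A ⊗[k] H) v).compl₂ (LinearMap.mul k H g))
            ((TensorProduct.assoc k A H H).symm (a ⊗ₜ w)) =
            twistAux T γ v (g * LinearMap.mul' k H (TensorProduct.map .id T
              (TensorProduct.comm k H H w))) * a := by
          intro v w
          induction w with
          | zero => simp
          | add x y hx hy => simp only [map_add, hx, hy, TensorProduct.tmul_add, mul_add, add_mul]
          | tmul p q =>
            induction v with
            | zero => simp
            | add x y hx hy =>
              simp only [TensorProduct.assoc_symm_tmul, TensorProduct.lift.tmul,
                LinearMap.compl₂_apply, LinearMap.comp_apply, map_add, LinearMap.add_apply,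
                add_mul] at hx hy ⊢
              rw [hx, hy]
            | tmul x y => simp [inv_antipode_mul_rev hTS hST, mul_assoc]
        rw [LinearMap.lTensor_tmul, h3, mul_inv_antipode hTS hST, ← twist_apply]
        simp [Algebra.algebraMap_eq_smul_one]
    rw [preGaloisMap_tmul, h1, coaction_coassoc, h2, coaction_counit]
    simp

/-- A linear map `ℓ(h) = Σ l ⊗ r` such that `Σ l r₍₀₎ ⊗ r₍₁₎ = 1 ⊗ h`. -/
def IsTranslationLift (ℓ : H →ₗ[k] A ⊗[k] A) : Prop :=
  ∀ h, preGaloisMap k H A (ℓ h) = 1 ⊗ₜ h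

theorem twistMul_translationLift (hTS : ∀ h, T (antipode k h) = h)
    (hST : ∀ h, antipode k (T h) = h) {ℓ : H →ₗ[k] A ⊗[k] A} (hℓ : IsTranslationLift ℓ) (h : H) :
    twistMul T γ (ℓ h) = γ ∘ₗ (LinearMap.mul k H).flip h := by
  ext g
  rw [← lift_twist_preGaloisMap hTS hST, hℓ]
  simp [twist_one hTS]

/-- The case `x = 1`, `g = 1` of `lift_twist_preGaloisMap`, because `1 ⊗ a` maps to the coaction of
`a`. -/
theorem lift_twist_coaction (hTS : ∀ h, T (antipode k h) = h)
    (hST : ∀ h, antipode k (T h) = h) (hγ1 : γ 1 = 1) (a : A) :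
    TensorProduct.lift (twist T γ) (coaction k H A a) = a := by
  have h := lift_twist_preGaloisMap (γ := γ) hTS hST 1 ((1 : A) ⊗ₜ[k] a)
  rw [preGaloisMap_tmul, twistMul_tmul, twist_one hTS, hγ1, one_mul,
    ← Algebra.TensorProduct.one_def, one_mul] at h
  refine Eq.trans ?_ h
  congr 2
  ext
  simp

theorem op_smul_coinvTrace {M : Type*} [AddCommGroup M] [Module k M]
    [Module Aᵐᵒᵖ M] [IsScalarTower k Aᵐᵒᵖ M] [RightComodule k H M] (g : H →ₗ[k] A) (a : A)
    (m : M) : op a • coinvTrace M g m = coinvTrace M ((LinearMap.mul k A).flip a ∘ₗ g) m := by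
  rw [coinvTrace_apply, coinvTrace_apply]
  generalize coaction k H M m = z
  induction z with
  | zero => simp
  | add x y hx hy => simp only [map_add, smul_add, hx, hy]
  | tmul x h => simp [mul_smul]

section HopfModule

variable (T γ) (ℓ : H →ₗ[k] A ⊗[k] A) (M : Type*) [AddCommGroup M] [Module k M]
    [Module Aᵐᵒᵖ M] [IsScalarTower k Aᵐᵒᵖ M] [RightComodule k H M]

/-- The map `m ⊗ h ↦ Σ m₍₀₎ γ(S(m₍₁₎) T(l₍₁₎)) l₍₀₎ ⊗ r`, where `ℓ(h) = Σ l ⊗ r`. -/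
noncomputable def hopfSplittingAux : M ⊗[k] H →ₗ[k] M ⊗[k] A :=
  TensorProduct.lift (LinearMap.mk₂ k
    (fun m h => ((coinvTrace M ∘ₗ twist T γ).flip m).rTensor A (ℓ h))
    (fun m m' h => by simp) (fun c m h => by simp)
    (fun m h h' => by simp) (fun c m h => by simp))

@[simp]
theorem hopfSplittingAux_tmul (m : M) (h : H) : hopfSplittingAux T γ ℓ M (m ⊗ₜ h) =
    ((coinvTrace M ∘ₗ twist T γ).flip m).rTensor A (ℓ h) := rfl

/-- The map `m ↦ Σ m₍₀₎ γ(S(m₍₁₎) T(l₍₁₎)) l₍₀₎ ⊗ r`, where `ℓ(m₍₂₎) = Σ l ⊗ r`. -/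
noncomputable def hopfSplitting : M →ₗ[k] M ⊗[k] A :=
  hopfSplittingAux T γ ℓ M ∘ₗ coaction k H M

variable {T γ ℓ M}

/-- Multiplying the legs of `ℓ(m₂)` back together turns the sum into `m₀ γ(S(m₁) m₂)`; the antipode
axiom and `γ 1 = 1` leave `m`. -/
theorem rightAction_hopfSplitting (hTS : ∀ h, T (antipode k h) = h)
    (hST : ∀ h, antipode k (T h) = h) (hγ1 : γ 1 = 1) (hℓ : IsTranslationLift ℓ) (m : M) :
    TensorProduct.lift (rightAction k A M) (hopfSplitting T γ ℓ M m) = m := by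
  let L : (M ⊗[k] H) ⊗[k] H →ₗ[k] M := TensorProduct.lift (rightAction k A M) ∘ₗ
    (γ ∘ₗ LinearMap.mul' k H ∘ₗ (antipode k).rTensor H).lTensor M ∘ₗ
      (TensorProduct.assoc k M H H).toLinearMap
  have h1 : ∀ z : M ⊗[k] H, TensorProduct.lift (rightAction k A M) (hopfSplittingAux T γ ℓ M z) =
      L ((coaction k H M).rTensor H z) := by
    intro z
    induction z with
    | zero => simp
    | add x y hx hy => simp only [map_add, hx, hy]
    | tmul m h =>
      have h3 : ∀ w : A ⊗[k] A, TensorProduct.lift (rightAction k A M)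
          (((coinvTrace M ∘ₗ twist T γ).flip m).rTensor A w) =
          coinvTrace M (twistMul T γ w) m := by
        intro w
        induction w with
        | zero => simp
        | add x y hx hy => simp only [map_add, hx, hy, LinearMap.add_apply]
        | tmul x y => simp [op_smul_coinvTrace, twistMul]
      rw [hopfSplittingAux_tmul, h3, twistMul_translationLift hTS hST hℓ, coinvTrace_apply,
        LinearMap.rTensor_tmul]
      generalize coaction k H M m = z
      induction z with
      | zero => simp
      | add x y hx hy => simp only [map_add, TensorProduct.add_tmul, hx, hy]
      | tmul x h => simp [L]
  have h2 : ∀ z : M ⊗[k] H, L ((TensorProduct.assoc k M H H).symm (comul.lTensor M z)) =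
      TensorProduct.rid k M (counit.lTensor M z) := by
    intro z
    induction z with
    | zero => simp
    | add x y hx hy => simp only [map_add, hx, hy]
    | tmul m h => simp [L, Algebra.algebraMap_eq_smul_one, hγ1]
  rw [hopfSplitting, LinearMap.comp_apply, h1, coaction_coassoc, h2, coaction_counit]

/-- For `M = A` this is left `B`-linearity of the splitting; for general `M` it computes the
splitting on the image of an induced module. -/
theorem hopfSplitting_op_smul [IsHopfModule k H A M] {n : M}
    (hn : coaction k H M n = n ⊗ₜ[k] 1) (a : A) :
    hopfSplitting T γ ℓ M (op a • n) =
      (rightAction k A M n).rTensor A (hopfSplitting T γ ℓ A a) := by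
  simp only [hopfSplitting, LinearMap.comp_apply, IsHopfModule.coact_smul, hn]
  generalize coaction k H A a = z
  induction z with
  | zero => simp
  | add x y hx hy => simp only [map_add, hx, hy]
  | tmul x h =>
    rw [TensorProduct.map₂_apply_tmul, TensorProduct.map_tmul, rightAction_apply,
      LinearMap.mul_apply', one_mul, hopfSplittingAux_tmul, hopfSplittingAux_tmul]
    generalize ℓ h = w
    induction w with
    | zero => simp
    | add x y hx hy => simp only [map_add, hx, hy]
    | tmul p q => simp [coinvTrace_op_smul _ hn]

end HopfModule

section RightSplitting

variable (T γ) (ℓ : H →ₗ[k] A ⊗[k] A)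

/-- The map `a ⊗ h ↦ Σ l ⊗ r₍₀₎ γ(S(r₍₁₎) T(a₍₁₎)) a₍₀₎`, where `ℓ(T(h)) = Σ l ⊗ r`. -/
noncomputable def rightSplittingAux : A ⊗[k] H →ₗ[k] A ⊗[k] A :=
  TensorProduct.lift (LinearMap.mk₂ k
    (fun a h => (coinvTrace A (twist T γ a)).lTensor A (ℓ (T h)))
    (fun m m' h => by simp) (fun c m h => by simp)
    (fun m h h' => by simp) (fun c m h => by simp))

@[simp]
theorem rightSplittingAux_tmul (a : A) (h : H) : rightSplittingAux T γ ℓ (a ⊗ₜ h) =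
    (coinvTrace A (twist T γ a)).lTensor A (ℓ (T h)) := rfl

/-- The map `a ↦ Σ l ⊗ r₍₀₎ γ(S(r₍₁₎) T(a₍₁₎)) a₍₀₎`, where `ℓ(T(a₍₂₎)) = Σ l ⊗ r`. -/
noncomputable def rightSplitting : A →ₗ[k] A ⊗[k] A :=
  rightSplittingAux T γ ℓ ∘ₗ coaction k H A

variable {T γ ℓ}

/-- The trace applies `S` to the argument `T h` of `ℓ`, so the two cancel, and `lift_twist_coaction`
finishes. -/
theorem mul_rightSplitting (hTS : ∀ h, T (antipode k h) = h)
    (hST : ∀ h, antipode k (T h) = h) (hγ1 : γ 1 = 1) (hℓ : IsTranslationLift ℓ) (a : A) :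
    LinearMap.mul' k A (rightSplitting T γ ℓ a) = a := by
  refine Eq.trans ?_ (lift_twist_coaction (γ := γ) hTS hST hγ1 a)
  rw [rightSplitting, LinearMap.comp_apply]
  generalize coaction k H A a = z
  induction z with
  | zero => simp
  | add x y hx hy => simp only [map_add, hx, hy]
  | tmul a h =>
    have h3 : ∀ w : A ⊗[k] A, LinearMap.mul' k A ((coinvTrace A (twist T γ a)).lTensor A w) =
        TensorProduct.lift ((LinearMap.mul k A).compl₂ (twist T γ a ∘ₗ antipode k))
          (preGaloisMap k H A w) := by
      intro w
      induction w with
      | zero => simp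
      | add x y hx hy => simp only [map_add, hx, hy]
      | tmul x y =>
        rw [LinearMap.lTensor_tmul, coinvTrace_apply, preGaloisMap_tmul]
        generalize coaction k H A y = z
        induction z with
        | zero => simp
        | add x y hx hy =>
          simp only [map_add, mul_add, TensorProduct.tmul_add, hx, hy]
        | tmul p q => simp [mul_assoc]
    rw [rightSplittingAux_tmul, h3, hℓ]
    simp [hST]

theorem rightSplitting_mul_coe (a : A) (b : coinvariants k H A) :
    rightSplitting T γ ℓ (a * (b : A)) =
      ((LinearMap.mul k A).flip (b : A)).lTensor A (rightSplitting T γ ℓ a) := by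
  rw [rightSplitting, LinearMap.comp_apply, LinearMap.comp_apply, coaction_mul,
    show coaction k H A (b : A) = _ from b.2]
  generalize coaction k H A a = z
  induction z with
  | zero => simp
  | add x y hx hy => simp only [map_add, add_mul, hx, hy]
  | tmul a h =>
    have : twist T γ (a * (b : A)) = (LinearMap.mul k A).flip (b : A) ∘ₗ twist T γ a := by
      ext h
      simp [twist_mul_coe]
    rw [Algebra.TensorProduct.tmul_mul_tmul, mul_one, rightSplittingAux_tmul,
      rightSplittingAux_tmul, this, ← LinearMap.lTensor_comp_apply]
    congr 2
    ext x
    simp [← op_smul_coinvTrace]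

end RightSplitting

end TotalIntegral

/-! ### Slices of tensors over a field. -/

section Slices

variable {k C M N : Type*} [Field k] [AddCommGroup C] [Module k C]
  [AddCommGroup M] [Module k M] [AddCommGroup N] [Module k N]

/-- The map `m ⊗ c ↦ φ(c) m`. -/
noncomputable def slice (M : Type*) [AddCommGroup M] [Module k M] (φ : Module.Dual k C) :
    M ⊗[k] C →ₗ[k] M :=
  (TensorProduct.rid k M).toLinearMap ∘ₗ φ.lTensor M

@[simp]
theorem slice_tmul (φ : Module.Dual k C) (m : M) (c : C) : slice M φ (m ⊗ₜ c) = φ c • m := by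
  simp [slice]

theorem slice_rTensor (φ : Module.Dual k C) (f : M →ₗ[k] N) (z : M ⊗[k] C) :
    slice N φ (f.rTensor C z) = f (slice M φ z) := by
  induction z with
  | zero => simp
  | add x y hx hy => simp only [map_add, hx, hy]
  | tmul m c => simp

theorem eq_zero_of_slice {z : M ⊗[k] C} (h : ∀ φ : Module.Dual k C, slice M φ z = 0) : z = 0 := by
  classical
  let b := Module.Basis.ofVectorSpace k C
  have key : ∀ (i) (z : M ⊗[k] C),
      TensorProduct.equivFinsuppOfBasisRight b z i = slice M (b.coord i) z := by
    intro i z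
    induction z with
    | zero => simp
    | add x y hx hy => simp only [map_add, Finsupp.add_apply, hx, hy]
    | tmul m c => simp
  apply (TensorProduct.equivFinsuppOfBasisRight (M := M) b).injective
  ext i
  rw [key, h, map_zero, Finsupp.zero_apply]

/-- Slices commute with the quotient by `K`, and over a field they detect zero. Stability of a
subspace under a coaction can therefore be tested on functionals. -/
theorem mem_range_rTensor_subtype {K : Submodule k M} {z : M ⊗[k] C} :
    z ∈ LinearMap.range (K.subtype.rTensor C) ↔ ∀ φ : Module.Dual k C, slice M φ z ∈ K := by
  constructor
  · rintro ⟨w, rfl⟩ φ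
    rw [slice_rTensor]
    exact (slice K φ w).2
  · intro h
    have e := rTensor_exact C (LinearMap.exact_subtype_mkQ K) K.mkQ_surjective
    refine (e z).1 (eq_zero_of_slice fun φ => ?_)
    rw [slice_rTensor]
    simpa using h φ

end Slices

/-! ### Subcomodules and local finiteness. -/

section Subcomodule

open Coalgebra

variable {k C M : Type*} [Field k] [AddCommGroup C] [Module k C] [Coalgebra k C]
  [AddCommGroup M] [Module k M] [RightComodule k C M]

theorem rTensor_subtype_injective (K : Submodule k M) (C : Type*) [AddCommGroup C] [Module k C] :
    Function.Injective (K.subtype.rTensor C) :=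
  Module.Flat.rTensor_preserves_injective_linearMap _ K.injective_subtype

/-- The coaction on a subcomodule. -/
noncomputable def subCoact (K : Submodule k M)
    (hK : ∀ x ∈ K, coaction k C M x ∈ LinearMap.range (K.subtype.rTensor C)) : K →ₗ[k] K ⊗[k] C :=
  (LinearEquiv.ofInjective _ (rTensor_subtype_injective K C)).symm.toLinearMap ∘ₗ
    (coaction k C M ∘ₗ K.subtype).codRestrict _ fun x => hK x x.2

theorem rTensor_subCoact (K : Submodule k M)
    (hK : ∀ x ∈ K, coaction k C M x ∈ LinearMap.range (K.subtype.rTensor C)) (x : K) :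
    K.subtype.rTensor C (subCoact K hK x) = coaction k C M x := by
  have := (LinearEquiv.ofInjective _ (rTensor_subtype_injective K C)).apply_symm_apply
    ((coaction k C M ∘ₗ K.subtype).codRestrict _ (fun x => hK x x.2) x)
  exact congr($this.1)

/-- A subspace that is stable under the coaction is a comodule. -/
@[reducible]
noncomputable def subcomodule (K : Submodule k M)
    (hK : ∀ x ∈ K, coaction k C M x ∈ LinearMap.range (K.subtype.rTensor C)) :
    RightComodule k C K where
  coact := subCoact K hK
  coact_coassoc := by
    ext x
    apply rTensor_subtype_injective K (C ⊗[k] C)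
    have h1 : ∀ z : K ⊗[k] C, K.subtype.rTensor (C ⊗[k] C) (TensorProduct.assoc k K C C
        ((subCoact K hK).rTensor C z)) = TensorProduct.assoc k M C C
          ((coaction k C M).rTensor C (K.subtype.rTensor C z)) := by
      intro z
      induction z with
      | zero => simp
      | add x y hx hy => simp only [map_add, hx, hy]
      | tmul m c =>
        simp only [LinearMap.rTensor_tmul, Submodule.subtype_apply, ← rTensor_subCoact K hK]
        generalize subCoact K hK m = w
        induction w with
        | zero => simp
        | add x y hx hy => simp only [map_add, TensorProduct.add_tmul, hx, hy]
        | tmul m c => simp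
    have h2 : ∀ z : K ⊗[k] C, K.subtype.rTensor (C ⊗[k] C) (comul.lTensor K z) =
        comul.lTensor M (K.subtype.rTensor C z) := fun z => by
      rw [← LinearMap.comp_apply, ← LinearMap.comp_apply, LinearMap.lTensor_comp_rTensor,
        LinearMap.rTensor_comp_lTensor]
    simp only [LinearMap.comp_apply, LinearEquiv.coe_coe, h1, h2, rTensor_subCoact,
      coaction_coassoc, LinearEquiv.apply_symm_apply]
  coact_counit := by
    ext x
    have h1 : ∀ z : K ⊗[k] C, K.subtype (TensorProduct.rid k K (counit.lTensor K z)) =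
        TensorProduct.rid k M (counit.lTensor M (K.subtype.rTensor C z)) := by
      intro z
      induction z with
      | zero => simp
      | add x y hx hy => simp only [map_add, hx, hy]
      | tmul m c => simp
    refine (h1 _).trans ?_
    rw [rTensor_subCoact, coaction_counit]
    rfl

theorem IsColinear.apply {N : Type*} [AddCommGroup N] [Module k N] [RightComodule k C N]
    {f : M →ₗ[k] N} (hf : IsColinear k C f) (m : M) :
    f.rTensor C (coaction k C M m) = coaction k C N (f m) :=
  LinearMap.congr_fun hf m

/-- Coassociativity turns iterated slicing into slicing by a convolution product, so the slices of
the coaction of `m` form a subcomodule. -/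
theorem slice_slice_coaction (φ ψ : Module.Dual k C) (m : M) :
    slice M φ (coaction k C M (slice M ψ (coaction k C M m))) =
      slice M (LinearMap.mul' k k ∘ₗ TensorProduct.map φ ψ ∘ₗ comul) (coaction k C M m) := by
  rw [← slice_rTensor, coaction_coassoc]
  generalize coaction k C M m = z
  induction z with
  | zero => simp
  | add x y hx hy => simp only [map_add, hx, hy]
  | tmul m c =>
    rw [LinearMap.lTensor_tmul, slice_tmul, LinearMap.comp_apply, LinearMap.comp_apply]
    generalize comul (R := k) c = w
    induction w with
    | zero => simp
    | add x y hx hy => simp only [map_add, TensorProduct.tmul_add, hx, hy, add_smul]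
    | tmul p q => simp [smul_smul, mul_comm]

/-- The subcomodule generated by an element. -/
noncomputable def cyclicSubcomodule (k C : Type*) [Field k] {M : Type*} [AddCommGroup C] [Module k C]
    [Coalgebra k C]
    [AddCommGroup M] [Module k M] [RightComodule k C M] (m : M) : Submodule k M :=
  LinearMap.range (LinearMap.applyₗ (coaction k C M m) ∘ₗ
    LinearMap.compRight k (TensorProduct.rid k M).toLinearMap ∘ₗ
      LinearMap.lTensorHom (R := k) (N := C) (P := k) M)

theorem mem_cyclicSubcomodule_iff {m x : M} :
    x ∈ cyclicSubcomodule k C m ↔ ∃ φ : Module.Dual k C, slice M φ (coaction k C M m) = x := Iff.rfl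

theorem self_mem_cyclicSubcomodule (m : M) : m ∈ cyclicSubcomodule k C m :=
  mem_cyclicSubcomodule_iff.2 ⟨counit, coaction_counit m⟩

theorem coaction_mem_cyclicSubcomodule (m : M) (x : M) (hx : x ∈ cyclicSubcomodule k C m) :
    coaction k C M x ∈ LinearMap.range ((cyclicSubcomodule k C m).subtype.rTensor C) := by
  obtain ⟨ψ, rfl⟩ := mem_cyclicSubcomodule_iff.1 hx
  refine mem_range_rTensor_subtype.2 fun φ => mem_cyclicSubcomodule_iff.2
    ⟨_, (slice_slice_coaction φ ψ m).symm⟩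

/-- The coaction of `m` is a finite sum of pure tensors, and all slices lie in the span of their
left factors. -/
instance finite_cyclicSubcomodule (m : M) : Module.Finite k (cyclicSubcomodule k C m) := by
  have key : ∀ z : M ⊗[k] C, ∃ F : Submodule k M, Module.Finite k F ∧
      ∀ φ : Module.Dual k C, slice M φ z ∈ F := by
    intro z
    induction z with
    | zero => exact ⟨⊥, inferInstance, by simp⟩
    | tmul m c => 
      exact ⟨k ∙ m, inferInstance, fun φ => by
        rw [slice_tmul]; exact Submodule.smul_mem _ _ (Submodule.mem_span_singleton_self m)⟩
    | add x y hx hy =>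
      obtain ⟨F, hF, h⟩ := hx
      obtain ⟨G, hG, h'⟩ := hy
      refine ⟨F ⊔ G, inferInstance, fun φ => ?_⟩
      rw [map_add]
      exact Submodule.add_mem_sup (h φ) (h' φ)
  obtain ⟨F, hF, h⟩ := key (coaction k C M m)
  have hle : cyclicSubcomodule k C m ≤ F := by
    rintro x hx
    obtain ⟨φ, rfl⟩ := mem_cyclicSubcomodule_iff.1 hx
    exact h φ
  exact Module.Finite.of_injective _ (Submodule.inclusion_injective hle)

end Subcomodule

/-! ### A Baer-type criterion: finite-dimensional test comodules suffice. -/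

section Zorn

variable {k C X Y : Type*} [Field k] [AddCommGroup C] [Module k C] [Coalgebra k C]
  [AddCommGroup X] [Module k X] [RightComodule k C X]
  [AddCommGroup Y] [Module k Y] [RightComodule k C Y]

/-- The partial map `g` is colinear at the point `y` of its domain. -/
def IsColinearAt (C : Type*) [AddCommGroup C] [Module k C] [Coalgebra k C]
    [RightComodule k C X] [RightComodule k C Y] (g : Y →ₗ.[k] X) (y : g.domain) : Prop :=
  ∃ z : g.domain ⊗[k] C, g.domain.subtype.rTensor C z = coaction k C Y y ∧
    g.toFun.rTensor C z = coaction k C X (g y)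

theorem IsColinearAt.add {g : Y →ₗ.[k] X} {x y : g.domain} (hx : IsColinearAt C g x)
    (hy : IsColinearAt C g y) : IsColinearAt C g (x + y) := by
  obtain ⟨z, h1, h2⟩ := hx
  obtain ⟨w, h3, h4⟩ := hy
  exact ⟨z + w, by simp [h1, h3], by simp [h2, h4, LinearPMap.map_add]⟩

/-- The witness is pushed along the inclusion of domains. Being a condition at one point,
colinearity thus passes to suprema of partial maps. -/
theorem IsColinearAt.mono {g g' : Y →ₗ.[k] X} (hle : g ≤ g') {y : g.domain}
    (hy : IsColinearAt C g y) : IsColinearAt C g' ⟨y, hle.1 y.2⟩ := by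
  obtain ⟨z, h1, h2⟩ := hy
  refine ⟨(Submodule.inclusion hle.1).rTensor C z, ?_, ?_⟩
  · rw [← LinearMap.rTensor_comp_apply, Submodule.subtype_comp_inclusion, h1]
  · rw [← LinearMap.rTensor_comp_apply]
    have : g'.toFun ∘ₗ Submodule.inclusion hle.1 = g.toFun :=
      LinearMap.ext fun x => (LinearPMap.apply_comp_inclusion hle x).symm
    rw [this, h2, LinearPMap.apply_comp_inclusion hle y]
    rfl

/-- Comodule maps to `X` extend along injective maps of finite-dimensional comodules. -/
def IsFinInjectiveComodule (k C X : Type*) [Field k] [AddCommGroup C] [Module k C] [Coalgebra k C]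
    [AddCommGroup X] [Module k X] [RightComodule k C X] : Prop :=
  ∀ (E' E : Type t) [AddCommGroup E'] [Module k E'] [RightComodule k C E']
    [AddCommGroup E] [Module k E] [RightComodule k C E] [Module.Finite k E'] [Module.Finite k E]
    (i : E' →ₗ[k] E) (f : E' →ₗ[k] X), IsColinear k C i → Function.Injective i → IsColinear k C f →
      ∃ g : E →ₗ[k] X, IsColinear k C g ∧ g ∘ₗ i = f

/-- The new vector generates a finite-dimensional subcomodule `E`. The restriction of `g` to `E ⊓
g.domain` extends to `E` by hypothesis, and the result glues with `g` because both agree on the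
intersection. -/
theorem exists_extension_of_colinearAt {Y : Type t} [AddCommGroup Y] [Module k Y]
    [RightComodule k C Y] (hX : IsFinInjectiveComodule.{t} k C X)
    (g : Y →ₗ.[k] X) (hg : ∀ y, IsColinearAt C g y) (y : Y) :
    ∃ g' : Y →ₗ.[k] X, g ≤ g' ∧ y ∈ g'.domain ∧ ∀ y, IsColinearAt C g' y := by
  let E := cyclicSubcomodule k C y
  have hE : ∀ x ∈ E, coaction k C Y x ∈ LinearMap.range (E.subtype.rTensor C) :=
    coaction_mem_cyclicSubcomodule y
  let E' := E.comap g.domain.subtype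
  let _ : RightComodule k C E := subcomodule E hE
  let F := E ⊓ g.domain
  -- Stability of the intersection is checked slice by slice; the colinearity witness at `x` keeps
  -- the slices in the domain of `g`.
  have hF : ∀ x ∈ F, coaction k C Y x ∈ LinearMap.range (F.subtype.rTensor C) := by
    intro x hx
    refine mem_range_rTensor_subtype.2 fun φ => ⟨mem_range_rTensor_subtype.1 (hE x hx.1) φ, ?_⟩
    refine mem_range_rTensor_subtype.1 ?_ φ
    obtain ⟨z, hz, -⟩ := hg ⟨x, hx.2⟩
    exact ⟨z, hz⟩
  let _ : RightComodule k C F := subcomodule F hF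
  let i : F →ₗ[k] E := Submodule.inclusion inf_le_left
  let j : F →ₗ[k] g.domain := Submodule.inclusion inf_le_right
  have : Module.Finite k F := Module.Finite.of_injective i (Submodule.inclusion_injective _)
  have hi : IsColinear k C i := by
    ext x
    apply rTensor_subtype_injective E C
    simp only [LinearMap.comp_apply]
    rw [← LinearMap.rTensor_comp_apply]
    exact (rTensor_subCoact F hF x).trans (rTensor_subCoact E hE (i x)).symm
  have hf : IsColinear k C (g.toFun ∘ₗ j) := by
    ext x
    obtain ⟨z, h1, h2⟩ := hg (j x)
    have : j.rTensor C (coaction k C F x) = z := by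
      apply rTensor_subtype_injective g.domain C
      rw [← LinearMap.rTensor_comp_apply, h1]
      exact rTensor_subCoact F hF x
    simp only [LinearMap.comp_apply, LinearMap.rTensor_comp, this, h2]
    rfl
  obtain ⟨f', hf', hff'⟩ := hX F E i _ hi (Submodule.inclusion_injective _) hf
  let h : Y →ₗ.[k] X := ⟨E, f'⟩
  have hh : ∀ y, IsColinearAt C h y := fun x =>
    ⟨coaction k C E x, rTensor_subCoact E hE x, hf'.apply x⟩
  have compat : ∀ (x : g.domain) (y : h.domain), (x : Y) = y → g x = h y := by
    rintro ⟨x, hx⟩ ⟨y, hy⟩ (rfl : x = y)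
    exact (LinearMap.congr_fun hff' ⟨x, hy, hx⟩).symm
  refine ⟨g.sup h compat, LinearPMap.left_le_sup _ _ _,
    (LinearPMap.right_le_sup g h compat).1 (self_mem_cyclicSubcomodule y), ?_⟩
  rintro ⟨x, hx⟩
  obtain ⟨a, ha, b, hb, rfl⟩ := Submodule.mem_sup.1 hx
  exact ((hg ⟨a, ha⟩).mono (LinearPMap.left_le_sup g h compat)).add
    ((hh ⟨b, hb⟩).mono (LinearPMap.right_le_sup g h compat))

/-- Zorn's lemma for partial colinear maps that extend `f` on the range of `i`; a maximal one is
total by `exists_extension_of_colinearAt`. -/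
theorem IsFinInjectiveComodule.isInjectiveComodule (hX : IsFinInjectiveComodule.{t} k C X) :
    IsInjectiveComodule.{t} k C X := by
  intro X₀ Y _ _ _ _ _ _ i f hi hinj hf
  let g₀ : Y →ₗ.[k] X := ⟨LinearMap.range i, f ∘ₗ (LinearEquiv.ofInjective i hinj).symm⟩
  have hg₀ : ∀ x, g₀ ⟨i x, x, rfl⟩ = f x := fun x =>
    congrArg f ((LinearEquiv.ofInjective i hinj).symm_apply_apply x)
  have hc : ∀ y, IsColinearAt C g₀ y := by
    rintro ⟨_, x, rfl⟩
    refine ⟨i.rangeRestrict.rTensor C (coaction k C X₀ x), ?_, ?_⟩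
    · rw [← LinearMap.rTensor_comp_apply]
      exact hi.apply x
    · rw [← LinearMap.rTensor_comp_apply, hg₀, ← hf.apply x]
      congr 2
      ext x
      exact hg₀ x
  obtain ⟨g, hg₀g, hg⟩ := zorn_le_nonempty₀ {g : Y →ₗ.[k] X | ∀ y, IsColinearAt C g y} (by
    intro c hcs hchain g₁ hg₁
    have hd : DirectedOn (· ≤ ·) c := hchain.directedOn
    refine ⟨LinearPMap.sSup c hd, ?_, fun z hz => LinearPMap.le_sSup hd hz⟩
    rintro ⟨y, hy⟩
    obtain ⟨g, hg, hyg⟩ := (LinearPMap.mem_domain_sSup_iff ⟨g₁, hg₁⟩ hd).1 hy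
    exact (hcs hg ⟨y, hyg⟩).mono (LinearPMap.le_sSup hd hg)) g₀ hc
  have htop : ∀ y, y ∈ g.domain := by
    intro y
    obtain ⟨g', hgg', hy, hg'⟩ := exists_extension_of_colinearAt hX g hg.1 y
    exact (hg.2 hg' hgg').1 hy
  let e : Y →ₗ[k] g.domain := LinearMap.id.codRestrict _ htop
  refine ⟨g.toFun ∘ₗ e, ?_, ?_⟩
  · ext y
    obtain ⟨z, h1, h2⟩ := hg.1 (e y)
    have : e.rTensor C (coaction k C Y y) = z := by
      apply rTensor_subtype_injective g.domain C
      rw [← LinearMap.rTensor_comp_apply, h1]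
      exact LinearMap.congr_fun (LinearMap.rTensor_id C Y) _
    simp only [LinearMap.comp_apply, LinearMap.rTensor_comp, this, h2]
    rfl
  · ext x
    rw [← hg₀ x]
    exact (hg₀g.2 (x := ⟨i x, x, rfl⟩) (y := e (i x)) rfl).symm

end Zorn

/-! ### Tensoring over `R` with `X ⊗ C` and `Hom(E, X)`. -/

namespace BalancedTensor

section RightFactor

variable {k R P X : Type*} [CommRing k] [Ring R] [Algebra k R] [AddCommGroup P] [Module k P]
  [Module Rᵐᵒᵖ P] [IsScalarTower k Rᵐᵒᵖ P] [AddCommGroup X] [Module k X] [Module R X]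
  [IsScalarTower k R X]

/-- The map `x ↦ p ⊗ x`. -/
noncomputable def tmulLeft (k R : Type*) {P : Type*} (X : Type*) [CommRing k] [Ring R]
    [AddCommGroup P] [Module k P]
    [Module Rᵐᵒᵖ P] [AddCommGroup X] [Module k X] [Module R X] :
    P →ₗ[k] X →ₗ[k] BalancedTensor k R P X :=
  TensorProduct.curry (mk k R P X)

@[simp]
theorem tmulLeft_apply (p : P) (x : X) : tmulLeft k R X p x = mk k R P X (p ⊗ₜ x) := rfl

theorem map_id_comp {Y Z : Type*} [AddCommGroup Y] [Module k Y] [Module R Y]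
    [IsScalarTower k R Y] [AddCommGroup Z] [Module k Z] [Module R Z] [IsScalarTower k R Z]
    (f : X →ₗ[R] Y) (g : Y →ₗ[R] Z) (t : BalancedTensor k R P X) :
    map (k := k) (LinearMap.id : P →ₗ[Rᵐᵒᵖ] P) g (map (k := k) LinearMap.id f t) =
      map (k := k) LinearMap.id (g ∘ₗ f) t := by
  rw [← LinearMap.comp_apply]
  congr 1
  exact hom_ext fun n m => by simp

variable (k R P X) (C : Type*) [AddCommGroup C] [Module k C]

/-- The canonical map `P ⊗_R (X ⊗ C) → (P ⊗_R X) ⊗ C`. -/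
noncomputable def assocRight :
    BalancedTensor k R P (X ⊗[k] C) →ₗ[k] BalancedTensor k R P X ⊗[k] C :=
  lift ((mk k R P X).rTensor C ∘ₗ (TensorProduct.assoc k P X C).symm.toLinearMap) <| by
    intro p r z
    induction z with
    | zero => simp
    | add x y hx hy => simp only [smul_add, TensorProduct.tmul_add, map_add, hx, hy]
    | tmul x c => simp [TensorProduct.smul_tmul', mk_smul_tmul]

@[simp]
theorem assocRight_mk_tmul (p : P) (x : X) (c : C) :
    assocRight k R P X C (mk k R P _ (p ⊗ₜ (x ⊗ₜ c))) = mk k R P X (p ⊗ₜ x) ⊗ₜ c := by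
  simp [assocRight]

/-- The reverse reassociation is well defined on the balanced tensor product and is a left inverse.
-/
theorem assocRight_injective : Function.Injective (assocRight k R P X C) := by
  let τ : BalancedTensor k R P X ⊗[k] C →ₗ[k] BalancedTensor k R P (X ⊗[k] C) :=
    TensorProduct.lift <| lift (TensorProduct.curry (mk k R P (X ⊗[k] C) ∘ₗ
      (TensorProduct.assoc k P X C).toLinearMap)) <| by
        intro p r x
        ext c
        simp [mk_smul_tmul, TensorProduct.smul_tmul']
  have h : τ ∘ₗ assocRight k R P X C = LinearMap.id := by
    refine hom_ext fun p z => ?_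
    induction z with
    | zero => simp
    | add x y hx hy => simp only [TensorProduct.tmul_add, map_add, hx, hy]
    | tmul x c => simp [τ]
  exact Function.LeftInverse.injective (LinearMap.congr_fun h)

variable (E : Type*) [AddCommGroup E] [Module k E]

/-- The canonical map `P ⊗_R Hom(E, X) → Hom(E, P ⊗_R X)`. -/
noncomputable def evalHom :
    BalancedTensor k R P (E →ₗ[k] X) →ₗ[k] E →ₗ[k] BalancedTensor k R P X :=
  lift (TensorProduct.lift (LinearMap.llcomp k E X (BalancedTensor k R P X) ∘ₗ
      tmulLeft k R X)) <| by
    intro p r f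
    ext e
    simp [mk_smul_tmul]

variable {k R P X E}

@[simp]
theorem evalHom_mk_tmul (p : P) (f : E →ₗ[k] X) :
    evalHom k R P X E (mk k R P _ (p ⊗ₜ f)) = tmulLeft k R X p ∘ₗ f := by
  simp [evalHom]
  rfl

variable (X) in
/-- The map `x ↦ (e ↦ φ(e) x)`. -/
def smulRightHom (R : Type*) [Ring R] [Algebra k R] [Module R X] [IsScalarTower k R X]
    (φ : Module.Dual k E) : X →ₗ[R] E →ₗ[k] X where
  toFun x := φ.smulRight x
  map_add' x y := by ext; simp
  map_smul' r x := by ext e; exact smul_comm _ _ _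

theorem evalHom_map_smulRightHom (φ : Module.Dual k E) (t : BalancedTensor k R P X) (e : E) :
    evalHom k R P X E (map (k := k) LinearMap.id (smulRightHom X R φ) t) e = φ e • t := by
  suffices h : (LinearMap.applyₗ e ∘ₗ evalHom k R P X E) ∘ₗ
      map (k := k) LinearMap.id (smulRightHom X R φ) = φ e • LinearMap.id from
    LinearMap.congr_fun h t
  refine hom_ext fun p x => ?_
  simp [smulRightHom]

/-- A finite basis of `E` makes `Hom(E, X)` a finite sum of copies of `X`; the inverse sends `u` to
the sum of the values `u (b i)`, each moved in by the dual basis vector `b.coord i`. -/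
theorem evalHom_bijective {k R P X E : Type*} [Field k] [Ring R] [Algebra k R] [AddCommGroup P]
    [Module k P] [Module Rᵐᵒᵖ P] [IsScalarTower k Rᵐᵒᵖ P] [AddCommGroup X] [Module k X]
    [Module R X] [IsScalarTower k R X] [AddCommGroup E] [Module k E] [Module.Finite k E] :
    Function.Bijective (evalHom k R P X E) := by
  let b := Module.finBasis k E
  let inv : (E →ₗ[k] BalancedTensor k R P X) →ₗ[k] BalancedTensor k R P (E →ₗ[k] X) :=
    ∑ i, map (k := k) LinearMap.id (smulRightHom X R (b.coord i)) ∘ₗ LinearMap.applyₗ (b i)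
  have h1 : inv ∘ₗ evalHom k R P X E = LinearMap.id := by
    refine hom_ext fun p f => ?_
    simp only [inv, LinearMap.comp_apply, LinearMap.sum_apply, evalHom_mk_tmul,
      LinearMap.applyₗ_apply_apply, tmulLeft_apply, map_mk_tmul, LinearMap.id_apply]
    rw [← map_sum, ← TensorProduct.tmul_sum]
    congr 2
    refine b.ext fun j => ?_
    simp [smulRightHom, Finsupp.single_apply]
  have h2 : ∀ u, evalHom k R P X E (inv u) = u := by
    intro u
    ext e
    simp only [inv, LinearMap.comp_apply, LinearMap.sum_apply, map_sum,
      LinearMap.applyₗ_apply_apply,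
      evalHom_map_smulRightHom]
    conv_rhs => rw [← b.sum_repr e, map_sum]
    simp
  exact ⟨Function.LeftInverse.injective (LinearMap.congr_fun h1),
    Function.RightInverse.surjective h2⟩

end RightFactor

end BalancedTensor

/-! ### Descent of injectivity along a faithfully flat module. -/

section ColinearHoms

open Coalgebra

variable {k C : Type u} [Field k] [AddCommGroup C] [Module k C] [Coalgebra k C]

/-- A comodule map `f` to a cofree comodule extends along injective comodule maps. -/
theorem exists_cofree_extension {Q E' E : Type*} [AddCommGroup Q] [Module k Q]
    [AddCommGroup E'] [Module k E'] [RightComodule k C E']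
    [AddCommGroup E] [Module k E] [RightComodule k C E] (i : E' →ₗ[k] E) (hi : IsColinear k C i)
    (hinj : Function.Injective i) (f : E' →ₗ[k] Q ⊗[k] C)
    (hf : ∀ e, f.rTensor C (coaction k C E' e) =
      (TensorProduct.assoc k Q C C).symm (comul.lTensor Q (f e))) :
    ∃ g : E →ₗ[k] Q ⊗[k] C, (∀ e, g.rTensor C (coaction k C E e) =
      (TensorProduct.assoc k Q C C).symm (comul.lTensor Q (g e))) ∧ g ∘ₗ i = f := by
  obtain ⟨r, hr⟩ := i.exists_leftInverse_of_injective (LinearMap.ker_eq_bot.2 hinj)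
  -- A colinear map to a cofree comodule is recovered from its composite with the counit, so it is
  -- enough to extend `f₀` linearly, by means of the retraction `r`.
  let f₀ : E' →ₗ[k] Q := slice Q (counit (R := k) (A := C)) ∘ₗ f
  have hf₀ : ∀ e, f₀.rTensor C (coaction k C E' e) = f e := by
    intro e
    rw [LinearMap.rTensor_comp_apply, hf]
    generalize f e = z
    induction z with
    | zero => simp
    | add x y hx hy => simp only [map_add, hx, hy]
    | tmul q c =>
      have : ∀ w : C ⊗[k] C, (slice Q (counit (R := k) (A := C))).rTensor C
          ((TensorProduct.assoc k Q C C).symm (q ⊗ₜ w)) =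
          q ⊗ₜ (TensorProduct.lid k C (counit.rTensor C w)) := by
        intro w
        induction w with
        | zero => simp
        | add x y hx hy => simp only [map_add, TensorProduct.tmul_add, hx, hy]
        | tmul x y => simp [TensorProduct.smul_tmul]
      rw [LinearMap.lTensor_tmul, this]
      simp
  refine ⟨(f₀ ∘ₗ r).rTensor C ∘ₗ coaction k C E, fun e => ?_, ?_⟩
  · rw [LinearMap.rTensor_comp_apply, coaction_coassoc, LinearMap.comp_apply]
    generalize coaction k C E e = z
    induction z with
    | zero => simp
    | add x y hx hy => simp only [map_add, hx, hy]
    | tmul m c =>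
      rw [LinearMap.lTensor_tmul, LinearMap.rTensor_tmul, LinearMap.lTensor_tmul]
      generalize comul (R := k) c = w
      induction w with
      | zero => simp
      | add x y hx hy => simp only [map_add, TensorProduct.tmul_add, hx, hy]
      | tmul x y => simp
  · ext e
    rw [LinearMap.comp_apply, LinearMap.comp_apply, ← hi.apply, ← LinearMap.rTensor_comp_apply,
      LinearMap.comp_assoc, hr, LinearMap.comp_id, hf₀]

variable {R X : Type u} [Ring R] [Algebra k R] [AddCommGroup X] [Module k X] [Module R X]
  [IsScalarTower k R X] [RightComodule k C X]

/-- The ring `R` acts on the comodule `X` by comodule maps. -/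
def IsLinearCoaction (k C R X : Type*) [Field k] [AddCommGroup C] [Module k C] [Coalgebra k C]
    [Ring R] [Algebra k R] [AddCommGroup X] [Module k X] [Module R X] [IsScalarTower k R X]
    [RightComodule k C X] : Prop :=
  ∀ (r : R) (x : X), coaction k C X (r • x) = r • coaction k C X x

variable (C) in
/-- The coaction of a comodule with an action of `R` by comodule maps, as an `R`-linear map. -/
noncomputable def coactionLinear (hX : IsLinearCoaction k C R X) :
    X →ₗ[R] X ⊗[k] C where
  toFun := coaction k C X
  map_add' := map_add _
  map_smul' := hX

/-- The `R`-linear map on `Hom(E, X)` whose kernel consists of the comodule maps. -/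
noncomputable def colinearDefect (hX : IsLinearCoaction k C R X)
    (E : Type u) [AddCommGroup E] [Module k E] [RightComodule k C E] :
    (E →ₗ[k] X) →ₗ[R] E →ₗ[k] X ⊗[k] C where
  toFun f := coaction k C X ∘ₗ f - f.rTensor C ∘ₗ coaction k C E
  map_add' f g := by
    ext e
    simp [LinearMap.rTensor_add]
    abel
  map_smul' r f := by
    ext e
    have : ∀ z : E ⊗[k] C, (r • f).rTensor C z = r • f.rTensor C z := by
      intro z
      induction z with
      | zero => simp
      | add x y hx hy => simp only [map_add, smul_add, hx, hy]
      | tmul m c => simp [TensorProduct.smul_tmul']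
    simp [hX r, this, smul_sub]

theorem colinearDefect_apply (hX : IsLinearCoaction k C R X)
    (E : Type u) [AddCommGroup E] [Module k E] [RightComodule k C E] (f : E →ₗ[k] X) :
    colinearDefect hX E f = coaction k C X ∘ₗ f - f.rTensor C ∘ₗ coaction k C E := rfl

theorem colinearDefect_eq_zero_iff (hX : IsLinearCoaction k C R X)
    {E : Type u} [AddCommGroup E] [Module k E] [RightComodule k C E] {f : E →ₗ[k] X} :
    colinearDefect hX E f = 0 ↔ IsColinear k C f :=
  sub_eq_zero.trans eq_comm

/-- Restriction of comodule maps. -/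
noncomputable def colinearRestrict (hX : IsLinearCoaction k C R X)
    {E' E : Type u} [AddCommGroup E'] [Module k E'] [RightComodule k C E']
    [AddCommGroup E] [Module k E] [RightComodule k C E] (i : E' →ₗ[k] E) (hi : IsColinear k C i) :
    LinearMap.ker (colinearDefect hX E) →ₗ[R] LinearMap.ker (colinearDefect hX E') where
  toFun v := ⟨v.1 ∘ₗ i, (colinearDefect_eq_zero_iff hX).2 <| by
    have hv : IsColinear k C v.1 := (colinearDefect_eq_zero_iff hX).1 v.2
    unfold IsColinear at *
    rw [LinearMap.rTensor_comp, LinearMap.comp_assoc, hi, ← LinearMap.comp_assoc, hv,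
      LinearMap.comp_assoc]⟩
  map_add' v w := rfl
  map_smul' r v := rfl

variable {P : Type u} [AddCommGroup P] [Module k P] [Module Rᵐᵒᵖ P] [IsScalarTower k Rᵐᵒᵖ P]

variable (P) in
/-- The coaction on the right tensor factor of `P ⊗_R X`. -/
noncomputable def tensorCoact (hX : IsLinearCoaction k C R X) :
    BalancedTensor k R P X →ₗ[k] BalancedTensor k R P X ⊗[k] C :=
  BalancedTensor.assocRight k R P X C ∘ₗ
    BalancedTensor.map (k := k) LinearMap.id (coactionLinear C hX)

/-- Tensoring the defect with `P` gives the defect for maps into `P ⊗_R X`. Its kernel is thus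
described by colinear maps to that comodule when `E` is finite-dimensional. -/
theorem assocRight_evalHom_colinearDefect
    (hX : IsLinearCoaction k C R X)
    (E : Type u) [AddCommGroup E] [Module k E] [RightComodule k C E]
    (z : BalancedTensor k R P (E →ₗ[k] X)) :
    BalancedTensor.assocRight k R P X C ∘ₗ BalancedTensor.evalHom k R P (X ⊗[k] C) E
      (BalancedTensor.map (k := k) LinearMap.id (colinearDefect hX E) z) =
    tensorCoact P hX ∘ₗ BalancedTensor.evalHom k R P X E z -
      (BalancedTensor.evalHom k R P X E z).rTensor C ∘ₗ coaction k C E := by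
  ext e
  let L : BalancedTensor k R P (E →ₗ[k] X) →ₗ[k] BalancedTensor k R P X ⊗[k] C :=
    BalancedTensor.assocRight k R P X C ∘ₗ LinearMap.applyₗ e ∘ₗ
      BalancedTensor.evalHom k R P (X ⊗[k] C) E ∘ₗ
        BalancedTensor.map (k := k) LinearMap.id (colinearDefect hX E)
  let L' : BalancedTensor k R P (E →ₗ[k] X) →ₗ[k] BalancedTensor k R P X ⊗[k] C :=
    tensorCoact P hX ∘ₗ LinearMap.applyₗ e ∘ₗ BalancedTensor.evalHom k R P X E -
      LinearMap.applyₗ (coaction k C E e) ∘ₗ LinearMap.rTensorHom C ∘ₗ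
        BalancedTensor.evalHom k R P X E
  suffices h : L = L' from LinearMap.congr_fun h z
  refine BalancedTensor.hom_ext fun p f => ?_
  have h1 : ∀ w : E ⊗[k] C, BalancedTensor.assocRight k R P X C
      (BalancedTensor.mk k R P _ (p ⊗ₜ f.rTensor C w)) =
      (BalancedTensor.tmulLeft k R X p ∘ₗ f).rTensor C w := by
    intro w
    induction w with
    | zero => simp
    | add x y hx hy => simp only [map_add, TensorProduct.tmul_add, hx, hy]
    | tmul x c => simp
  simp only [L, L', LinearMap.comp_apply, LinearMap.sub_apply, BalancedTensor.map_mk_tmul,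
    BalancedTensor.evalHom_mk_tmul, LinearMap.applyₗ_apply_apply, LinearMap.id_apply,
    BalancedTensor.tmulLeft_apply, colinearDefect_apply, TensorProduct.tmul_sub, map_sub,
    tensorCoact, LinearMap.coe_rTensorHom, h1]
  rfl

/-- If `P` is a faithfully flat right `R`-module and `P ⊗_R X` is cofree, then comodule maps to `X`
extend along injective maps of finite-dimensional comodules. -/
theorem isFinInjectiveComodule_of_faithfullyFlat
    (hX : IsLinearCoaction k C R X)
    (hP : IsRightFaithfullyFlat.{u} k R P) {Q : Type*} [AddCommGroup Q] [Module k Q]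
    (β : BalancedTensor k R P X ≃ₗ[k] Q ⊗[k] C)
    (hβ : ∀ t, β.toLinearMap.rTensor C (tensorCoact P hX t) =
      (TensorProduct.assoc k Q C C).symm (comul.lTensor Q (β t))) :
    IsFinInjectiveComodule.{u} k C X := by
  intro E' E _ _ _ _ _ _ _ _ i f hi hinj hf
  -- Extendability along `i` is surjectivity of an `R`-linear map, which can be tested after
  -- tensoring with `P`, where the target comodule is cofree.
  let res := colinearRestrict hX i hi
  suffices hs : Function.Surjective res by
    obtain ⟨g, hg⟩ := hs ⟨f, (colinearDefect_eq_zero_iff hX).2 hf⟩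
    exact ⟨g.1, (colinearDefect_eq_zero_iff hX).1 g.2, congrArg Subtype.val hg⟩
  have flat_inj : Function.Injective (BalancedTensor.map (k := k) (LinearMap.id : P →ₗ[Rᵐᵒᵖ] P)
      (LinearMap.ker (colinearDefect hX E')).subtype) := by
    have h := (hP PUnit _ _ (0 : PUnit.{u+1} →ₗ[R] _)
      (LinearMap.ker (colinearDefect hX E')).subtype).1 (by
        intro x
        simp [eq_comm])
    have h0 : BalancedTensor.map (k := k) (LinearMap.id : P →ₗ[Rᵐᵒᵖ] P)
        (0 : PUnit.{u+1} →ₗ[R] LinearMap.ker (colinearDefect hX E')) = 0 :=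
      BalancedTensor.hom_ext fun p x => by simp
    rw [injective_iff_map_eq_zero]
    intro z hz
    obtain ⟨w, hw⟩ := (h z).1 hz
    rw [← hw, h0, LinearMap.zero_apply]
  have surj : Function.Surjective
      (BalancedTensor.map (k := k) (LinearMap.id : P →ₗ[Rᵐᵒᵖ] P) res) := by
    intro z'
    set ι' := BalancedTensor.map (k := k) (LinearMap.id : P →ₗ[Rᵐᵒᵖ] P)
      (LinearMap.ker (colinearDefect hX E')).subtype with hι'
    -- The map `E' → P ⊗_R X` represented by `z'`; it is colinear because `z'` comes from the kernel
    -- of the defect.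
    let u' := BalancedTensor.evalHom k R P X E' (ι' z')
    have hu' : tensorCoact P hX ∘ₗ u' = u'.rTensor C ∘ₗ coaction k C E' := by
      rw [← sub_eq_zero, ← assocRight_evalHom_colinearDefect, hι', BalancedTensor.map_id_comp]
      have : colinearDefect hX E' ∘ₗ (LinearMap.ker (colinearDefect hX E')).subtype = 0 :=
        LinearMap.ext fun v => v.2
      rw [this, show BalancedTensor.map (k := k) (LinearMap.id : P →ₗ[Rᵐᵒᵖ] P)
        (0 : LinearMap.ker (colinearDefect hX E') →ₗ[R] E' →ₗ[k] X ⊗[k] C) = 0 from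
          BalancedTensor.hom_ext fun p x => by simp]
      simp
    obtain ⟨w, hw, hwi⟩ := exists_cofree_extension i hi hinj (β.toLinearMap ∘ₗ u') (by
      intro e
      rw [LinearMap.rTensor_comp_apply, ← LinearMap.comp_apply, ← LinearMap.comp_apply,
        LinearMap.comp_assoc, ← hu']
      exact hβ _)
    -- Finite dimension of `E` turns the extension, carried back along `β`, into an element of `P
    -- ⊗_R Hom(E, X)`.
    obtain ⟨z, hz⟩ := BalancedTensor.evalHom_bijective.2 (β.symm.toLinearMap ∘ₗ w)
    have hDz : BalancedTensor.map (k := k) LinearMap.id (colinearDefect hX E) z = 0 := by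
      apply BalancedTensor.evalHom_bijective.1
      rw [map_zero]
      ext e
      apply BalancedTensor.assocRight_injective
      rw [LinearMap.zero_apply, map_zero]
      refine (LinearMap.congr_fun (assocRight_evalHom_colinearDefect hX E z) e).trans ?_
      rw [hz, LinearMap.sub_apply, sub_eq_zero]
      have inj : Function.Injective (β.toLinearMap.rTensor C) :=
        (LinearEquiv.rTensor C β).injective
      apply inj
      simp only [LinearMap.comp_apply, hβ, ← LinearMap.rTensor_comp_apply]
      have e1 : β.toLinearMap ∘ₗ β.symm.toLinearMap ∘ₗ w = w := by ext; simp
      rw [e1, hw]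
      simp
    -- Exactness after tensoring lifts `z` from the kernel of the tensored defect to `P` tensor the
    -- kernel.
    obtain ⟨y, hy⟩ := ((hP _ _ _ (LinearMap.ker (colinearDefect hX E)).subtype
      (colinearDefect hX E)).1 (LinearMap.exact_subtype_ker_map _) z).1 hDz
    refine ⟨y, flat_inj (BalancedTensor.evalHom_bijective.1 ?_)⟩
    have h3 : ∀ y, BalancedTensor.evalHom k R P X E' (ι' (BalancedTensor.map (k := k)
        (LinearMap.id : P →ₗ[Rᵐᵒᵖ] P) res y)) = BalancedTensor.evalHom k R P X E
          (BalancedTensor.map (k := k) LinearMap.id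
            (LinearMap.ker (colinearDefect hX E)).subtype y) ∘ₗ i := by
      intro y
      suffices h : BalancedTensor.evalHom k R P X E' ∘ₗ ι' ∘ₗ BalancedTensor.map (k := k)
        (LinearMap.id : P →ₗ[Rᵐᵒᵖ] P) res = LinearMap.lcomp k _ i ∘ₗ
          BalancedTensor.evalHom k R P X E ∘ₗ (BalancedTensor.map (k := k) LinearMap.id
            (LinearMap.ker (colinearDefect hX E)).subtype) from LinearMap.congr_fun h y
      refine BalancedTensor.hom_ext fun p v => ?_
      simp [hι', res, colinearRestrict]
      rfl
    rw [h3, hy, hz, LinearMap.comp_assoc, hwi]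
    change _ = u'
    ext
    simp
  -- Surjectivity is exactness of `res` followed by the map to zero, and faithful flatness reflects
  -- it.
  have h := (hP _ _ PUnit.{u+1} res (0 : _ →ₗ[R] PUnit.{u+1})).2 (by
    intro z
    have h0 : BalancedTensor.map (k := k) (LinearMap.id : P →ₗ[Rᵐᵒᵖ] P)
        (0 : LinearMap.ker (colinearDefect hX E') →ₗ[R] PUnit.{u+1}) = 0 :=
      BalancedTensor.hom_ext fun p x => by
        rw [BalancedTensor.map_mk_tmul, LinearMap.zero_apply, TensorProduct.tmul_zero, map_zero,
          LinearMap.zero_apply]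
    simp [h0, surj z])
  intro v
  exact (h v).1 rfl

end ColinearHoms

/-! ### Passage to the opposite ring. -/

section Opposite

variable {k R M : Type*} [CommRing k] [Ring R] [Algebra k R] [AddCommGroup M] [Module k M]
  [Module R M] [Module Rᵐᵒᵖᵐᵒᵖ M]
  (hM : ∀ (r : R) (m : M), op (op r) • m = r • m)

/-- The map `M ⊗_{Rᵒᵖ} N → N ⊗_R M`, `m ⊗ n ↦ n ⊗ m`. -/
noncomputable def BalancedTensor.swapHom (N : Type*) [AddCommGroup N] [Module k N]
    [Module Rᵐᵒᵖ N] : BalancedTensor k Rᵐᵒᵖ M N →ₗ[k] BalancedTensor k R N M :=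
  BalancedTensor.lift (BalancedTensor.mk k R N M ∘ₗ (TensorProduct.comm k M N).toLinearMap) <| by
    intro m r n
    induction r using MulOpposite.rec' with
    | h r => simp [hM, BalancedTensor.mk_smul_tmul]

/-- The map `N ⊗_R M → M ⊗_{Rᵒᵖ} N`, `n ⊗ m ↦ m ⊗ n`. -/
noncomputable def BalancedTensor.swapInv (N : Type*) [AddCommGroup N] [Module k N]
    [Module Rᵐᵒᵖ N] : BalancedTensor k R N M →ₗ[k] BalancedTensor k Rᵐᵒᵖ M N :=
  BalancedTensor.lift (BalancedTensor.mk k Rᵐᵒᵖ M N ∘ₗ (TensorProduct.comm k N M).toLinearMap) <| by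
    intro n r m
    simp [← hM, BalancedTensor.mk_smul_tmul]

theorem BalancedTensor.swapHom_mk_tmul {N : Type*} [AddCommGroup N] [Module k N]
    [Module Rᵐᵒᵖ N] (m : M) (n : N) :
    BalancedTensor.swapHom hM N (BalancedTensor.mk k Rᵐᵒᵖ M N (m ⊗ₜ n)) =
      BalancedTensor.mk k R N M (n ⊗ₜ m) := rfl

theorem BalancedTensor.swapInv_mk_tmul {N : Type*} [AddCommGroup N] [Module k N]
    [Module Rᵐᵒᵖ N] (m : M) (n : N) :
    BalancedTensor.swapInv hM N (BalancedTensor.mk k R N M (n ⊗ₜ m)) =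
      BalancedTensor.mk k Rᵐᵒᵖ M N (m ⊗ₜ n) := rfl

/-- The isomorphism `M ⊗_{Rᵒᵖ} N ≃ N ⊗_R M`. -/
noncomputable def BalancedTensor.swap (N : Type*) [AddCommGroup N] [Module k N]
    [Module Rᵐᵒᵖ N] : BalancedTensor k Rᵐᵒᵖ M N ≃ₗ[k] BalancedTensor k R N M :=
  LinearEquiv.ofLinearMap (BalancedTensor.swapHom hM N) (BalancedTensor.swapInv hM N)
    (BalancedTensor.hom_ext fun n m => by
      rw [LinearMap.comp_apply, swapInv_mk_tmul, swapHom_mk_tmul, LinearMap.id_apply])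
    (BalancedTensor.hom_ext fun n m => by
      rw [LinearMap.comp_apply, swapHom_mk_tmul, swapInv_mk_tmul, LinearMap.id_apply])

theorem BalancedTensor.swap_mk_tmul {N : Type*} [AddCommGroup N] [Module k N]
    [Module Rᵐᵒᵖ N] (m : M) (n : N) :
    BalancedTensor.swap hM N (BalancedTensor.mk k Rᵐᵒᵖ M N (m ⊗ₜ n)) =
      BalancedTensor.mk k R N M (n ⊗ₜ m) := rfl

/-- The two tensor sequences agree up to `swap`. This makes the descent argument, stated for right
modules, available for left ones. -/
theorem IsLeftFaithfullyFlat.opposite (hM : ∀ (r : R) (m : M), op (op r) • m = r • m)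
    [IsScalarTower k R M] [IsScalarTower k Rᵐᵒᵖᵐᵒᵖ M]
    (h : IsLeftFaithfullyFlat.{t} k R M) : IsRightFaithfullyFlat.{t} k Rᵐᵒᵖ M := by
  intro N₁ N₂ N₃ _ _ _ _ _ _ _ _ _ _ _ _ f g
  rw [h N₁ N₂ N₃ f g]
  refine Function.Exact.iff_of_ladder_linearEquiv (e₁ := BalancedTensor.swap hM N₁)
    (e₂ := BalancedTensor.swap hM N₂) (e₃ := BalancedTensor.swap hM N₃) ?_ ?_ <;>
  exact BalancedTensor.hom_ext fun m n => by simp [BalancedTensor.swap_mk_tmul]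

/-- A left `R`-module is a right module over the opposite ring. -/
@[reducible]
def opOpModule (R M : Type*) [Ring R] [AddCommGroup M] [Module R M] : Module Rᵐᵒᵖᵐᵒᵖ M :=
  Module.compHom M (RingEquiv.opOp R).symm.toRingHom

end Opposite

/-! ### Galois and faithfully flat implies injective. -/

section GaloisInjective

open Coalgebra HopfAlgebra

variable {k H A : Type u} [Field k] [Ring H] [HopfAlgebra k H] [Ring A] [Algebra k A]
  [RightComoduleAlgebra k H A]

theorem coaction_coinvariants_smul :
    IsLinearCoaction k H (coinvariants k H A) A := by
  intro b a
  refine (coaction_coe_mul k H A b a).trans ?_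
  generalize coaction k H A a = z
  induction z with
  | zero => exact (mul_zero _).trans (smul_zero _).symm
  | add x y hx hy =>
    rw [mul_add, hx, hy]
    exact (smul_add _ _ _).symm
  | tmul x h =>
    rw [Algebra.TensorProduct.tmul_mul_tmul, one_mul, TensorProduct.smul_tmul']
    rfl

theorem coaction_op_coinvariants_smul :
    IsLinearCoaction k H (coinvariants k H A)ᵐᵒᵖ A := by
  intro b a
  induction b using MulOpposite.rec' with
  | h b =>
    rw [op_smul_def, coaction_mul, show coaction k H A (b : A) = _ from b.2]
    generalize coaction k H A a = z
    induction z with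
    | zero => simp
    | add x y hx hy => simp only [add_mul, smul_add, hx, hy]
    | tmul x h =>
      rw [Algebra.TensorProduct.tmul_mul_tmul, mul_one, TensorProduct.smul_tmul', op_smul_def]

theorem tensorCoact_mk_tmul {k C R X P : Type u} [Field k] [AddCommGroup C] [Module k C]
    [Coalgebra k C] [Ring R] [Algebra k R] [AddCommGroup X] [Module k X] [Module R X]
    [IsScalarTower k R X] [RightComodule k C X] [AddCommGroup P] [Module k P] [Module Rᵐᵒᵖ P]
    [IsScalarTower k Rᵐᵒᵖ P]
    (hX : IsLinearCoaction k C R X) (p : P) (x : X) :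
    tensorCoact P hX (BalancedTensor.mk k R P X (p ⊗ₜ x)) =
      (BalancedTensor.tmulLeft k R X p).rTensor C (coaction k C X x) := by
  rw [tensorCoact, LinearMap.comp_apply, BalancedTensor.map_mk_tmul]
  change BalancedTensor.assocRight k R P X C
    (BalancedTensor.mk k R P _ (p ⊗ₜ coaction k C X x)) = _
  generalize coaction k C X x = z
  induction z with
  | zero => simp
  | add x y hx hy => simp only [map_add, TensorProduct.tmul_add, hx, hy]
  | tmul x c => simp

/-- With the coaction on the right factor, `A ⊗_B A` is identified by the Galois map with the cofree
comodule `A ⊗ H`, so the descent argument applies. -/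
theorem isInjectiveComodule_of_right_faithfullyFlat (hG : IsHopfGalois k H A)
    (hA : IsRightFaithfullyFlat.{u} k (coinvariants k H A) A) :
    IsInjectiveComodule.{u} k H A := by
  refine (isFinInjectiveComodule_of_faithfullyFlat coaction_coinvariants_smul hA
    (LinearEquiv.ofBijective (galoisMap k H A) hG) fun t => ?_).isInjectiveComodule
  let L : BalancedTensor k (coinvariants k H A) A A →ₗ[k] (A ⊗[k] H) ⊗[k] H :=
    (galoisMap k H A).rTensor H ∘ₗ tensorCoact A coaction_coinvariants_smul
  let L' : BalancedTensor k (coinvariants k H A) A A →ₗ[k] (A ⊗[k] H) ⊗[k] H :=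
    (TensorProduct.assoc k A H H).symm.toLinearMap ∘ₗ comul.lTensor A ∘ₗ galoisMap k H A
  suffices h : L = L' from LinearMap.congr_fun h t
  refine BalancedTensor.hom_ext fun x y => ?_
  simp only [L, L', LinearMap.comp_apply, tensorCoact_mk_tmul, galoisMap_mk, preGaloisMap_tmul]
  rw [← LinearMap.rTensor_comp_apply]
  have e : galoisMap k H A ∘ₗ BalancedTensor.tmulLeft k (coinvariants k H A) A x =
    LinearMap.mul k (A ⊗[k] H) (x ⊗ₜ 1) ∘ₗ coaction k H A := rfl
  rw [e, LinearMap.rTensor_comp_apply, coaction_coassoc]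
  generalize coaction k H A y = z
  induction z with
  | zero => simp
  | add x y hx hy => simp only [map_add, mul_add, hx, hy]
  | tmul a h =>
    simp only [LinearMap.lTensor_tmul, Algebra.TensorProduct.tmul_mul_tmul, one_mul]
    generalize comul (R := k) h = w
    induction w with
    | zero => simp
    | add x y hx hy => simp only [map_add, TensorProduct.tmul_add, hx, hy]
    | tmul p q => simp

/-- If `F` satisfies `F(h₁ ⊗ h₂) = ε(h)`, then `a₍₀₎ ⊗ F(a₍₁₎ ⊗ a₍₂₎) = a ⊗ 1`. -/
theorem rTensor_coaction_cancel (L : (A ⊗[k] H) ⊗[k] H →ₗ[k] A ⊗[k] H) (F : H ⊗[k] H →ₗ[k] H)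
    (hL : ∀ a p q, L ((a ⊗ₜ p) ⊗ₜ q) = a ⊗ₜ F (p ⊗ₜ q))
    (hF : ∀ h, F (comul h) = algebraMap k H (counit h)) (a : A) :
    L ((coaction k H A).rTensor H (coaction k H A a)) = a ⊗ₜ 1 := by
  rw [coaction_coassoc]
  conv_rhs => rw [← coaction_counit (k := k) (C := H) a]
  generalize coaction k H A a = z
  induction z with
  | zero => simp
  | add x y hx hy => simp only [map_add, TensorProduct.add_tmul, hx, hy]
  | tmul a h =>
    have : ∀ w : H ⊗[k] H, L ((TensorProduct.assoc k A H H).symm (a ⊗ₜ w)) = a ⊗ₜ F w := by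
      intro w
      induction w with
      | zero => simp
      | add x y hx hy => simp only [map_add, TensorProduct.tmul_add, hx, hy]
      | tmul p q => simp [hL]
    rw [LinearMap.lTensor_tmul, this, hF, Algebra.algebraMap_eq_smul_one]
    simp [TensorProduct.smul_tmul]

variable (k H A) in
/-- The map `a ⊗ h ↦ a₍₀₎ ⊗ a₍₁₎ S(h)`. -/
noncomputable def galoisFlip : A ⊗[k] H →ₗ[k] A ⊗[k] H :=
  TensorProduct.lift ((LinearMap.mul k (A ⊗[k] H) ∘ₗ coaction k H A).compl₂
    (Algebra.TensorProduct.includeRight.toLinearMap ∘ₗ antipode k))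

theorem galoisFlip_tmul (a : A) (h : H) :
    galoisFlip k H A (a ⊗ₜ h) = coaction k H A a * (1 ⊗ₜ antipode k h) := rfl

/-- In `x₀ y₀ ⊗ x₁ y₁ S(y₂)` the antipode axiom removes the legs of `y`. The flip thus turns the
Galois map into its mirror `x ⊗ y ↦ x₀ y ⊗ x₁`, colinear for the coaction on the left factor. -/
theorem galoisFlip_mul_coaction (x y : A) :
    galoisFlip k H A ((x ⊗ₜ 1) * coaction k H A y) = coaction k H A x * (y ⊗ₜ 1) := by
  have h := rTensor_coaction_cancel (TensorProduct.lift ((LinearMap.mul k (A ⊗[k] H)).compl₂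
    (Algebra.TensorProduct.includeRight.toLinearMap ∘ₗ antipode k)))
    (LinearMap.mul' k H ∘ₗ (antipode k).lTensor H) (by simp) (by simp) y
  rw [← h]
  generalize coaction k H A y = z
  induction z with
  | zero => simp
  | add x y hx hy => simp only [map_add, mul_add, hx, hy]
  | tmul a h => simp [galoisFlip_tmul, coaction_mul, mul_assoc]

/-- The inverse is `a ⊗ h ↦ a₀ ⊗ T(h) a₁`; the two cancellations are `T(h₂) h₁ = ε(h)` and the
antipode axiom. -/
theorem galoisFlip_bijective (hS : Function.Bijective (antipode k : H →ₗ[k] H)) :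
    Function.Bijective (galoisFlip k H A) := by
  let T : H →ₗ[k] H := (LinearEquiv.ofBijective (antipode k) hS).symm
  have hST : ∀ h, antipode k (T h) = h := (LinearEquiv.ofBijective _ hS).apply_symm_apply
  have hTS : ∀ h, T (antipode k h) = h := (LinearEquiv.ofBijective _ hS).symm_apply_apply
  let Ψ : A ⊗[k] H →ₗ[k] A ⊗[k] H :=
    TensorProduct.lift (((LinearMap.mul k (A ⊗[k] H)).flip ∘ₗ coaction k H A).compl₂
      (Algebra.TensorProduct.includeRight.toLinearMap ∘ₗ T))
  constructor
  · suffices h : Ψ ∘ₗ galoisFlip k H A = LinearMap.id from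
      Function.LeftInverse.injective (LinearMap.congr_fun h)
    refine TensorProduct.ext' fun a h => ?_
    have e := rTensor_coaction_cancel (TensorProduct.lift
      ((LinearMap.mul k (A ⊗[k] H)).flip.compl₂
        (Algebra.TensorProduct.includeRight.toLinearMap ∘ₗ T)))
      (LinearMap.mul' k H ∘ₗ TensorProduct.map T .id ∘ₗ (TensorProduct.comm k H H).toLinearMap)
      (by simp) (inv_antipode_mul hTS hST) a
    have e' : (a ⊗ₜ h : A ⊗[k] H) = (1 ⊗ₜ h) * (a ⊗ₜ 1) := by simp
    rw [LinearMap.comp_apply, galoisFlip_tmul, LinearMap.id_apply, e', ← e]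
    generalize coaction k H A a = z
    induction z with
    | zero => simp
    | add x y hx hy => simp only [map_add, add_mul, mul_add, hx, hy]
    | tmul p q => simp [Ψ, inv_antipode_mul_rev hTS hST, hTS, ← mul_assoc]
  · suffices h : galoisFlip k H A ∘ₗ Ψ = LinearMap.id from
      Function.RightInverse.surjective (LinearMap.congr_fun h)
    refine TensorProduct.ext' fun a h => ?_
    have e := rTensor_coaction_cancel (TensorProduct.lift
      ((LinearMap.mul k (A ⊗[k] H)).compl₂
        (Algebra.TensorProduct.includeRight.toLinearMap ∘ₗ antipode k)))
      (LinearMap.mul' k H ∘ₗ (antipode k).lTensor H) (by simp) (by simp) a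
    have e' : (a ⊗ₜ h : A ⊗[k] H) = (a ⊗ₜ 1) * (1 ⊗ₜ h) := by simp
    have e'' : Ψ (a ⊗ₜ h) = (1 ⊗ₜ T h) * coaction k H A a := rfl
    rw [LinearMap.comp_apply, LinearMap.id_apply, e'', e', ← e]
    generalize coaction k H A a = z
    induction z with
    | zero => simp
    | add x y hx hy => simp only [map_add, add_mul, mul_add, hx, hy]
    | tmul p q => simp [galoisFlip_tmul, antipode_mul_antidistrib, hST, mul_assoc]

/-- The descent argument is run over the opposite of `B`: the mirrored Galois map makes `A ⊗_B A`,
now with the coaction on the left factor, cofree. -/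
theorem isInjectiveComodule_of_left_faithfullyFlat
    (hS : Function.Bijective (antipode k : H →ₗ[k] H)) (hG : IsHopfGalois k H A)
    (hA : IsLeftFaithfullyFlat.{u} k (coinvariants k H A) A) :
    IsInjectiveComodule.{u} k H A := by
  let _ := opOpModule (coinvariants k H A) A
  have hop : ∀ (r : coinvariants k H A) (a : A), op (op r) • a = r • a := fun _ _ => rfl
  have _ : IsScalarTower k (coinvariants k H A)ᵐᵒᵖᵐᵒᵖ A :=
    ⟨fun c r m => smul_assoc c r.unop.unop m⟩
  let β := BalancedTensor.swap (k := k) hop A ≪≫ₗ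
    LinearEquiv.ofBijective (galoisMap k H A) hG ≪≫ₗ
      LinearEquiv.ofBijective (galoisFlip k H A) (galoisFlip_bijective hS)
  have hβ : ∀ p x : A, β (BalancedTensor.mk k _ A A (p ⊗ₜ x)) =
      coaction k H A x * (p ⊗ₜ 1) := by
    intro p x
    rw [← galoisFlip_mul_coaction]
    rfl
  refine (isFinInjectiveComodule_of_faithfullyFlat coaction_op_coinvariants_smul (hA.opposite hop)
    β fun t => ?_).isInjectiveComodule
  let L : BalancedTensor k (coinvariants k H A)ᵐᵒᵖ A A →ₗ[k] (A ⊗[k] H) ⊗[k] H :=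
    β.toLinearMap.rTensor H ∘ₗ tensorCoact A coaction_op_coinvariants_smul
  let L' : BalancedTensor k (coinvariants k H A)ᵐᵒᵖ A A →ₗ[k] (A ⊗[k] H) ⊗[k] H :=
    (TensorProduct.assoc k A H H).symm.toLinearMap ∘ₗ comul.lTensor A ∘ₗ β.toLinearMap
  suffices h : L = L' from LinearMap.congr_fun h t
  refine BalancedTensor.hom_ext fun p x => ?_
  simp only [L, L', LinearMap.comp_apply, tensorCoact_mk_tmul, LinearEquiv.coe_coe, hβ]
  rw [← LinearMap.rTensor_comp_apply]
  have e : β.toLinearMap ∘ₗ BalancedTensor.tmulLeft k (coinvariants k H A)ᵐᵒᵖ A p =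
      (LinearMap.mul k (A ⊗[k] H)).flip (p ⊗ₜ 1) ∘ₗ coaction k H A :=
    LinearMap.ext fun x => hβ p x
  rw [e, LinearMap.rTensor_comp_apply, coaction_coassoc]
  generalize coaction k H A x = z
  induction z with
  | zero => simp
  | add x y hx hy => simp only [map_add, add_mul, hx, hy]
  | tmul a h =>
    simp only [LinearMap.lTensor_tmul, Algebra.TensorProduct.tmul_mul_tmul, mul_one]
    generalize comul (R := k) h = w
    induction w with
    | zero => simp
    | add x y hx hy => simp only [map_add, TensorProduct.tmul_add, hx, hy]
    | tmul p q => simp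

end GaloisInjective

theorem BalancedTensor.induction_on {k R N M : Type*} [CommRing k] [Ring R]
    [AddCommGroup N] [Module k N] [Module Rᵐᵒᵖ N] [AddCommGroup M] [Module k M] [Module R M]
    {p : BalancedTensor k R N M → Prop} (x : BalancedTensor k R N M)
    (tmul : ∀ n m, p (mk k R N M (n ⊗ₜ m))) (zero : p 0)
    (add : ∀ x y, p x → p y → p (x + y)) : p x := by
  obtain ⟨z, rfl⟩ := (balancedRel k R N M).mkQ_surjective x
  change p (mk k R N M z)
  induction z with
  | zero => rwa [map_zero]
  | add x y hx hy => rw [map_add]; exact add _ _ hx hy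
  | tmul n m => exact tmul n m

/-! ### Hopf submodules. -/

section HopfSubmodules

variable {k H A M : Type*} [Field k] [Ring H] [Bialgebra k H] [Ring A] [Algebra k A]
  [RightComoduleAlgebra k H A] [AddCommGroup M] [Module k M] [Module Aᵐᵒᵖ M]
  [IsScalarTower k Aᵐᵒᵖ M] [RightComodule k H M]

instance restrictScalars_isScalarTower (K : Submodule Aᵐᵒᵖ M) :
    IsScalarTower k Aᵐᵒᵖ (K.restrictScalars k) :=
  ⟨fun c a x => Subtype.ext (smul_assoc c a (x : M))⟩

theorem isHopfModule_subcomodule [IsHopfModule k H A M] (K : Submodule Aᵐᵒᵖ M)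
    (hK : ∀ x ∈ K.restrictScalars k, coaction k H M x ∈
      LinearMap.range ((K.restrictScalars k).subtype.rTensor H)) :
    let _ : RightComodule k H (K.restrictScalars k) := subcomodule _ hK
    IsHopfModule k H A (K.restrictScalars k) := by
  intro _
  refine ⟨fun x a => rTensor_subtype_injective (K.restrictScalars k) H ?_⟩
  refine (rTensor_subCoact _ hK (op a • x)).trans ?_
  change coaction k H M (op a • (x : M)) = _
  rw [IsHopfModule.coact_smul, ← rTensor_subCoact _ hK x]
  change _ = (K.restrictScalars k).subtype.rTensor H
    (TensorProduct.map₂ _ _ (subCoact _ hK x) _)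
  generalize subCoact _ hK x = u
  generalize coaction k H A a = v
  induction u with
  | zero => simp
  | add x y hx hy => simp only [map_add, LinearMap.add_apply, hx, hy]
  | tmul x h =>
    induction v with
    | zero => simp
    | add x y hx hy => simp only [map_add, hx, hy]
    | tmul x' h' => rfl

end HopfSubmodules

/-! ### The Hopf module `A ⊗ H`. -/

section CofreeHopfModule

open Coalgebra

section CofreeComodule

variable (k C Q : Type*) [Field k] [AddCommGroup C] [Module k C] [Coalgebra k C]
  [AddCommGroup Q] [Module k Q]

/-- The coaction `q ⊗ c ↦ (q ⊗ c₁) ⊗ c₂` of a cofree comodule. -/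
noncomputable def cofreeCoact : Q ⊗[k] C →ₗ[k] (Q ⊗[k] C) ⊗[k] C :=
  (TensorProduct.assoc k Q C C).symm.toLinearMap ∘ₗ comul.lTensor Q

variable {k C Q} in
theorem cofreeCoact_apply (z : Q ⊗[k] C) :
    cofreeCoact k C Q z = (TensorProduct.assoc k Q C C).symm (comul.lTensor Q z) := rfl

/-- Cofree comodules. -/
@[reducible]
noncomputable def cofreeComodule : RightComodule k C (Q ⊗[k] C) where
  coact := cofreeCoact k C Q
  coact_coassoc := by
    refine TensorProduct.ext' fun a h => ?_
    simp only [LinearMap.comp_apply, cofreeCoact_apply, LinearMap.lTensor_tmul, LinearEquiv.coe_coe]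
    have h1 : ∀ w : C ⊗[k] C, TensorProduct.assoc k (Q ⊗[k] C) C C
        ((cofreeCoact k C Q).rTensor C ((TensorProduct.assoc k Q C C).symm (a ⊗ₜ w))) =
        (TensorProduct.mk k Q C a).rTensor (C ⊗[k] C) (TensorProduct.assoc k C C C
          (comul.rTensor C w)) := by
      intro w
      induction w with
      | zero => simp
      | add x y hx hy => simp only [map_add, TensorProduct.tmul_add, hx, hy]
      | tmul x y =>
        simp only [TensorProduct.assoc_symm_tmul, LinearMap.rTensor_tmul, cofreeCoact_apply,
          LinearMap.lTensor_tmul]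
        generalize comul (R := k) x = v
        induction v with
        | zero => simp
        | add x y hx hy =>
          simp only [map_add, TensorProduct.tmul_add, TensorProduct.add_tmul, hx, hy]
        | tmul p q => simp
    have h2 : ∀ w : C ⊗[k] C, comul.lTensor (Q ⊗[k] C) ((TensorProduct.assoc k Q C C).symm
        (a ⊗ₜ w)) = (TensorProduct.mk k Q C a).rTensor (C ⊗[k] C) (comul.lTensor C w) := by
      intro w
      induction w with
      | zero => simp
      | add x y hx hy => simp only [map_add, TensorProduct.tmul_add, hx, hy]
      | tmul x y => simp
    rw [h1, h2, coassoc_apply]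
  coact_counit := by
    refine TensorProduct.ext' fun a h => ?_
    have h2 : ∀ w : C ⊗[k] C, TensorProduct.rid k (Q ⊗[k] C) (counit.lTensor (Q ⊗[k] C)
        ((TensorProduct.assoc k Q C C).symm (a ⊗ₜ w))) =
        a ⊗ₜ TensorProduct.rid k C (counit.lTensor C w) := by
      intro w
      induction w with
      | zero => simp
      | add x y hx hy => simp only [map_add, TensorProduct.tmul_add, hx, hy]
      | tmul x y => simp
    simp only [LinearMap.comp_apply, cofreeCoact_apply, LinearMap.lTensor_tmul, LinearEquiv.coe_coe,
      h2, LinearMap.id_apply]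
    simp

end CofreeComodule

variable (k H A : Type*) [Field k] [Ring H] [Bialgebra k H] [Ring A] [Algebra k A]
  [RightComoduleAlgebra k H A]

theorem cofreeCoact_mul (z w : A ⊗[k] H) :
    cofreeCoact k H A (z * w) = cofreeCoact k H A z * cofreeCoact k H A w := by
  induction w with
  | zero => simp
  | add x y hx hy => simp only [map_add, mul_add, hx, hy]
  | tmul p q =>
    induction z with
    | zero => simp
    | add x y hx hy => simp only [map_add, add_mul, hx, hy]
    | tmul x y =>
      simp only [Algebra.TensorProduct.tmul_mul_tmul, cofreeCoact_apply, LinearMap.lTensor_tmul,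
        Bialgebra.comul_mul]
      generalize comul (R := k) y = v
      generalize comul (R := k) q = w
      induction v with
      | zero => simp
      | add x y hx hy => simp only [map_add, add_mul, TensorProduct.tmul_add, hx, hy]
      | tmul x y =>
        induction w with
        | zero => simp
        | add x y hx hy => simp only [map_add, mul_add, TensorProduct.tmul_add, hx, hy]
        | tmul => simp

theorem map₂_mul_coaction (v : (A ⊗[k] H) ⊗[k] H) (u : A ⊗[k] H) :
    TensorProduct.map₂ ((LinearMap.mul k (A ⊗[k] H)).compl₂ (coaction k H A))
      (LinearMap.mul k H) v u = v * (coaction k H A).rTensor H u := by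
  induction u with
  | zero => simp
  | add x y hx hy => simp only [map_add, mul_add, hx, hy]
  | tmul p q =>
    induction v with
    | zero => simp
    | add x y hx hy => simp only [map_add, LinearMap.add_apply, add_mul, hx, hy]
    | tmul x y => simp

/-- The space `A ⊗ H`, as a Hopf module with action `(x ⊗ h) a = x a₍₀₎ ⊗ h a₍₁₎` and coaction
`x ⊗ h ↦ (x ⊗ h₁) ⊗ h₂`. -/
def CofreeHopfModule : Type _ := A ⊗[k] H

noncomputable instance : AddCommGroup (CofreeHopfModule k H A) :=
  inferInstanceAs (AddCommGroup (A ⊗[k] H))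

noncomputable instance : Module k (CofreeHopfModule k H A) :=
  inferInstanceAs (Module k (A ⊗[k] H))

/-- The coaction of a comodule algebra, as a ring homomorphism. -/
noncomputable def coactionRingHom : A →+* A ⊗[k] H where
  toFun := coaction k H A
  map_one' := coaction_one k H A
  map_mul' := coaction_mul k H A
  map_zero' := map_zero _
  map_add' := map_add _

noncomputable instance : Module Aᵐᵒᵖ (CofreeHopfModule k H A) :=
  let _ : Module (A ⊗[k] H)ᵐᵒᵖ (CofreeHopfModule k H A) :=
    inferInstanceAs (Module (A ⊗[k] H)ᵐᵒᵖ (A ⊗[k] H))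
  Module.compHom _ (coactionRingHom k H A).op

variable {k H A} in
theorem CofreeHopfModule.op_smul_def (a : A) (z : A ⊗[k] H) :
    (op a • (show CofreeHopfModule k H A from z) : CofreeHopfModule k H A) =
      z * coaction k H A a := rfl

instance : IsScalarTower k Aᵐᵒᵖ (CofreeHopfModule k H A) where
  smul_assoc c a z := by
    induction a using MulOpposite.rec' with
    | h a =>
      change A ⊗[k] H at z
      change z * coaction k H A (c • a) = c • (z * coaction k H A a)
      rw [map_smul, mul_smul_comm]

noncomputable instance : RightComodule k H (CofreeHopfModule k H A) :=
  cofreeComodule k H A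

instance : IsHopfModule k H A (CofreeHopfModule k H A) where
  coact_smul z a := by
    change A ⊗[k] H at z
    refine (cofreeCoact_mul k H A z (coaction k H A a)).trans ?_
    rw [cofreeCoact_apply (coaction k H A a), ← coaction_coassoc]
    exact (map₂_mul_coaction k H A _ _).symm

/-- Apply the counit to the middle factor of the hypothesis. Hence the coinvariants of `A ⊗ H` lie
in `A ⊗ 1`. -/
theorem CofreeHopfModule.eq_tmul_one_of_coinvariant (z : A ⊗[k] H)
    (hz : cofreeCoact k H A z = z ⊗ₜ 1) :
    z = slice A (counit (R := k) (A := H)) z ⊗ₜ[k] 1 := by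
  have h1 : ∀ w : A ⊗[k] H, (slice A (counit (R := k) (A := H))).rTensor H
      ((TensorProduct.assoc k A H H).symm (comul.lTensor A w)) = w := by
    intro w
    induction w with
    | zero => simp
    | add x y hx hy => simp only [map_add, hx, hy]
    | tmul a h =>
      have : ∀ w : H ⊗[k] H, (slice A (counit (R := k) (A := H))).rTensor H
          ((TensorProduct.assoc k A H H).symm (a ⊗ₜ w)) =
          a ⊗ₜ (TensorProduct.lid k H (counit.rTensor H w)) := by
        intro w
        induction w with
        | zero => simp
        | add x y hx hy => simp only [map_add, TensorProduct.tmul_add, hx, hy]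
        | tmul x y => simp [TensorProduct.smul_tmul]
      rw [LinearMap.lTensor_tmul, this]
      simp
  conv_lhs => rw [← h1 z, ← cofreeCoact_apply, hz]
  exact LinearMap.rTensor_tmul _ _ _ _

end CofreeHopfModule

/-! ### Maps out of induced Hopf modules. -/

section InducedMap

variable {k H A : Type u} [Field k] [Ring H] [Bialgebra k H] [Ring A] [Algebra k A]
  [RightComoduleAlgebra k H A] {N M : Type*} [AddCommGroup N] [Module k N]
  [Module (coinvariants k H A)ᵐᵒᵖ N] [IsScalarTower k (coinvariants k H A)ᵐᵒᵖ N]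
  [AddCommGroup M] [Module k M] [Module Aᵐᵒᵖ M] [IsScalarTower k Aᵐᵒᵖ M]

/-- The map `n ⊗ a ↦ ι(n) a`. -/
noncomputable def inducedMap (ι : N →ₗ[k] M)
    (hι : ∀ (b : coinvariants k H A) (n : N), ι (op b • n) = op (b : A) • ι n) :
    BalancedTensor k (coinvariants k H A) N A →ₗ[Aᵐᵒᵖ] M :=
  let f : BalancedTensor k (coinvariants k H A) N A →ₗ[k] M :=
    BalancedTensor.lift (TensorProduct.lift (rightAction k A M ∘ₗ ι)) <| by
      intro n b a
      simp only [TensorProduct.lift.tmul, LinearMap.comp_apply, hι, rightAction_apply, smul_smul]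
      rfl
  { f with
    map_smul' := fun a x => by
      change f (a • x) = a • f x
      induction a using MulOpposite.rec' with
      | h a =>
        induction x using BalancedTensor.induction_on with
        | zero => simp
        | add x y hx hy => simp only [smul_add, map_add, hx, hy]
        | tmul n y => rw [op_smul_mk]; simp [f, mul_smul] }

@[simp]
theorem inducedMap_mk_tmul (ι : N →ₗ[k] M)
    (hι : ∀ (b : coinvariants k H A) (n : N), ι (op b • n) = op (b : A) • ι n) (n : N) (a : A) :
    inducedMap ι hι (BalancedTensor.mk k _ N A (n ⊗ₜ a)) = op a • ι n := by
  refine (BalancedTensor.lift_mk _ ?_ _).trans (by simp)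
  intro n b a
  simp only [TensorProduct.lift.tmul, LinearMap.comp_apply, hι, rightAction_apply, smul_smul]
  rfl

theorem coaction_induced_mk (n : N) (a : A) :
    coaction k H (BalancedTensor k (coinvariants k H A) N A) (BalancedTensor.mk k _ N A (n ⊗ₜ a)) =
      (BalancedTensor.tmulLeft k (coinvariants k H A) A n).rTensor H (coaction k H A a) :=
  inducedCoact_mk k H A N n a

theorem coaction_induced_mk_one (n : N) :
    coaction k H (BalancedTensor k (coinvariants k H A) N A) (BalancedTensor.mk k _ N A (n ⊗ₜ 1)) =
      BalancedTensor.mk k _ N A (n ⊗ₜ 1) ⊗ₜ 1 := by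
  rw [coaction_induced_mk, coaction_one, Algebra.TensorProduct.one_def]
  rfl

theorem mk_op_smul_tmul_one (n : N) (b : coinvariants k H A) :
    BalancedTensor.mk k (coinvariants k H A) N A ((op b • n) ⊗ₜ 1) =
      op (b : A) • BalancedTensor.mk k (coinvariants k H A) N A (n ⊗ₜ 1) := by
  rw [BalancedTensor.mk_smul_tmul, op_smul_mk, one_mul]
  congr 2
  exact mul_one _

theorem isColinear_inducedMap [RightComodule k H M] [IsHopfModule k H A M] (ι : N →ₗ[k] M)
    (hι : ∀ (b : coinvariants k H A) (n : N), ι (op b • n) = op (b : A) • ι n)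
    (hc : ∀ n, coaction k H M (ι n) = ι n ⊗ₜ 1) :
    IsColinear k H ((inducedMap ι hι).restrictScalars k) := by
  refine BalancedTensor.hom_ext fun n a => ?_
  rw [LinearMap.comp_apply, LinearMap.comp_apply, coaction_induced_mk,
    ← LinearMap.rTensor_comp_apply]
  change _ = coaction k H M (inducedMap ι hι _)
  rw [inducedMap_mk_tmul, IsHopfModule.coact_smul, hc]
  generalize coaction k H A a = z
  induction z with
  | zero => simp
  | add x y hx hy => simp only [map_add, hx, hy]
  | tmul p q => simp

/-- If `E : N ⊗_B A → A ⊗ H` is an isomorphism of Hopf modules such that `N` maps onto the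
coinvariants, then the Galois map is bijective. -/
theorem isHopfGalois_of_induced
    (E : BalancedTensor k (coinvariants k H A) N A →ₗ[Aᵐᵒᵖ] CofreeHopfModule k H A)
    (hc : IsColinear k H (E.restrictScalars k)) (hE : Function.Bijective E)
    (hs : ∀ a : A, ∃ n : N, E (BalancedTensor.mk k _ N A (n ⊗ₜ 1)) =
      (show A ⊗[k] H from a ⊗ₜ 1)) : IsHopfGalois k H A := by
  -- Elements `n ⊗ 1` are coinvariant, so `E` maps them into `A ⊗ 1`; the counit reads off the
  -- component in `A`.
  let θ₀ : N →ₗ[k] A := slice A (Coalgebra.counit (R := k) (A := H)) ∘ₗ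
    (E.restrictScalars k : _ →ₗ[k] A ⊗[k] H) ∘ₗ
      (BalancedTensor.tmulLeft k (coinvariants k H A) A).flip 1
  have hθ : ∀ n : N, E (BalancedTensor.mk k _ N A (n ⊗ₜ 1)) = (show A ⊗[k] H from θ₀ n ⊗ₜ 1) := by
    intro n
    refine CofreeHopfModule.eq_tmul_one_of_coinvariant k H A _ ?_
    refine (hc.apply _).symm.trans ?_
    rw [coaction_induced_mk_one]
    rfl
  have inj1 : ∀ a a' : A, a ⊗ₜ[k] (1 : H) = a' ⊗ₜ[k] (1 : H) → a = a' := fun a a' h => by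
    simpa using congrArg (slice A (Coalgebra.counit (R := k) (A := H))) h
  let θ : N →ₗ[(coinvariants k H A)ᵐᵒᵖ] A :=
    { θ₀ with
      map_smul' := fun b n => inj1 _ _ <| by
        induction b using MulOpposite.rec' with
        | h b =>
          refine (hθ (op b • n)).symm.trans ?_
          rw [mk_op_smul_tmul_one, map_smul, hθ]
          refine (CofreeHopfModule.op_smul_def _ _).trans ?_
          rw [show coaction k H A (b : A) = _ from b.2]
          exact (Algebra.TensorProduct.tmul_mul_tmul _ _ _ _).trans
            (congrArg _ (one_mul (1 : H))) }
  let Θ : BalancedTensor k (coinvariants k H A) N A →ₗ[k]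
      BalancedTensor k (coinvariants k H A) A A :=
    BalancedTensor.map (k := k) θ (LinearMap.id : A →ₗ[coinvariants k H A] A)
  -- `E` factors through the Galois map. Since `Θ` is surjective, bijectivity of `E` passes to the
  -- Galois map.
  have hΘ : ∀ z, galoisMap k H A (Θ z) = E z := by
    suffices h : galoisMap k H A ∘ₗ Θ = E.restrictScalars k from LinearMap.congr_fun h
    refine BalancedTensor.hom_ext fun n a => ?_
    rw [LinearMap.comp_apply, BalancedTensor.map_mk_tmul]
    change _ = E _
    have h := E.map_smul (op a) (BalancedTensor.mk k _ N A (n ⊗ₜ 1))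
    rw [hθ, op_smul_mk, one_mul] at h
    exact h.symm
  have hΘs : Function.Surjective Θ := by
    intro z
    induction z using BalancedTensor.induction_on with
    | zero => exact ⟨0, map_zero _⟩
    | add x y hx hy =>
      obtain ⟨x, rfl⟩ := hx
      obtain ⟨y, rfl⟩ := hy
      exact ⟨x + y, map_add _ _ _⟩
    | tmul a a' =>
      obtain ⟨n, hn⟩ := hs a
      refine ⟨BalancedTensor.mk k _ N A (n ⊗ₜ a'), ?_⟩
      rw [BalancedTensor.map_mk_tmul, ← inj1 _ _ ((hθ n).symm.trans hn)]
      rfl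
  constructor
  · rw [injective_iff_map_eq_zero]
    intro z hz
    obtain ⟨w, rfl⟩ := hΘs z
    rw [hΘ] at hz
    rw [hE.1 (hz.trans (map_zero E).symm), map_zero]
  · intro z
    obtain ⟨w, hw⟩ := hE.2 z
    exact ⟨Θ w, (hΘ w).trans hw⟩

end InducedMap

/-! ### Consequences of induction being an equivalence. -/

section Category

open CategoryTheory

variable {k H A : Type u} [Field k] [Ring H] [Bialgebra k H] [Ring A] [Algebra k A]
  [RightComoduleAlgebra k H A]

namespace HopfModuleCat

/-- The underlying linear map of a morphism of Hopf modules. -/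
abbrev lin {M N : HopfModuleCat k H A} (f : M ⟶ N) : M.carrier →ₗ[Aᵐᵒᵖ] N.carrier :=
  Hom.toLinearMap f

theorem lin_comp {M N P : HopfModuleCat k H A} (f : M ⟶ N) (g : N ⟶ P) :
    lin (f ≫ g) = lin g ∘ₗ lin f := rfl

theorem hom_ext {M N : HopfModuleCat k H A} {f g : M ⟶ N} (h : lin f = lin g) : f = g :=
  Hom.ext h

theorem coaction_lin {M N : HopfModuleCat k H A} (f : M ⟶ N) (m : M.carrier) :
    coaction k H N.carrier (lin f m) =
      ((lin f).restrictScalars k).rTensor H (coaction k H M.carrier m) :=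
  (Hom.isColinear f).apply m |>.symm

theorem lin_bijective {M N : HopfModuleCat k H A} (e : M ≅ N) :
    Function.Bijective (lin e.hom) :=
  ⟨Function.LeftInverse.injective (g := lin e.inv) fun x =>
      LinearMap.congr_fun (congrArg lin e.hom_inv_id) x,
    Function.RightInverse.surjective (g := lin e.inv) fun x =>
      LinearMap.congr_fun (congrArg lin e.inv_hom_id) x⟩

/-- Bijective morphisms of Hopf modules are isomorphisms. -/
noncomputable def isoOfBijective {M N : HopfModuleCat k H A} (f : M ⟶ N)
    (hf : Function.Bijective (lin f)) : M ≅ N where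
  hom := f
  inv :=
    { toLinearMap := (LinearEquiv.ofBijective (lin f) hf).symm.toLinearMap
      isColinear := by
        ext x
        obtain ⟨y, rfl⟩ := hf.2 x
        set e := LinearEquiv.ofBijective (lin f) hf
        have he : (e.symm.toLinearMap.restrictScalars k) ∘ₗ (lin f).restrictScalars k =
          LinearMap.id := LinearMap.ext fun x => e.symm_apply_apply x
        have he' : e.symm.toLinearMap.restrictScalars k (lin f y) = y := e.symm_apply_apply y
        rw [LinearMap.comp_apply, LinearMap.comp_apply, coaction_lin,
          ← LinearMap.rTensor_comp_apply, he, he']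
        simp }
  hom_inv_id := hom_ext <| LinearMap.ext fun x =>
    (LinearEquiv.ofBijective (lin f) hf).symm_apply_apply x
  inv_hom_id := hom_ext <| LinearMap.ext fun x =>
    (LinearEquiv.ofBijective (lin f) hf).apply_symm_apply x

end HopfModuleCat

open HopfModuleCat

/-- The kernel of a morphism of Hopf modules. -/
noncomputable def kernelHopfModule {M N : HopfModuleCat k H A} (f : M ⟶ N) :
    HopfModuleCat k H A :=
  have hK : ∀ x ∈ (LinearMap.ker (lin f)).restrictScalars k, coaction k H M.carrier x ∈
      LinearMap.range (((LinearMap.ker (lin f)).restrictScalars k).subtype.rTensor H) := by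
    intro x hx
    refine mem_range_rTensor_subtype.2 fun φ => ?_
    change lin f x = 0 at hx
    change (lin f).restrictScalars k _ = 0
    rw [← slice_rTensor, ← coaction_lin, hx, map_zero, map_zero]
  let _ : RightComodule k H ((LinearMap.ker (lin f)).restrictScalars k) := subcomodule _ hK
  have _ : IsHopfModule k H A ((LinearMap.ker (lin f)).restrictScalars k) :=
    isHopfModule_subcomodule _ hK
  { carrier := (LinearMap.ker (lin f)).restrictScalars k }

/-- The inclusion of the kernel of a morphism of Hopf modules. -/
noncomputable def kernelHopfModuleι {M N : HopfModuleCat k H A} (f : M ⟶ N) :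
    kernelHopfModule f ⟶ M where
  toLinearMap := (LinearMap.ker (lin f)).subtype
  isColinear := LinearMap.ext fun x => rTensor_subCoact _ _ x

open scoped ModuleCat

theorem lin_map_mk {X Y : ModuleCat.{u} (coinvariants k H A)ᵐᵒᵖ} (f : X ⟶ Y) (x : X) (a : A) :
    lin ((inductionFunctor k H A).map f) (BalancedTensor.mk k _ X A (x ⊗ₜ a)) =
      BalancedTensor.mk k _ Y A (f.hom x ⊗ₜ a) :=
  BalancedTensor.map_mk_tmul _ _ _ _

theorem lin_map_zero {X Y : ModuleCat.{u} (coinvariants k H A)ᵐᵒᵖ} :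
    lin ((inductionFunctor k H A).map (0 : X ⟶ Y)) = 0 := by
  refine LinearMap.ext fun x => ?_
  change BalancedTensor.map (k := k) (0 : X →ₗ[(coinvariants k H A)ᵐᵒᵖ] Y) LinearMap.id x =
    (0 : _ →ₗ[k] BalancedTensor k (coinvariants k H A) Y A) x
  congr 1
  exact BalancedTensor.hom_ext fun n a => by
    rw [BalancedTensor.map_mk_tmul, LinearMap.zero_apply, TensorProduct.zero_tmul, map_zero]
    rfl

/-- The morphism from an induced Hopf module that is given by a linear map to the coinvariants. -/
noncomputable def inducedHom {X : ModuleCat.{u} (coinvariants k H A)ᵐᵒᵖ} {M : HopfModuleCat k H A}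
    (ι : X →+ M.carrier) (hι : ∀ (b : coinvariants k H A) (n : X), ι (op b • n) = op (b : A) • ι n)
    (hc : ∀ n, coaction k H M.carrier (ι n) = ι n ⊗ₜ 1) : (inductionFunctor k H A).obj X ⟶ M :=
  let ι' : X →ₗ[k] M.carrier := { ι with
    map_smul' := fun c x => by
      have h := hι (algebraMap k _ c) x
      have e : op (algebraMap k (coinvariants k H A) c) • x = c • x := rfl
      have e' : op ((algebraMap k (coinvariants k H A) c : coinvariants k H A) : A) • ι x =
          c • ι x := by
        change op (algebraMap k A c) • ι x = _
        rw [Algebra.algebraMap_eq_smul_one, op_smul, op_one, smul_assoc, one_smul]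
      exact (congrArg ι e).symm.trans (h.trans e') }
  { toLinearMap := inducedMap ι' hι
    isColinear := isColinear_inducedMap ι' hι hc }

theorem lin_inducedHom_mk {X : ModuleCat.{u} (coinvariants k H A)ᵐᵒᵖ} {M : HopfModuleCat k H A}
    (ι : X →+ M.carrier) (hι : ∀ (b : coinvariants k H A) (n : X), ι (op b • n) = op (b : A) • ι n)
    (hc : ∀ n, coaction k H M.carrier (ι n) = ι n ⊗ₜ 1) (x : X) (a : A) :
    lin (inducedHom ι hι hc) (BalancedTensor.mk k _ X A (x ⊗ₜ a)) = op a • ι x :=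
  inducedMap_mk_tmul _ hι _ _

section Equivalence

variable [(inductionFunctor k H A).IsEquivalence]

theorem eq_zero_of_lin_map_eq_zero {X Y : ModuleCat.{u} (coinvariants k H A)ᵐᵒᵖ} {f : X ⟶ Y}
    (h : lin ((inductionFunctor k H A).map f) = 0) : f = 0 :=
  (inductionFunctor k H A).map_injective (HopfModuleCat.hom_ext (h.trans lin_map_zero.symm))

/-- The kernel is a Hopf module, hence induced by essential surjectivity, and fullness makes its
inclusion an induced map. -/
theorem exists_range_map_eq_ker {Y : ModuleCat.{u} (coinvariants k H A)ᵐᵒᵖ}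
    {M : HopfModuleCat k H A} (φ : (inductionFunctor k H A).obj Y ⟶ M) :
    ∃ (X : ModuleCat.{u} (coinvariants k H A)ᵐᵒᵖ) (f : X ⟶ Y),
      LinearMap.range (lin ((inductionFunctor k H A).map f)) = LinearMap.ker (lin φ) := by
  let e := (inductionFunctor k H A).objObjPreimageIso (kernelHopfModule φ)
  obtain ⟨f, hf⟩ := (inductionFunctor k H A).map_surjective (e.hom ≫ kernelHopfModuleι φ)
  refine ⟨_, f, ?_⟩
  rw [hf, lin_comp, LinearMap.range_comp_of_range_eq_top _
    (LinearMap.range_eq_top.2 (lin_bijective e).2)]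
  exact Submodule.range_subtype _

/-- Every coinvariant of a Hopf module `N ⊗_B A ≅ M` comes from `N` if induction is an
equivalence. -/
theorem exists_lin_mk_tmul_one_eq {X : ModuleCat.{u} (coinvariants k H A)ᵐᵒᵖ}
    {M : HopfModuleCat k H A} (e : (inductionFunctor k H A).obj X ≅ M) {m : M.carrier}
    (hm : coaction k H M.carrier m = m ⊗ₜ 1) :
    ∃ x : X, lin e.hom (BalancedTensor.mk k _ X A (x ⊗ₜ 1)) = m := by
  let R := ModuleCat.of (coinvariants k H A)ᵐᵒᵖ (coinvariants k H A)ᵐᵒᵖ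
  let ι : R →+ M.carrier :=
    { toFun := fun b : (coinvariants k H A)ᵐᵒᵖ => op (b.unop : A) • m
      map_zero' := zero_smul _ m
      map_add' := fun b c => add_smul (op (b.unop : A)) (op (c.unop : A)) m }
  -- A coinvariant is a morphism out of the module induced from `B`. Fullness descends `ψ ≫ e.inv`
  -- to a map `B → X`, and its value at `1` is the required element.
  let ψ := inducedHom (X := R) ι
    (fun b c => mul_smul (op (b : A)) (op ((show (coinvariants k H A)ᵐᵒᵖ from c).unop : A)) m) (by
      intro b
      change (coinvariants k H A)ᵐᵒᵖ at b
      change coaction k H M.carrier (op (b.unop : A) • m) = (op (b.unop : A) • m) ⊗ₜ 1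
      rw [IsHopfModule.coact_smul, hm, show coaction k H A (b.unop : A) = _ from b.unop.2]
      simp)
  obtain ⟨u, hu⟩ := (inductionFunctor k H A).map_surjective (ψ ≫ e.inv)
  refine ⟨u.hom (1 : (coinvariants k H A)ᵐᵒᵖ), ?_⟩
  have h : lin ((inductionFunctor k H A).map u ≫ e.hom) = lin ψ := by
    rw [hu, Category.assoc, e.inv_hom_id, Category.comp_id]
  rw [← lin_map_mk]
  refine (LinearMap.congr_fun h _).trans ((lin_inducedHom_mk _ _ _ _ _).trans ?_)
  change op (1 : A) • op (1 : A) • m = m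
  simp

/-- The Hopf module `A ⊗ H` is induced from some module, and the elements `a ⊗ 1` are coinvariant,
so they come from that module. -/
theorem isHopfGalois_of_isEquivalence : IsHopfGalois k H A := by
  let M : HopfModuleCat k H A := { carrier := CofreeHopfModule k H A }
  let e := (inductionFunctor k H A).objObjPreimageIso M
  exact isHopfGalois_of_induced (lin e.hom) (Hom.isColinear e.hom) (lin_bijective e) fun a =>
    exists_lin_mk_tmul_one_eq e <| by
      change cofreeCoact k H A (a ⊗ₜ[k] (1 : H)) = (a ⊗ₜ[k] (1 : H)) ⊗ₜ[k] (1 : H)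
      simp [cofreeCoact_apply, Algebra.TensorProduct.one_def]

theorem exact_iff_of_isEquivalence {X Y Z : ModuleCat.{u} (coinvariants k H A)ᵐᵒᵖ} (f : X ⟶ Y)
    (g : Y ⟶ Z) : Function.Exact f.hom g.hom ↔
      Function.Exact (lin ((inductionFunctor k H A).map f))
        (lin ((inductionFunctor k H A).map g)) := by
  constructor
  · intro h
    have hfg : f ≫ g = 0 := by
      ext x
      exact h.apply_apply_eq_zero x
    have h0 : lin ((inductionFunctor k H A).map g) ∘ₗ lin ((inductionFunctor k H A).map f) = 0 := by
      rw [← lin_comp, ← Functor.map_comp, hfg, lin_map_zero]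
    -- The kernel of the induced `g` is the range of an induced `v`. Faithfulness gives `v ≫ g = 0`,
    -- so `v` takes values in the range of `f`.
    obtain ⟨N, v, hv⟩ := exists_range_map_eq_ker ((inductionFunctor k H A).map g)
    have hvg : v ≫ g = 0 := eq_zero_of_lin_map_eq_zero <| by
      rw [Functor.map_comp, lin_comp]
      ext x
      exact (hv.le ⟨x, rfl⟩ : _)
    intro y
    refine ⟨fun hy => ?_, fun ⟨x, hx⟩ => hx ▸ LinearMap.congr_fun h0 x⟩
    obtain ⟨w, rfl⟩ := hv.ge hy
    clear hy
    change w ∈ (LinearMap.range (lin ((inductionFunctor k H A).map f))).comap _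
    induction w using BalancedTensor.induction_on with
    | zero => exact Submodule.zero_mem _
    | add x y hx hy => exact Submodule.add_mem _ hx hy
    | tmul n a =>
      obtain ⟨x, hx⟩ := (h (v.hom n)).1 (congrArg (fun t => t.hom n) hvg)
      refine ⟨BalancedTensor.mk k _ X A (x ⊗ₜ a), ?_⟩
      rw [lin_map_mk, lin_map_mk, hx]
  · intro h
    have hfg : f ≫ g = 0 := eq_zero_of_lin_map_eq_zero <| by
      rw [Functor.map_comp, lin_comp]
      ext x
      exact h.apply_apply_eq_zero x
    intro y
    refine ⟨fun hy => ?_, fun ⟨x, hx⟩ => hx ▸ congrArg (fun t => t.hom x) hfg⟩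
    let R := ModuleCat.of (coinvariants k H A)ᵐᵒᵖ (coinvariants k H A)ᵐᵒᵖ
    -- With `v` picking out `y` and `q` the cokernel of `f`, the claim is `v ≫ q = 0`, which
    -- faithfulness allows to be checked after induction.
    let v : R ⟶ Y := ModuleCat.ofHom (LinearMap.toSpanSingleton _ _ y)
    let q : Y ⟶ ModuleCat.of (coinvariants k H A)ᵐᵒᵖ (Y ⧸ LinearMap.range f.hom) :=
      ModuleCat.ofHom (LinearMap.range f.hom).mkQ
    have hvg : v ≫ g = 0 := by
      ext
      change g.hom ((1 : (coinvariants k H A)ᵐᵒᵖ) • y) = 0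
      rw [one_smul, hy]
    have hfq : f ≫ q = 0 := by
      ext x
      exact (Submodule.Quotient.mk_eq_zero _).2 ⟨x, rfl⟩
    have hvq : v ≫ q = 0 := eq_zero_of_lin_map_eq_zero <| by
      rw [Functor.map_comp, lin_comp]
      ext w
      obtain ⟨x, hx⟩ := (h (lin ((inductionFunctor k H A).map v) w)).1 (by
        rw [← LinearMap.comp_apply, ← lin_comp, ← Functor.map_comp, hvg, lin_map_zero]
        rfl)
      rw [LinearMap.comp_apply, ← hx, ← LinearMap.comp_apply, ← lin_comp, ← Functor.map_comp, hfq,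
        lin_map_zero]
      rfl
    have := congrArg (fun t => t.hom (1 : (coinvariants k H A)ᵐᵒᵖ)) hvq
    have h1 : (LinearMap.range f.hom).mkQ ((1 : (coinvariants k H A)ᵐᵒᵖ) • y) = 0 := this
    rw [one_smul] at h1
    exact (Submodule.Quotient.mk_eq_zero _).1 h1

/-- Test modules carry their own `k`-structure, while `inductionFunctor` uses the one restricted
from the ring; this identifies the two. -/
theorem eq_restrictScalars {k R N : Type*} [CommRing k] [Ring R] [Algebra k R] [AddCommGroup N]
    (i : Module k N) [Module R N] [IsScalarTower k R N] :
    i = Module.restrictScalars k R N := by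
  refine Module.ext ?_
  funext c n
  have : c • n = algebraMap k R c • n := (algebraMap_smul R c n).symm
  exact this

theorem isLeftFaithfullyFlat_of_isEquivalence :
    IsLeftFaithfullyFlat.{u} k (coinvariants k H A) A := by
  intro N₁ N₂ N₃ _ i₁ _ _ _ i₂ _ _ _ i₃ _ _ f g
  obtain rfl := eq_restrictScalars (R := (coinvariants k H A)ᵐᵒᵖ) i₁
  obtain rfl := eq_restrictScalars (R := (coinvariants k H A)ᵐᵒᵖ) i₂
  obtain rfl := eq_restrictScalars (R := (coinvariants k H A)ᵐᵒᵖ) i₃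
  exact exact_iff_of_isEquivalence (ModuleCat.ofHom f) (ModuleCat.ofHom g)

end Equivalence

end Category

/-! ### Splittings and faithful flatness. -/

namespace BalancedTensor

section Splitting

variable {k R P : Type*} [CommRing k] [Ring R] [Algebra k R] [AddCommGroup P] [Module k P]
  [Module Rᵐᵒᵖ P] [IsScalarTower k Rᵐᵒᵖ P] (M : Type*) [AddCommGroup M] [Module k M] [Module R M]
  [IsScalarTower k R M]

/-- The map `p ⊗ m ↦ Σ q ⊗ r m`, where `σ(p) = Σ q ⊗ r`. -/
noncomputable def splitting (σ : P →ₗ[k] P ⊗[k] R)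
    (hσ : ∀ p r, σ (op r • p) = ((LinearMap.mul k R).flip r).lTensor P (σ p)) :
    BalancedTensor k R P M →ₗ[k] P ⊗[k] M :=
  lift ((TensorProduct.lift (Algebra.lsmul k k M).toLinearMap).lTensor P ∘ₗ
      (TensorProduct.assoc k P R M).toLinearMap ∘ₗ σ.rTensor M) <| by
    intro p r m
    simp only [LinearMap.comp_apply, LinearMap.rTensor_tmul, hσ]
    generalize σ p = z
    induction z with
    | zero => simp
    | add x y hx hy => simp only [map_add, TensorProduct.add_tmul, hx, hy]
    | tmul q s => simp

variable {M} in
theorem splitting_mk_tmul (σ : P →ₗ[k] P ⊗[k] R)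
    (hσ : ∀ p r, σ (op r • p) = ((LinearMap.mul k R).flip r).lTensor P (σ p)) (p : P) (m : M) :
    splitting M σ hσ (mk k R P M (p ⊗ₜ m)) =
      ((Algebra.lsmul k k M).toLinearMap.flip m).lTensor P (σ p) := by
  simp only [splitting, lift_mk, LinearMap.comp_apply, LinearMap.rTensor_tmul]
  generalize σ p = z
  induction z with
  | zero => simp
  | add x y hx hy => simp only [map_add, TensorProduct.add_tmul, hx, hy]
  | tmul q s => simp

/-- With `mk_splitting`, this naturality makes `P ⊗_R M` a natural retract of `P ⊗ M` over the base,
through which exactness passes when the base is a field. -/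
theorem splitting_map {M' : Type*} [AddCommGroup M'] [Module k M'] [Module R M']
    [IsScalarTower k R M'] (σ : P →ₗ[k] P ⊗[k] R)
    (hσ : ∀ p r, σ (op r • p) = ((LinearMap.mul k R).flip r).lTensor P (σ p)) (f : M →ₗ[R] M')
    (x : BalancedTensor k R P M) :
    splitting M' σ hσ (map (k := k) LinearMap.id f x) =
      (f.restrictScalars k).lTensor P (splitting M σ hσ x) := by
  induction x using BalancedTensor.induction_on with
  | zero => simp
  | add x y hx hy => simp only [map_add, hx, hy]
  | tmul p m =>
    rw [map_mk_tmul, splitting_mk_tmul, splitting_mk_tmul, ← LinearMap.lTensor_comp_apply,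
      LinearMap.id_apply]
    congr 2
    ext
    simp

theorem mk_splitting (σ : P →ₗ[k] P ⊗[k] R)
    (hσ : ∀ p r, σ (op r • p) = ((LinearMap.mul k R).flip r).lTensor P (σ p))
    (h : ∀ p, TensorProduct.lift (rightAction k R P) (σ p) = p) (x : BalancedTensor k R P M) :
    mk k R P M (splitting M σ hσ x) = x := by
  induction x using BalancedTensor.induction_on with
  | zero => simp
  | add x y hx hy => simp only [map_add, hx, hy]
  | tmul p m =>
    rw [splitting_mk_tmul]
    conv_rhs => rw [← h p]
    generalize σ p = z
    induction z with
    | zero => simp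
    | add x y hx hy => simp only [map_add, TensorProduct.add_tmul, hx, hy]
    | tmul q s => simp [mk_smul_tmul]

/-- The map `p ⊗ m ↦ t(p) m`. -/
noncomputable def evalLeft (t : P →ₗ[Rᵐᵒᵖ] R) : BalancedTensor k R P M →ₗ[k] M :=
  lift (TensorProduct.lift ((Algebra.lsmul k k M).toLinearMap ∘ₗ t.restrictScalars k)) <| by
    intro p r m
    simp

@[simp]
theorem evalLeft_mk_tmul (t : P →ₗ[Rᵐᵒᵖ] R) (p : P) (m : M) :
    evalLeft M t (mk k R P M (p ⊗ₜ m)) = t p • m :=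
  lift_mk _ _ _

variable {M} in
/-- The map `p ⊗ m ↦ p t(m)`. -/
noncomputable def evalRight (t : M →ₗ[R] R) : BalancedTensor k R P M →ₗ[k] P :=
  lift (TensorProduct.lift ((rightAction k R P).compl₂ (t.restrictScalars k))) <| by
    intro p r m
    simp [mul_smul]

variable {M} in
@[simp]
theorem evalRight_mk_tmul (t : M →ₗ[R] R) (p : P) (m : M) :
    evalRight t (mk k R P M (p ⊗ₜ m)) = op (t m) • p :=
  lift_mk _ _ _

end Splitting

end BalancedTensor

/-- A right module is faithfully flat if the action `P ⊗ R → P` splits and `R` is a direct summand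
of `P`. -/
theorem isRightFaithfullyFlat_of_splitting {k R P : Type*} [Field k] [Ring R] [Algebra k R]
    [AddCommGroup P] [Module k P] [Module Rᵐᵒᵖ P] [IsScalarTower k Rᵐᵒᵖ P]
    (σ : P →ₗ[k] P ⊗[k] R)
    (hσ : ∀ p r, σ (op r • p) = ((LinearMap.mul k R).flip r).lTensor P (σ p))
    (h : ∀ p, TensorProduct.lift (rightAction k R P) (σ p) = p)
    (t : P →ₗ[Rᵐᵒᵖ] R) (e : P) (ht : t e = 1) : IsRightFaithfullyFlat.{u} k R P := by
  intro M₁ M₂ M₃ _ _ _ _ _ _ _ _ _ _ _ _ f g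
  have hmk : ∀ z, BalancedTensor.map (k := k) (LinearMap.id : P →ₗ[Rᵐᵒᵖ] P) f
      (BalancedTensor.mk k R P M₁ z) =
        BalancedTensor.mk k R P M₂ ((f.restrictScalars k).lTensor P z) := by
    intro z
    induction z with
    | zero => simp
    | add x y hx hy => simp only [map_add, hx, hy]
    | tmul => simp
  constructor
  · intro hfg x
    refine ⟨fun hx => ?_, ?_⟩
    · obtain ⟨z, hz⟩ := (Module.Flat.lTensor_exact P (f := f.restrictScalars k)
        (g := g.restrictScalars k) hfg (BalancedTensor.splitting M₂ σ hσ x)).1 (by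
          rw [← BalancedTensor.splitting_map, hx, map_zero])
      exact ⟨BalancedTensor.mk k R P M₁ z, by rw [hmk, hz, BalancedTensor.mk_splitting _ _ _ h]⟩
    · rintro ⟨y, rfl⟩
      rw [BalancedTensor.map_id_comp, hfg.linearMap_comp_eq_zero]
      induction y using BalancedTensor.induction_on with
      | zero => simp
      | add x y hx hy => simp only [map_add, hx, hy, add_zero]
      | tmul => simp
  · intro hfg x
    have hev : ∀ (z : BalancedTensor k R P M₁), BalancedTensor.evalLeft M₂ t
        (BalancedTensor.map (k := k) LinearMap.id f z) =
          f (BalancedTensor.evalLeft M₁ t z) := by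
      intro z
      induction z using BalancedTensor.induction_on with
      | zero => simp
      | add x y hx hy => simp only [map_add, hx, hy]
      | tmul => simp
    -- Since `t e = 1`, the map `n ↦ e ⊗ n` is a natural section of `evalLeft`, so a module is a
    -- retract of its tensor product with `P` and exactness is reflected.
    have h1 : ∀ {N : Type u} [AddCommGroup N] [Module k N] [Module R N] [IsScalarTower k R N]
        (n : N), BalancedTensor.evalLeft N t (BalancedTensor.mk k R P N (e ⊗ₜ n)) = n := by
      intro N _ _ _ _ n
      rw [BalancedTensor.evalLeft_mk_tmul, ht, one_smul]
    refine ⟨fun hx => ?_, ?_⟩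
    · obtain ⟨z, hz⟩ := (hfg (BalancedTensor.mk k R P M₂ (e ⊗ₜ x))).1 (by simp [hx])
      exact ⟨BalancedTensor.evalLeft M₁ t z, by rw [← hev, hz, h1]⟩
    · rintro ⟨y, rfl⟩
      have := hfg.apply_apply_eq_zero (BalancedTensor.mk k R P M₁ (e ⊗ₜ y))
      rw [BalancedTensor.map_mk_tmul, BalancedTensor.map_mk_tmul] at this
      rw [← h1 (g (f y))]
      exact (congrArg _ this).trans (map_zero _)

/-! ### Projectivity from a splitting of the action. -/

section Projective

variable {k R P : Type*} [Field k] [Ring R] [Algebra k R] [AddCommGroup P] [Module k P]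

/-- The map `σ` is an `R`-linear section of `R ⊗ P → P`, and `R ⊗ P` is projective because `k` is a
field. -/
theorem projective_of_left_splitting [Module R P] [IsScalarTower k R P]
    (σ : P →ₗ[k] R ⊗[k] P)
    (hσ : ∀ r p, σ (r • p) = (LinearMap.mul k R r).rTensor P (σ p))
    (h : ∀ p, TensorProduct.lift (Algebra.lsmul k k P).toLinearMap (σ p) = p) :
    Module.Projective R P := by
  let i : P →ₗ[R] R ⊗[k] P :=
    { σ with
      map_smul' := fun r p => by
        refine (hσ r p).trans ?_
        change _ = r • σ p
        generalize σ p = z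
        induction z with
        | zero => simp
        | add x y hx hy => simp only [map_add, smul_add, hx, hy]
        | tmul x y => simp [TensorProduct.smul_tmul'] }
  let s : R ⊗[k] P →ₗ[R] P :=
    { TensorProduct.lift (Algebra.lsmul k k P).toLinearMap with
      map_smul' := fun r z => by
        change TensorProduct.lift (Algebra.lsmul k k P).toLinearMap (r • z) =
          r • TensorProduct.lift (Algebra.lsmul k k P).toLinearMap z
        induction z with
        | zero => simp
        | add x y hx hy => simp only [map_add, smul_add, hx, hy]
        | tmul x y => simp [TensorProduct.smul_tmul'] }
  exact Module.Projective.of_split i s (LinearMap.ext h)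

theorem projective_of_right_splitting [Module Rᵐᵒᵖ P] [IsScalarTower k Rᵐᵒᵖ P]
    (σ : P →ₗ[k] P ⊗[k] R)
    (hσ : ∀ p r, σ (op r • p) = ((LinearMap.mul k R).flip r).lTensor P (σ p))
    (h : ∀ p, TensorProduct.lift (rightAction k R P) (σ p) = p) :
    Module.Projective Rᵐᵒᵖ P := by
  let c : P ⊗[k] R →ₗ[k] Rᵐᵒᵖ ⊗[k] P :=
    (opLinearEquiv k (M := R)).toLinearMap.rTensor P ∘ₗ (TensorProduct.comm k P R).toLinearMap
  refine projective_of_left_splitting (k := k) (c ∘ₗ σ) (fun r p => ?_) fun p => ?_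
  · induction r using MulOpposite.rec' with
    | h r =>
      rw [LinearMap.comp_apply, hσ]
      change c _ = LinearMap.rTensor P _ (c (σ p))
      generalize σ p = z
      induction z with
      | zero => simp
      | add x y hx hy => simp only [map_add, hx, hy]
      | tmul x y => simp [c]
  · conv_rhs => rw [← h p]
    rw [LinearMap.comp_apply]
    generalize σ p = z
    induction z with
    | zero => simp
    | add x y hx hy => simp only [map_add, hx, hy]
    | tmul x y => simp [c]

end Projective

open Coalgebra HopfAlgebra

/-! ### Total integrals and lifts of the translation map. -/

section Integral

variable (k H A : Type*) [Field k] [Ring H] [HopfAlgebra k H] [Ring A] [Algebra k A]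
  [RightComoduleAlgebra k H A]

/-- An inverse `T` of the antipode, a total integral `γ` and a lift `ℓ` of the translation map. -/
structure SplittingData where
  T : H →ₗ[k] H
  γ : H →ₗ[k] A
  ℓ : H →ₗ[k] A ⊗[k] A
  inv_antipode : ∀ h, T (antipode k h) = h
  antipode_inv : ∀ h, antipode k (T h) = h
  coaction_γ : ∀ h, coaction k H A (γ h) = γ.rTensor H (comul h)
  γ_one : γ 1 = 1
  isTranslationLift : IsTranslationLift ℓ

end Integral

/-- The unit `k → A` is colinear for the trivial coaction on `k`; injectivity extends it along the
unit of `H`, which is injective thanks to the counit. -/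
theorem exists_total_integral {k H A : Type u} [Field k] [Ring H] [Bialgebra k H] [Ring A]
    [Algebra k A] [RightComoduleAlgebra k H A] (hA : IsInjectiveComodule.{u} k H A) :
    ∃ γ : H →ₗ[k] A, (∀ h, coaction k H A (γ h) = γ.rTensor H (comul h)) ∧ γ 1 = 1 := by
  let _ : RightComodule k H k :=
    { coact := (TensorProduct.mk k k H).flip 1
      coact_coassoc := by ext; simp [Algebra.TensorProduct.one_def]
      coact_counit := by ext; simp }
  let _ : RightComodule k H H :=
    { coact := comul
      coact_coassoc := Coalgebra.coassoc
      coact_counit := by ext; simp }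
  obtain ⟨γ, hγ, hγ'⟩ := hA k H (Algebra.linearMap k H) (Algebra.linearMap k A) (by
      ext
      change (Algebra.linearMap k H).rTensor H ((1 : k) ⊗ₜ (1 : H)) =
        comul (R := k) (algebraMap k H 1)
      simp [Algebra.TensorProduct.one_def]) (by
      intro a b h
      simpa using congrArg (counit (R := k) (A := H)) h) (by
      ext
      change (Algebra.linearMap k A).rTensor H ((1 : k) ⊗ₜ (1 : H)) =
        coaction k H A (algebraMap k A 1)
      simp [Algebra.TensorProduct.one_def, coaction_one])
  refine ⟨γ, fun h => (hγ.apply h).symm, ?_⟩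
  simpa using LinearMap.congr_fun hγ' 1

/-- Over a field the surjection `preGaloisMap` has a linear section; its restriction to `1 ⊗ H` is
`ℓ`. No compatibility of `ℓ` with actions or coactions is needed. -/
theorem nonempty_splittingData {k H A : Type u} [Field k] [Ring H] [HopfAlgebra k H] [Ring A]
    [Algebra k A] [RightComoduleAlgebra k H A]
    (hS : Function.Bijective (antipode k : H →ₗ[k] H)) (hβ : Function.Surjective (galoisMap k H A))
    (hA : IsInjectiveComodule.{u} k H A) : Nonempty (SplittingData k H A) := by
  obtain ⟨γ, hγ, hγ1⟩ := exists_total_integral hA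
  have hβ' : Function.Surjective (preGaloisMap k H A) :=
    hβ.comp (balancedRel k (coinvariants k H A) A A).mkQ_surjective
  obtain ⟨s, hs⟩ := (preGaloisMap k H A).exists_rightInverse_of_surjective
    (LinearMap.range_eq_top.2 hβ')
  let e := LinearEquiv.ofBijective (antipode k : H →ₗ[k] H) hS
  exact ⟨⟨e.symm, γ, s ∘ₗ TensorProduct.mk k A H 1, e.symm_apply_apply, e.apply_symm_apply, hγ, hγ1,
    fun h => LinearMap.congr_fun hs _⟩⟩

/-! ### Coinvariants of a Hopf module as a `B`-module. -/

section Coinvariants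

variable (k H A M : Type*) [Field k] [Ring H] [Bialgebra k H] [Ring A] [Algebra k A]
  [RightComoduleAlgebra k H A] [AddCommGroup M] [Module k M] [Module Aᵐᵒᵖ M]
  [IsScalarTower k Aᵐᵒᵖ M] [RightComodule k H M] [IsHopfModule k H A M]

/-- The space of coinvariants of a comodule. -/
def comoduleCoinvariants (k H M : Type*) [CommRing k] [Ring H] [Bialgebra k H] [AddCommGroup M]
    [Module k M] [RightComodule k H M] : Submodule k M :=
  LinearMap.eqLocus (coaction k H M) ((TensorProduct.mk k M H).flip 1)

instance comoduleCoinvariantsModule :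
    Module (coinvariants k H A)ᵐᵒᵖ (comoduleCoinvariants k H M) where
  smul b m := ⟨op (b.unop : A) • (m : M), by
    change coaction k H M (op (b.unop : A) • (m : M)) = (op (b.unop : A) • (m : M)) ⊗ₜ 1
    rw [IsHopfModule.coact_smul, show coaction k H M m = _ from m.2,
      show coaction k H A (b.unop : A) = _ from b.unop.2]
    simp⟩
  one_smul m := Subtype.ext (one_smul Aᵐᵒᵖ (m : M))
  mul_smul b c m := Subtype.ext (mul_smul (op (b.unop : A)) (op (c.unop : A)) (m : M))
  smul_zero b := Subtype.ext (smul_zero (op (b.unop : A)))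
  smul_add b m n := Subtype.ext (smul_add (op (b.unop : A)) (m : M) n)
  add_smul b c m := Subtype.ext (add_smul (op (b.unop : A)) (op (c.unop : A)) (m : M))
  zero_smul m := Subtype.ext (zero_smul Aᵐᵒᵖ (m : M))

end Coinvariants

theorem exists_lift_rTensor {k V N M C : Type*} [Field k] [AddCommGroup V] [Module k V]
    [AddCommGroup N] [Module k N] [AddCommGroup M] [Module k M] [AddCommGroup C] [Module k C]
    {ι : N →ₗ[k] M} (hι : Function.Injective ι) (f : V →ₗ[k] M ⊗[k] C)
    (hf : ∀ v, f v ∈ LinearMap.range (ι.rTensor C)) :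
    ∃ g : V →ₗ[k] N ⊗[k] C, ∀ v, ι.rTensor C (g v) = f v := by
  obtain ⟨r, hr⟩ := LinearMap.exists_leftInverse_of_injective (ι.rTensor C)
    (LinearMap.ker_eq_bot.2 (Module.Flat.rTensor_preserves_injective_linearMap _ hι))
  refine ⟨r ∘ₗ f, fun v => ?_⟩
  obtain ⟨w, hw⟩ := hf v
  rw [LinearMap.comp_apply, ← hw, ← LinearMap.comp_apply, ← LinearMap.comp_apply,
    LinearMap.comp_assoc, hr, LinearMap.comp_id]

/-! ### Projectivity, direct summands and right faithful flatness. -/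

namespace SplittingData

variable {k H A M : Type*} [Field k] [Ring H] [HopfAlgebra k H] [Ring A] [Algebra k A]
  [RightComoduleAlgebra k H A] (D : SplittingData k H A) [AddCommGroup M] [Module k M]
  [Module Aᵐᵒᵖ M] [IsScalarTower k Aᵐᵒᵖ M] [RightComodule k H M] [IsHopfModule k H A M]

theorem coaction_twistTrace (a : A) (m : M) :
    coaction k H M (coinvTrace M (twist D.T D.γ a) m) =
      coinvTrace M (twist D.T D.γ a) m ⊗ₜ 1 :=
  coaction_coinvTrace (coaction_twist D.inv_antipode D.antipode_inv D.coaction_γ a) m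

/-- Every left leg is a trace of the colinear map `twist D.T D.γ x`, hence coinvariant. -/
theorem hopfSplitting_mem {N : Type*} [AddCommGroup N] [Module k N] (ι : N →ₗ[k] M)
    (hι : ∀ m, coaction k H M m = m ⊗ₜ 1 → m ∈ LinearMap.range ι) (m : M) :
    hopfSplitting D.T D.γ D.ℓ M m ∈ LinearMap.range (ι.rTensor A) := by
  rw [hopfSplitting, LinearMap.comp_apply]
  generalize coaction k H M m = z
  induction z with
  | zero => simp
  | add x y hx hy => rw [map_add]; exact Submodule.add_mem _ hx hy
  | tmul m h =>
    rw [hopfSplittingAux_tmul]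
    generalize D.ℓ h = w
    induction w with
    | zero => simp
    | add x y hx hy => rw [map_add]; exact Submodule.add_mem _ hx hy
    | tmul x y =>
      obtain ⟨n, hn⟩ := hι _ (D.coaction_twistTrace x m)
      exact ⟨n ⊗ₜ y, congrArg (· ⊗ₜ[k] y) hn⟩

theorem rightSplitting_mem (a : A) : TensorProduct.comm k A A (rightSplitting D.T D.γ D.ℓ a) ∈
    LinearMap.range ((coinvariants k H A).val.toLinearMap.rTensor A) := by
  rw [rightSplitting, LinearMap.comp_apply]
  generalize coaction k H A a = z
  induction z with
  | zero => simp
  | add x y hx hy => rw [map_add, map_add]; exact Submodule.add_mem _ hx hy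
  | tmul m h =>
    rw [rightSplittingAux_tmul]
    generalize D.ℓ (D.T h) = w
    induction w with
    | zero => simp
    | add x y hx hy => rw [map_add, map_add]; exact Submodule.add_mem _ hx hy
    | tmul x y => exact ⟨⟨_, D.coaction_twistTrace m y⟩ ⊗ₜ x, rfl⟩

/-- The projection `a ↦ a₍₀₎ γ(S a₍₁₎)` of `A` onto the coinvariants, as a map of left modules. -/
noncomputable def leftRetraction : A →ₗ[coinvariants k H A] coinvariants k H A where
  toFun a := ⟨coinvTrace A D.γ a, coaction_coinvTrace D.coaction_γ a⟩
  map_add' a b := Subtype.ext (map_add _ a b)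
  map_smul' b a := Subtype.ext (coinvTrace_op_smul D.γ b.2 a)

theorem leftRetraction_coe (b : coinvariants k H A) : D.leftRetraction (b : A) = b :=
  Subtype.ext (coinvTrace_of_coinvariant D.γ_one b.2)

/-- A projection of `A` onto the coinvariants, as a map of right modules. -/
noncomputable def rightRetraction : A →ₗ[(coinvariants k H A)ᵐᵒᵖ] coinvariants k H A where
  -- As `1` is coinvariant, this value is `γ(T a₁) a₀`.
  toFun a := ⟨coinvTrace A (twist D.T D.γ a) 1, D.coaction_twistTrace a 1⟩
  map_add' a b := Subtype.ext (by simp)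
  map_smul' b a := by
    induction b using MulOpposite.rec' with
    | h b =>
      refine Subtype.ext ?_
      have : twist D.T D.γ (a * (b : A)) = (LinearMap.mul k A).flip (b : A) ∘ₗ twist D.T D.γ a := by
        ext h
        simp [twist_mul_coe]
      change coinvTrace A (twist D.T D.γ (a * (b : A))) 1 =
        coinvTrace A (twist D.T D.γ a) 1 * (b : A)
      rw [this, ← op_smul_coinvTrace]
      rfl

theorem rightRetraction_coe (b : coinvariants k H A) : D.rightRetraction (b : A) = b := by
  have h1 : D.rightRetraction (1 : A) = 1 := by
    have : twist D.T D.γ (1 : A) = D.γ := LinearMap.ext (twist_one D.inv_antipode)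
    refine Subtype.ext ?_
    change coinvTrace A (twist D.T D.γ (1 : A)) 1 = 1
    rw [this]
    exact coinvTrace_of_coinvariant D.γ_one (coaction_one k H A)
  have h := D.rightRetraction.map_smul (op b) (1 : A)
  rw [h1, op_smul_def, one_mul] at h
  exact h.trans (one_mul b)

theorem exists_isCompl_leftSubmodule (D : SplittingData k H A) :
    ∃ C : Submodule (coinvariants k H A) A,
      IsCompl (leftSubmodule (coinvariants k H A)) C := by
  let f : A →ₗ[coinvariants k H A] A :=
    (leftSubmodule (coinvariants k H A)).subtype ∘ₗ
      ({ toFun := id, map_add' := fun _ _ => rfl, map_smul' := fun _ _ => rfl } :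
        coinvariants k H A →ₗ[coinvariants k H A] leftSubmodule (coinvariants k H A)) ∘ₗ
          D.leftRetraction
  exact ⟨_, LinearMap.IsProj.isCompl (f := f) ⟨fun a => (D.leftRetraction a).2,
    fun b hb => congrArg Subtype.val (D.leftRetraction_coe ⟨b, hb⟩)⟩⟩

theorem exists_isCompl_rightSubmodule (D : SplittingData k H A) :
    ∃ C : Submodule (coinvariants k H A)ᵐᵒᵖ A,
      IsCompl (rightSubmodule (coinvariants k H A)) C := by
  let f : A →ₗ[(coinvariants k H A)ᵐᵒᵖ] A :=
    (rightSubmodule (coinvariants k H A)).subtype ∘ₗ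
      ({ toFun := id, map_add' := fun _ _ => rfl, map_smul' := fun _ _ => rfl } :
        coinvariants k H A →ₗ[(coinvariants k H A)ᵐᵒᵖ] rightSubmodule (coinvariants k H A)) ∘ₗ
          D.rightRetraction
  exact ⟨_, LinearMap.IsProj.isCompl (f := f) ⟨fun a => (D.rightRetraction a).2,
    fun b hb => congrArg Subtype.val (D.rightRetraction_coe ⟨b, hb⟩)⟩⟩

theorem exists_left_splitting (D : SplittingData k H A) :
    ∃ σ : A →ₗ[k] coinvariants k H A ⊗[k] A,
      (∀ a, (coinvariants k H A).val.toLinearMap.rTensor A (σ a) =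
        hopfSplitting D.T D.γ D.ℓ A a) ∧
      ∀ a, TensorProduct.lift (Algebra.lsmul k k A).toLinearMap (σ a) = a := by
  obtain ⟨σ, hσ⟩ := exists_lift_rTensor (ι := (coinvariants k H A).val.toLinearMap)
    Subtype.val_injective _ (D.hopfSplitting_mem (M := A) _ fun m hm => ⟨⟨m, hm⟩, rfl⟩)
  refine ⟨σ, hσ, fun a => ?_⟩
  have h := rightAction_hopfSplitting D.inv_antipode D.antipode_inv D.γ_one
    D.isTranslationLift a
  rw [← hσ] at h
  refine Eq.trans ?_ h
  generalize σ a = z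
  induction z with
  | zero => simp
  | add x y hx hy => simp only [map_add, hx, hy]
  | tmul x y => rfl

theorem projective_left (D : SplittingData k H A) : Module.Projective (coinvariants k H A) A := by
  obtain ⟨σ, hσ, hσ'⟩ := D.exists_left_splitting
  refine projective_of_left_splitting σ (fun b a => ?_) hσ'
  · apply Module.Flat.rTensor_preserves_injective_linearMap (M := A)
      (coinvariants k H A).val.toLinearMap Subtype.val_injective
    refine (hσ _).trans ((hopfSplitting_op_smul (M := A) b.2 a).trans ?_)
    rw [← hσ]
    change _ = LinearMap.rTensor A _ (LinearMap.rTensor A _ (σ a))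
    rw [← LinearMap.rTensor_comp_apply, ← LinearMap.rTensor_comp_apply]
    rfl

theorem exists_right_splitting (D : SplittingData k H A) :
    ∃ σ : A →ₗ[k] A ⊗[k] coinvariants k H A,
      (∀ p r, σ (op r • p) =
        ((LinearMap.mul k (coinvariants k H A)).flip r).lTensor A (σ p)) ∧
      ∀ p, TensorProduct.lift (rightAction k (coinvariants k H A) A) (σ p) = p := by
  obtain ⟨σ', hσ'⟩ := exists_lift_rTensor
    (ι := (coinvariants k H A).val.toLinearMap) Subtype.val_injective
    ((TensorProduct.comm k A A).toLinearMap ∘ₗ rightSplitting D.T D.γ D.ℓ) D.rightSplitting_mem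
  let σ : A →ₗ[k] A ⊗[k] coinvariants k H A :=
    (TensorProduct.comm k (coinvariants k H A) A).toLinearMap ∘ₗ σ'
  have hσ : ∀ a, (coinvariants k H A).val.toLinearMap.lTensor A (σ a) =
      rightSplitting D.T D.γ D.ℓ a := by
    intro a
    apply (TensorProduct.comm k A A).injective
    refine Eq.trans ?_ (hσ' a)
    change _ = LinearMap.rTensor A _ (σ' a)
    simp only [σ, LinearMap.comp_apply]
    generalize σ' a = z
    change coinvariants k H A ⊗[k] A at z
    induction z with
    | zero => simp
    | add x y hx hy => simp only [map_add, hx, hy]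
    | tmul x y => rfl
  have hinj : Function.Injective ((coinvariants k H A).val.toLinearMap.lTensor A) :=
    Module.Flat.lTensor_preserves_injective_linearMap _ Subtype.val_injective
  refine ⟨σ, fun a b => hinj ?_, fun a => ?_⟩
  · rw [hσ, op_smul_def, rightSplitting_mul_coe, ← hσ, ← LinearMap.lTensor_comp_apply,
      ← LinearMap.lTensor_comp_apply]
    rfl
  · have h := mul_rightSplitting D.inv_antipode D.antipode_inv D.γ_one D.isTranslationLift a
    rw [← hσ] at h
    refine Eq.trans ?_ h
    generalize σ a = z
    induction z with
    | zero => simp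
    | add x y hx hy => simp only [map_add, hx, hy]
    | tmul x y => rfl

theorem projective_right (D : SplittingData k H A) :
    Module.Projective (coinvariants k H A)ᵐᵒᵖ A := by
  obtain ⟨σ, h1, h2⟩ := D.exists_right_splitting
  exact projective_of_right_splitting σ h1 h2

/-- This side is read off from the splitting and the retraction onto `B`; the equivalence only
speaks of `A` as a left module. -/
theorem isRightFaithfullyFlat (D : SplittingData k H A) :
    IsRightFaithfullyFlat.{u} k (coinvariants k H A) A := by
  obtain ⟨σ, h1, h2⟩ := D.exists_right_splitting
  exact isRightFaithfullyFlat_of_splitting σ h1 h2 D.rightRetraction 1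
    (D.rightRetraction_coe 1)

end SplittingData

/-! ### Unit and counit of induction. -/

namespace SplittingData

section Unit

variable {k H A : Type u} {N N' : Type*} [Field k] [Ring H] [HopfAlgebra k H] [Ring A] [Algebra k A]
  [RightComoduleAlgebra k H A] (D : SplittingData k H A) [AddCommGroup N] [Module k N]
  [Module (coinvariants k H A)ᵐᵒᵖ N] [IsScalarTower k (coinvariants k H A)ᵐᵒᵖ N]
  [AddCommGroup N'] [Module k N']
  [Module (coinvariants k H A)ᵐᵒᵖ N'] [IsScalarTower k (coinvariants k H A)ᵐᵒᵖ N']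

theorem evalRight_mk_tmul_one (n : N) : BalancedTensor.evalRight D.leftRetraction
    (BalancedTensor.mk k (coinvariants k H A) N A (n ⊗ₜ 1)) = n := by
  have h : D.leftRetraction (1 : A) = 1 := D.leftRetraction_coe 1
  rw [BalancedTensor.evalRight_mk_tmul, h, op_one, one_smul]

/-- The trace with `γ` fixes coinvariants, and on `N ⊗_B A` it is `evalRight D.leftRetraction`
followed by `n ↦ n ⊗ 1`. So `N` maps onto the coinvariants of its induced module. -/
theorem mk_evalRight_tmul_one {x : BalancedTensor k (coinvariants k H A) N A}
    (hx : coaction k H _ x = x ⊗ₜ 1) : BalancedTensor.mk k (coinvariants k H A) N A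
      (BalancedTensor.evalRight D.leftRetraction x ⊗ₜ 1) = x := by
  conv_rhs => rw [← coinvTrace_of_coinvariant D.γ_one hx]
  clear hx
  induction x using BalancedTensor.induction_on with
  | zero => simp
  | add x y hx hy => simp only [map_add, TensorProduct.add_tmul, hx, hy]
  | tmul n a =>
    rw [BalancedTensor.evalRight_mk_tmul, mk_op_smul_tmul_one]
    have h := coinvTrace_op_smul D.γ (coaction_induced_mk_one (k := k) (H := H) (A := A) n) a
    rw [op_smul_mk, one_mul] at h
    exact h.symm

/-- Morphisms of induced Hopf modules are induced. -/
theorem exists_eq_map (D : SplittingData k H A)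
    (g : BalancedTensor k (coinvariants k H A) N A →ₗ[Aᵐᵒᵖ]
      BalancedTensor k (coinvariants k H A) N' A)
    (hc : IsColinear k H (g.restrictScalars k)) :
    ∃ f : N →ₗ[(coinvariants k H A)ᵐᵒᵖ] N',
      ∀ z, BalancedTensor.map (k := k) f LinearMap.id z = g z := by
  have hg : ∀ x : N, BalancedTensor.mk k (coinvariants k H A) N' A
      (BalancedTensor.evalRight D.leftRetraction
        (g (BalancedTensor.mk k (coinvariants k H A) N A (x ⊗ₜ 1))) ⊗ₜ 1) =
      g (BalancedTensor.mk k (coinvariants k H A) N A (x ⊗ₜ 1)) := by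
    intro x
    refine D.mk_evalRight_tmul_one ((hc.apply _).symm.trans ?_)
    rw [coaction_induced_mk_one]
    rfl
  let f : N →ₗ[(coinvariants k H A)ᵐᵒᵖ] N' :=
    { toFun := fun x => BalancedTensor.evalRight D.leftRetraction
        (g (BalancedTensor.mk k (coinvariants k H A) N A (x ⊗ₜ 1)))
      map_add' := fun x y => by simp only [TensorProduct.add_tmul, map_add]
      map_smul' := fun b x => by
        induction b using MulOpposite.rec' with
        | h b =>
          have hi : Function.Injective fun y : N' =>
              BalancedTensor.mk k (coinvariants k H A) N' A (y ⊗ₜ 1) :=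
            Function.LeftInverse.injective D.evalRight_mk_tmul_one
          apply hi
          simp only [RingHom.id_apply]
          rw [hg, mk_op_smul_tmul_one, map_smul, mk_op_smul_tmul_one, hg] }
  refine ⟨f, fun z => ?_⟩
  induction z using BalancedTensor.induction_on with
  | zero => rw [map_zero, map_zero]
  | add x y hx hy => rw [map_add, map_add, hx, hy]
  | tmul x a =>
    have h1 := op_smul_mk (coinvariants k H A) N' a 1 (f x)
    have h2 := op_smul_mk (coinvariants k H A) N a 1 x
    rw [one_mul] at h1 h2
    rw [BalancedTensor.map_mk_tmul, ← h2, map_smul, LinearMap.id_apply, ← h1]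
    exact congrArg _ (hg x)

end Unit

section Counit

variable {k H A : Type u} {M N : Type*} [Field k] [Ring H] [HopfAlgebra k H] [Ring A] [Algebra k A]
  [RightComoduleAlgebra k H A] [AddCommGroup M] [Module k M]
  [Module Aᵐᵒᵖ M] [IsScalarTower k Aᵐᵒᵖ M] [RightComodule k H M] [IsHopfModule k H A M]
  [AddCommGroup N] [Module k N] [Module (coinvariants k H A)ᵐᵒᵖ N]
  [IsScalarTower k (coinvariants k H A)ᵐᵒᵖ N]

/-- If `N` is the module of coinvariants of `M`, then `N ⊗_B A ≅ M`. -/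
theorem inducedMap_bijective (D : SplittingData k H A) (ι : N →ₗ[k] M)
    (hι : ∀ (b : coinvariants k H A) (n : N), ι (op b • n) = op (b : A) • ι n)
    (hinj : Function.Injective ι) (hc : ∀ n, coaction k H M (ι n) = ι n ⊗ₜ 1)
    (hs : ∀ m, coaction k H M m = m ⊗ₜ 1 → m ∈ LinearMap.range ι) :
    Function.Bijective (inducedMap ι hι) := by
  -- `g` is `hopfSplitting` with its coinvariant legs read in `N`; its class in `N ⊗_B A` is the
  -- inverse map.
  obtain ⟨g, hg⟩ := exists_lift_rTensor hinj _ (D.hopfSplitting_mem ι hs)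
  obtain ⟨σ, hσ, hσ'⟩ := D.exists_left_splitting
  have hind : ∀ z, inducedMap ι hι (BalancedTensor.mk k (coinvariants k H A) _ A z) =
      TensorProduct.lift (rightAction k A M) (ι.rTensor A z) := by
    intro z
    induction z with
    | zero => simp
    | add x y hx hy => simp only [map_add, hx, hy]
    | tmul x y => simp
  -- On the image of the induced map the splitting comes from that of `A`, whose left legs lie in
  -- `B` and can be moved across the tensor sign.
  have hgn : ∀ (n : N) (a : A), g (op a • ι n) =
      (rightAction k (coinvariants k H A) N n).rTensor A (σ a) := by
    intro n a
    apply Module.Flat.rTensor_preserves_injective_linearMap (M := A) ι hinj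
    rw [hg, hopfSplitting_op_smul (hc n) a, ← hσ, ← LinearMap.rTensor_comp_apply,
      ← LinearMap.rTensor_comp_apply]
    congr 2
    ext b
    simp [hι]
  have hleft : Function.LeftInverse (fun m => BalancedTensor.mk k (coinvariants k H A) _ A (g m))
      (inducedMap ι hι) := by
    intro x
    induction x using BalancedTensor.induction_on with
    | zero => simp
    | add x y hx hy => simp only [map_add, hx, hy]
    | tmul n a =>
      simp only [inducedMap_mk_tmul, hgn]
      conv_rhs => rw [← hσ' a]
      generalize σ a = z
      induction z with
      | zero => simp
      | add x y hx hy => simp only [map_add, TensorProduct.tmul_add, hx, hy]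
      | tmul b y => simp [BalancedTensor.mk_smul_tmul]
  refine ⟨hleft.injective, fun m => ⟨BalancedTensor.mk k _ _ A (g m), ?_⟩⟩
  rw [hind, hg]
  exact rightAction_hopfSplitting D.inv_antipode D.antipode_inv D.γ_one D.isTranslationLift m

end Counit

section Equivalence

open CategoryTheory HopfModuleCat

open scoped ModuleCat

variable {k H A : Type u} [Field k] [Ring H] [HopfAlgebra k H] [Ring A] [Algebra k A]
  [RightComoduleAlgebra k H A]

theorem faithful_inductionFunctor (D : SplittingData k H A) :
    (inductionFunctor k H A).Faithful where
  map_injective {X Y} f g h := by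
    ext x
    have h1 := LinearMap.congr_fun (congrArg lin h)
      (BalancedTensor.mk k (coinvariants k H A) X A (x ⊗ₜ 1))
    rw [lin_map_mk, lin_map_mk] at h1
    have h2 := congrArg (BalancedTensor.evalRight D.leftRetraction) h1
    rwa [evalRight_mk_tmul_one, evalRight_mk_tmul_one] at h2

theorem full_inductionFunctor (D : SplittingData k H A) : (inductionFunctor k H A).Full where
  map_surjective g := by
    obtain ⟨f, hf⟩ := D.exists_eq_map (lin g) (Hom.isColinear g)
    exact ⟨ModuleCat.ofHom f, HopfModuleCat.hom_ext (LinearMap.ext hf)⟩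

theorem lin_inducedHom_bijective (D : SplittingData k H A)
    {X : ModuleCat.{u} (coinvariants k H A)ᵐᵒᵖ} {M : HopfModuleCat k H A} (ι : X →+ M.carrier)
    (hι : ∀ (b : coinvariants k H A) (n : X), ι (op b • n) = op (b : A) • ι n)
    (hc : ∀ n, coaction k H M.carrier (ι n) = ι n ⊗ₜ 1) (hinj : Function.Injective ι)
    (hs : ∀ m, coaction k H M.carrier m = m ⊗ₜ 1 → ∃ n, ι n = m) :
    Function.Bijective (lin (inducedHom ι hι hc)) :=
  D.inducedMap_bijective _ hι hinj hc hs

theorem essSurj_inductionFunctor (D : SplittingData k H A) :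
    (inductionFunctor k H A).EssSurj where
  mem_essImage M := by
    let X := ModuleCat.of (coinvariants k H A)ᵐᵒᵖ (comoduleCoinvariants k H M.carrier)
    let φ : (inductionFunctor k H A).obj X ⟶ M := inducedHom (X := X)
      (comoduleCoinvariants k H M.carrier).subtype.toAddMonoidHom (fun _ _ => rfl) (fun n => n.2)
    exact ⟨X, ⟨isoOfBijective φ (D.lin_inducedHom_bijective _ _ _ Subtype.val_injective
      fun m hm => ⟨⟨m, hm⟩, rfl⟩)⟩⟩

theorem isEquivalence_inductionFunctor (D : SplittingData k H A) :
    (inductionFunctor k H A).IsEquivalence where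
  faithful := D.faithful_inductionFunctor
  full := D.full_inductionFunctor
  essSurj := D.essSurj_inductionFunctor

end Equivalence

end SplittingData

end HopfGalois

theorem mainTheorem5 {k H A : Type u} [Field k] [Ring H] [HopfAlgebra k H]
    (hS : Function.Bijective (HopfAlgebra.antipode k : H →ₗ[k] H))
    [Ring A] [Algebra k A] [RightComoduleAlgebra k H A] :
    List.TFAE
      [Function.Surjective (galoisMap k H A) ∧ IsInjectiveComodule.{u} k H A,
        IsHopfGalois k H A ∧ IsLeftFaithfullyFlat.{u} k (coinvariants k H A) A,
        IsHopfGalois k H A ∧ IsRightFaithfullyFlat.{u} k (coinvariants k H A) A,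
        (inductionFunctor k H A).IsEquivalence] ∧
    (Function.Surjective (galoisMap k H A) ∧ IsInjectiveComodule.{u} k H A →
      Module.Projective (coinvariants k H A) A ∧
      Module.Projective (coinvariants k H A)ᵐᵒᵖ A ∧
      (∃ C : Submodule (coinvariants k H A) A,
        IsCompl (leftSubmodule (coinvariants k H A)) C) ∧
      (∃ C : Submodule (coinvariants k H A)ᵐᵒᵖ A,
        IsCompl (rightSubmodule (coinvariants k H A)) C)) := by
  have h14 : Function.Surjective (galoisMap k H A) ∧ IsInjectiveComodule.{u} k H A →
      (inductionFunctor k H A).IsEquivalence := fun h =>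
    (nonempty_splittingData hS h.1 h.2).some.isEquivalence_inductionFunctor
  refine ⟨?_, fun h => ?_⟩
  · tfae_have 1 → 4 := h14
    tfae_have 4 → 2 := fun _ =>
      ⟨isHopfGalois_of_isEquivalence, isLeftFaithfullyFlat_of_isEquivalence⟩
    tfae_have 2 → 1 := fun h => ⟨h.1.2, isInjectiveComodule_of_left_faithfullyFlat hS h.1 h.2⟩
    -- Bijectivity of the Galois map comes from the equivalence, faithful flatness from the
    -- splitting data.
    tfae_have 1 → 3 := fun h =>
      have := h14 h
      ⟨isHopfGalois_of_isEquivalence,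
        (nonempty_splittingData hS h.1 h.2).some.isRightFaithfullyFlat⟩
    tfae_have 3 → 1 := fun h => ⟨h.1.2, isInjectiveComodule_of_right_faithfullyFlat h.1 h.2⟩
    tfae_finish
  · obtain ⟨D⟩ := nonempty_splittingData hS h.1 h.2
    exact ⟨D.projective_left, D.projective_right, D.exists_isCompl_leftSubmodule,
      D.exists_isCompl_rightSubmodule⟩
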